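/- Let $M$ be a compact smooth $n$-manifold, $n\ge 1$, with possibly empty boundary, let $d$ be any metric inducing its topology, and let $X$ be a $C^1$ vector field on $M$, inwardly transverse to $\partial M$ if $\partial M\neq\emptyset$, with induced flow $X_t$ (defined on $M$ for $t\ge 0$). Let $\omega(x)$ denote the set of limits of sequences $X_{t_k}(x)$ with $t_k\to\infty$, and let the basin of a set $B\subset M$ be $\{x\in M:\omega(x)\subset B\}$. A set $\Lambda\subset M$ is invariant if $X_t(\Lambda)=\Lambda$ for all $t$ (equivalently, for all $t\ge 0$); an attractor is an invariant set $A$ such that $A=\omega(x)$ for some $x\in A$ and $A=\bigcap_{t\ge0}X_t(U)$ for some compact neighborhood $U$ of $A$. A compact invariant set $\Lambda$ is saddle-type hyperbolic if there are a $DX_t$-invariant splitting $T_\Lambda M=E^s\oplus E^X\oplus E^u$, where $E^X_x$ is spanned by $X(x)$ and $E^s_x\ne0$, $E^u_x\neq0$ for all $x\in\Lambda$, a Riemannian metric $\|\cdot\|$ on $M$, and constants $K,\lambda>0$ such that, for all $x\in\Lambda$ and $t\ge0$, $\|DX_t(x)v\|\le Ke^{-\lambda t}\|v\|$ for $v\in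 E^s_x$ and $\|DX_t(x)v\|\ge K^{-1}e^{\lambda t}\|v\|$ for $v\in E^u_x$. Suppose there are finitely many attractors $A_1,\dots,A_r$ of $X$ that are saddle-type hyperbolic sets and finitely many singularities $\sigma_1,\dots,\sigma_l$ of $X$ (points with $X(\sigma_j)=0$) such that each $\{\sigma_j\}$ is a saddle-type hyperbolic set ($r=0$ or $l=0$ is allowed), and suppose that the union of the basins of $A_1,\dots,A_r,\{\sigma_1\},\dots,\{\sigma_l\}$ is dense in $M$. Then $X$ is sensitive to the initial conditions: there is $\delta>0$ such that for every $x\in M$ and every neighborhood $U$ of $x$ there are $y\in U$ and $t\ge0$ with $d(X_t(x),X_t(y))>\delta$. -/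

import Mathlib

open Set Filter Topology
open scoped Manifold ContDiff Bundle

noncomputable section

namespace HypAttr

/-! Throughout, an `n`-manifold with (possibly empty) boundary is modelled on the closed
half-space `{x ∈ ℝⁿ | 0 ≤ x₀}` through `𝓡∂ n`; a manifold without boundary is the case
`(𝓡∂ n).boundary M = ∅`. -/

variable {n : ℕ} [NeZero n] {M : Type*}

section Topological

variable [TopologicalSpace M] [ChartedSpace (EuclideanHalfSpace n) M]

/-- The vector field `X` is inwardly transverse to the boundary: read in the chart at a boundary
point, `X` has a positive component along the inner normal of the half-space. -/
def InwardlyTransverse (X : ∀ x : M, TangentSpace (𝓡∂ n) x) : Prop :=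
  ∀ x ∈ (𝓡∂ n).boundary M,
    0 < (show EuclideanSpace ℝ (Fin n) from
      mfderiv (𝓡∂ n) 𝓘(ℝ, EuclideanSpace ℝ (Fin n)) (extChartAt (𝓡∂ n) x) x (X x)) 0

open Classical in
/-- The induced flow `X_t(x)`: the value at time `t` of the integral curve `γ : [0, ∞) → M` of `X`
with `γ 0 = x`. (If no such curve existed the value would be `x`; for a `C¹` field on a compact
manifold, inwardly transverse to the boundary, it exists and is unique.) Only times `t ≥ 0` are
used: on a manifold with boundary a point need not have a past. -/
def flow (X : ∀ x : M, TangentSpace (𝓡∂ n) x) (t : ℝ) (x : M) : M :=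
  if h : ∃ γ : ℝ → M, γ 0 = x ∧ IsMIntegralCurveOn (I := 𝓡∂ n) γ X (Ici 0) then h.choose t else x

/-- The omega-limit set `ω(x)`. -/
def omegaSet (X : ∀ x : M, TangentSpace (𝓡∂ n) x) (x : M) : Set M :=
  omegaLimit atTop (flow X) {x}

/-- The basin of attraction of `B`. -/
def basin (X : ∀ x : M, TangentSpace (𝓡∂ n) x) (B : Set M) : Set M :=
  {x | omegaSet X x ⊆ B}

/-- `X_t(Λ) = Λ` for all `t ≥ 0`. As every `X_t`, `t ≥ 0`, is injective, this says that `Λ` lies in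
the maximal invariant set (where `X_t` is defined for all `t ∈ ℝ`) and that `X_t(Λ) = Λ` for all
`t ∈ ℝ`. -/
def InvariantSet (X : ∀ x : M, TangentSpace (𝓡∂ n) x) (Λ : Set M) : Prop :=
  ∀ t : ℝ, 0 ≤ t → flow X t '' Λ = Λ

/-- `Λ` is invariant and `Λ = ω(x)` for some `x ∈ Λ`. -/
def TransitiveSet (X : ∀ x : M, TangentSpace (𝓡∂ n) x) (Λ : Set M) : Prop :=
  InvariantSet X Λ ∧ ∃ x ∈ Λ, Λ = omegaSet X x

/-- `A` is transitive and `A = ⋂_{t ≥ 0} X_t(U)` for some compact neighborhood `U` of `A`. -/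
def Attractor (X : ∀ x : M, TangentSpace (𝓡∂ n) x) (A : Set M) : Prop :=
  TransitiveSet X A ∧
    ∃ U : Set M, IsCompact U ∧ U ∈ 𝓝ˢ A ∧ A = ⋂ t ∈ Ici (0 : ℝ), flow X t '' U

variable [IsManifold (𝓡∂ n) ∞ M]

/-- A smooth Riemannian metric on `M`. -/
abbrev RiemMetric (n : ℕ) [NeZero n] (M : Type*) [TopologicalSpace M]
    [ChartedSpace (EuclideanHalfSpace n) M] [IsManifold (𝓡∂ n) ∞ M] :=
  Bundle.ContMDiffRiemannianMetric (𝓡∂ n) ∞ (EuclideanSpace ℝ (Fin n))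
    (fun x : M => TangentSpace (𝓡∂ n) x)

/-- The norm of a tangent vector for a Riemannian metric. -/
def RiemMetric.norm (g : RiemMetric n M) (x : M) (v : TangentSpace (𝓡∂ n) x) : ℝ :=
  Real.sqrt (g.inner x v v)

/-- The derivative `DX_t(x) : T_x M → T_{X_t(x)} M` of the time-`t` map. -/
def dflow (X : ∀ x : M, TangentSpace (𝓡∂ n) x) (t : ℝ) (x : M) :
    TangentSpace (𝓡∂ n) x →L[ℝ] TangentSpace (𝓡∂ n) (flow X t x) :=
  mfderiv (𝓡∂ n) (𝓡∂ n) (flow X t) x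

/-- `T_Λ M = Es ⊕ E^X ⊕ Eu` is a hyperbolic splitting over `Λ`: it is `DX_t`-invariant,
`E^X` is spanned by `X`, and for some Riemannian metric and `K, lam > 0` the derivative
`DX_t` contracts `Es` by at least `K e^{-lam t}` and expands `Eu` by at least `K⁻¹ e^{lam t}`. -/
structure HyperbolicSplitting (X : ∀ x : M, TangentSpace (𝓡∂ n) x) (Λ : Set M)
    (Es Eu : ∀ x : M, Submodule ℝ (TangentSpace (𝓡∂ n) x)) : Prop where
  disjoint : ∀ x ∈ Λ, Disjoint (Es x) (Submodule.span ℝ {X x})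
  isCompl : ∀ x ∈ Λ, IsCompl (Es x ⊔ Submodule.span ℝ {X x}) (Eu x)
  map_stable : ∀ x ∈ Λ, ∀ t : ℝ, 0 ≤ t →
    (Es x).map (dflow X t x).toLinearMap = Es (flow X t x)
  map_unstable : ∀ x ∈ Λ, ∀ t : ℝ, 0 ≤ t →
    (Eu x).map (dflow X t x).toLinearMap = Eu (flow X t x)
  rates : ∃ (g : RiemMetric n M) (K lam : ℝ), 0 < K ∧ 0 < lam ∧
    (∀ x ∈ Λ, ∀ t : ℝ, 0 ≤ t → ∀ v ∈ Es x,
      g.norm (flow X t x) (dflow X t x v) ≤ K * Real.exp (-lam * t) * g.norm x v) ∧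
    (∀ x ∈ Λ, ∀ t : ℝ, 0 ≤ t → ∀ v ∈ Eu x,
      K⁻¹ * Real.exp (lam * t) * g.norm x v ≤ g.norm (flow X t x) (dflow X t x v))

/-- `Λ` is a saddle-type hyperbolic set: a compact invariant set with a hyperbolic splitting whose
stable and unstable subspaces are nonzero at every point of `Λ`. -/
def SaddleHyperbolicSet (X : ∀ x : M, TangentSpace (𝓡∂ n) x) (Λ : Set M) : Prop :=
  IsCompact Λ ∧ InvariantSet X Λ ∧
    ∃ Es Eu : ∀ x : M, Submodule ℝ (TangentSpace (𝓡∂ n) x),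
      HyperbolicSplitting X Λ Es Eu ∧ ∀ x ∈ Λ, Es x ≠ ⊥ ∧ Eu x ≠ ⊥

/-- A saddle-type hyperbolic attractor. -/
def SaddleHyperbolicAttractor (X : ∀ x : M, TangentSpace (𝓡∂ n) x) (A : Set M) : Prop :=
  Attractor X A ∧ SaddleHyperbolicSet X A

/-- A saddle-type hyperbolic singularity. -/
def SaddleHyperbolicSingularity (X : ∀ x : M, TangentSpace (𝓡∂ n) x) (σ : M) : Prop :=
  X σ = 0 ∧ SaddleHyperbolicSet X {σ}

end Topological

/-- `X` is sensitive to the initial conditions. -/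
def SensitiveToInitialConditions [MetricSpace M] [ChartedSpace (EuclideanHalfSpace n) M]
    (X : ∀ x : M, TangentSpace (𝓡∂ n) x) : Prop :=
  ∃ δ : ℝ, 0 < δ ∧ ∀ x : M, ∀ U ∈ 𝓝 x, ∃ y ∈ U, ∃ t : ℝ, 0 ≤ t ∧
    δ < dist (flow X t x) (flow X t y)

end HypAttr

end

open scoped NNReal

noncomputable section

namespace HypAttr

/-! ### Lipschitz equations on a normed space: short-time solutions and dependence on the initial
point. -/

section ODE

variable {F : Type*} [NormedAddCommGroup F] [NormedSpace ℝ F]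

/-! It suffices to treat one basin at a time. For each of the given hyperbolic sets Λ there is δ > 0
such that every y in the basin of Λ has points y' arbitrarily close to it whose orbits are at some
time more than δ away from that of y (`HypRates.exists_separation`). Finitely many δ have a positive
lower bound, the basins together are dense, and the triangle inequality carries the separation to
every point of M (`sensitiveToInitialConditions_of_dense_basins`).

Separation needs no invariant manifolds. Embed M in a Euclidean space by e, and measure tangent
vectors and pairs of points through e. Over Λ there are T > 0 and A > 1 such that a vector which the
time-T map expands by A/2 is expanded by 2A during the next T, and every vector of E^u is expanded
by 2A at once (`HypRates.exists_cone_criteria`). Strict differentiability turns this into a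
statement about pairs of nearby points near Λ: a pair expanded by A is expanded by A again
(`exists_nhds_expansion`). If all points of a neighborhood V of y stayed close to the orbit of y,
wait until this orbit is near Λ. The image of V is still a neighborhood, so it contains a point
displaced in an unstable direction. The distance between the two orbits then grows by A at every
step, for ever, which contradicts compactness.

The cone criterion compares E^s and E^u with the flow direction, along which growth is bounded above
and below only if X vanishes everywhere or nowhere on Λ. Hence a hyperbolic set Λ = ω(x), with x in
Λ, that contains a singularity σ must be shown to equal {σ} (`HypRates.eq_singleton_of_eq_zero`).
Otherwise the orbit of x makes arbitrarily long passages near σ, from z to w, with |X(z)| and |X(w)|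
bounded below. By counting dimensions, either E^s ⊕ E^X at z meets a subspace expanded throughout
the passage, or E^u ⊕ E^X at w meets one expanded throughout in backward time. Hyperbolicity of Λ
bounds both rates independently of the length of the passage, a contradiction. Neither continuity of
the splitting nor constancy of its dimensions is used.

The rest is foundation: the flow on a manifold with boundary, defined for t ≥ 0 only, and its being
a C¹ local diffeomorphism at interior points (`contMDiffAt_flow_and_injective`,
`image_flow_mem_nhds`). -/

theorem hasDerivWithinAt_Ici_of_Icc {c : ℝ → F} {c' : F} {a b t : ℝ} (ht : t ∈ Ico a b)
    (h : HasDerivWithinAt c c' (Icc a b) t) : HasDerivWithinAt c c' (Ici t) t :=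
  h.mono_of_mem_nhdsWithin (Icc_mem_nhdsGE_of_mem ht)

theorem exists_solution_of_lipschitz [CompleteSpace F] {v : ℝ → F → F} {K : ℝ≥0} {ε : ℝ}
    (hε : 0 ≤ ε) (hεK : ε * (K + 1) ≤ 1) (hv : ∀ t ∈ Icc 0 ε, LipschitzWith K (v t))
    (hc : ∀ x, ContinuousOn (v · x) (Icc 0 ε)) (x₀ : F) :
    ∃ c : ℝ → F, c 0 = x₀ ∧
      ∀ t ∈ Icc 0 ε, HasDerivWithinAt c (v t (c t)) (Icc 0 ε) t := by
  obtain ⟨B, hB⟩ := isCompact_Icc.exists_bound_of_continuousOn (hc x₀)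
  have hB0 : 0 ≤ B := (norm_nonneg _).trans (hB 0 ⟨le_rfl, hε⟩)
  lift B to ℝ≥0 using hB0
  -- On the ball of radius B + 1 about `x₀` the speed is at most B + K(B + 1) ≤ (K + 1)(B + 1), so
  -- solutions stay in it up to time 1/(K + 1): the existence time does not depend on `x₀`.
  have hPL : IsPicardLindelof v (tmin := 0) (tmax := ε) ⟨0, le_rfl, hε⟩ x₀ (B + 1) 0
      (B + K * (B + 1)) K := by
    refine ⟨fun t ht => (hv t ht).lipschitzOnWith, fun x _ => hc x, fun t ht x hx => ?_, ?_⟩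
    · have h1 := (hv t ht).norm_sub_le x x₀
      have h2 : ‖x - x₀‖ ≤ B + 1 := by simpa [dist_eq_norm] using hx
      have h3 := norm_le_norm_sub_add (v t x) (v t x₀)
      have h4 := hB t ht
      have h5 : (K : ℝ) * ‖x - x₀‖ ≤ K * (B + 1) := by gcongr
      push_cast
      linarith
    · have hB' : (0 : ℝ) ≤ B := B.2
      have hK' : (0 : ℝ) ≤ K := K.2
      have : max (ε - 0) (0 - 0) = ε := by rw [max_eq_left] <;> simp [hε]
      simp only [this]
      push_cast
      nlinarith
  exact hPL.exists_eq_forall_mem_Icc_hasDerivWithinAt₀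

theorem dist_solution_le {v : ℝ → F → F} {K : ℝ≥0} {ε : ℝ}
    (hv : ∀ t, LipschitzWith K (v t)) {c₁ c₂ : ℝ → F}
    (h₁ : ∀ t ∈ Icc 0 ε, HasDerivWithinAt c₁ (v t (c₁ t)) (Icc 0 ε) t)
    (h₂ : ∀ t ∈ Icc 0 ε, HasDerivWithinAt c₂ (v t (c₂ t)) (Icc 0 ε) t) {t : ℝ}
    (ht : t ∈ Icc 0 ε) : dist (c₁ t) (c₂ t) ≤ dist (c₁ 0) (c₂ 0) * Real.exp (K * t) := by
  have := dist_le_of_trajectories_ODE (a := 0) (b := ε) hv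
    (fun s hs => (h₁ s hs).continuousWithinAt)
    (fun s hs => hasDerivWithinAt_Ici_of_Icc hs (h₁ s (Ico_subset_Icc_self hs)))
    (fun s hs => (h₂ s hs).continuousWithinAt)
    (fun s hs => hasDerivWithinAt_Ici_of_Icc hs (h₂ s (Ico_subset_Icc_self hs))) le_rfl t ht
  simpa using this

theorem norm_le_mul_exp_sub_one {c c' : ℝ → F} {K δ ε η : ℝ} (hK : 0 < K)
    (hc : ∀ t ∈ Icc 0 ε, HasDerivWithinAt c (c' t) (Icc 0 ε) t)
    (h0 : ‖c 0‖ ≤ δ) (hb : ∀ t ∈ Icc 0 ε, ‖c' t‖ ≤ K * ‖c t‖ + η) {t : ℝ} (ht : t ∈ Icc 0 ε) :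
    ‖c t‖ ≤ δ * Real.exp (K * t) + η / K * (Real.exp (K * t) - 1) := by
  have := norm_le_gronwallBound_of_norm_deriv_right_le (a := 0) (b := ε) (f := c) (f' := c')
    (fun s hs => (hc s hs).continuousWithinAt)
    (fun s hs => hasDerivWithinAt_Ici_of_Icc hs (hc s (Ico_subset_Icc_self hs))) h0
    (fun s hs => hb s (Ico_subset_Icc_self hs)) t ht
  rw [gronwallBound_of_K_ne_0 hK.ne'] at this
  simpa using this

/-- The mean value inequality on balls where `fderiv ℝ G` varies by at most η. Compactness of `S`
makes the radius uniform, as required by a Gronwall estimate along a whole solution. -/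
theorem exists_uniform_linearization {G : F → F} {U : Set F} (hU : IsOpen U)
    (hG : ContDiffOn ℝ 1 G U) {S : Set F} (hS : IsCompact S) (hSU : S ⊆ U) {η : ℝ} (hη : 0 < η) :
    ∃ δ > 0, ∀ s ∈ S, ∀ u ∈ Metric.ball s δ, ∀ w ∈ Metric.ball s δ,
      ‖G u - G w - fderiv ℝ G s (u - w)‖ ≤ η * ‖u - w‖ := by
  obtain ⟨δ₁, hδ₁, h₁⟩ := hS.exists_thickening_subset_open hU hSU
  have hcont : ∀ a ∈ S, ContinuousAt (fderiv ℝ G) a := fun a ha =>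
    (hG.continuousOn_fderiv_of_isOpen hU le_rfl).continuousAt (hU.mem_nhds (hSU ha))
  obtain ⟨δ₂, hδ₂, h₂⟩ := Metric.mem_uniformity_dist.1
    (hS.uniformContinuousAt_of_continuousAt _ hcont (Metric.dist_mem_uniformity hη))
  refine ⟨min δ₁ δ₂, lt_min hδ₁ hδ₂, fun s hs u hu w hw => ?_⟩
  refine (convex_ball s (min δ₁ δ₂)).norm_image_sub_le_of_norm_fderiv_le' (𝕜 := ℝ)
    (fun z hz => ?_) (fun z hz => ?_) hw hu
  · have : z ∈ U := h₁ (Metric.mem_thickening_iff.2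
      ⟨s, hs, (Metric.mem_ball.1 hz).trans_le (min_le_left _ _)⟩)
    exact (hG.contDiffAt (hU.mem_nhds this)).differentiableAt one_ne_zero
  · rw [← dist_eq_norm, dist_comm]
    exact (h₂ (by rw [dist_comm]; exact (Metric.mem_ball.1 hz).trans_le (min_le_right _ _)) hs).le

theorem exp_sub_one_le_half {K ε t : ℝ} (hK : 0 ≤ K) (h : ε * (K + 1) ≤ 1 / 4)
    (ht : t ∈ Icc 0 ε) : Real.exp ((K + 1) * t) - 1 ≤ 1 / 2 := by
  have h1 : (K + 1) * t ≤ 1 / 4 := by nlinarith [ht.2]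
  have h0 : 0 ≤ (K + 1) * t := mul_nonneg (by linarith) ht.1
  have := Real.exp_bound_div_one_sub_of_interval h0 (by linarith)
  have h3 : 1 / (1 - (K + 1) * t) ≤ 3 / 2 := by
    rw [div_le_iff₀] <;> linarith
  linarith

/-- The derivative solves the variational equation along the orbit of `x`; Gronwall applied to the
difference of two solutions minus its linear prediction gives strictness. The time is so short that
the derivative stays within 1/2 of the identity, hence is injective without any recourse to a
backward flow. -/
theorem hasStrictFDerivAt_flow [CompleteSpace F] {G : F → F} {K : ℝ≥0} (hG : LipschitzWith K G)
    {U : Set F} (hU : IsOpen U) (hGU : ContDiffOn ℝ 1 G U) {ε : ℝ}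
    (hεK : ε * (K + 1) ≤ 1 / 4) {Φ : F → ℝ → F} (h0 : ∀ x, Φ x 0 = x)
    (hΦ : ∀ x, ∀ t ∈ Icc 0 ε, HasDerivWithinAt (Φ x) (G (Φ x t)) (Icc 0 ε) t) {x : F}
    (hx : ∀ t ∈ Icc 0 ε, Φ x t ∈ U) {t : ℝ} (ht : t ∈ Icc 0 ε) :
    ∃ L : F →L[ℝ] F, HasStrictFDerivAt (Φ · t) L x ∧ Function.Injective L := by
  have hε : 0 ≤ ε := ht.1.trans ht.2
  have hK0 : (0 : ℝ) ≤ K := K.2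
  have hcx : ContinuousOn (Φ x) (Icc 0 ε) := fun s hs => (hΦ x s hs).continuousWithinAt
  have hAc : ContinuousOn (fun s => fderiv ℝ G (Φ x s)) (Icc 0 ε) :=
    (hGU.continuousOn_fderiv_of_isOpen hU le_rfl).comp hcx hx
  have hAn : ∀ s, ‖fderiv ℝ G (Φ x s)‖ ≤ K := fun s => norm_fderiv_le_of_lipschitz ℝ hG
  obtain ⟨L, hL0, hL⟩ := exists_solution_of_lipschitz (F := F →L[ℝ] F)
    (v := fun s M => (fderiv ℝ G (Φ x s)).comp M) (K := K) hε (by linarith)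
    (fun s _ => LipschitzWith.of_dist_le_mul fun M N => by
      rw [dist_eq_norm, dist_eq_norm, ← ContinuousLinearMap.comp_sub]
      exact (ContinuousLinearMap.opNorm_comp_le _ _).trans
        (mul_le_mul_of_nonneg_right (hAn s) (norm_nonneg _)))
    (fun M => hAc.clm_comp continuousOn_const) (ContinuousLinearMap.id ℝ F)
  refine ⟨L t, ?_, ?_⟩
  · rw [hasStrictFDerivAt_iff_isLittleO, Asymptotics.isLittleO_iff]
    intro κ hκ
    have hη : 0 < κ / 4 := by positivity
    obtain ⟨δ, hδ, hlin⟩ := exists_uniform_linearization hU hGU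
      (isCompact_Icc.image_of_continuousOn hcx) (image_subset_iff.2 hx) hη
    have hexp : ∀ s ∈ Icc 0 ε, Real.exp (K * s) ≤ 3 / 2 := fun s hs => by
      have h1 := exp_sub_one_le_half hK0 hεK hs
      have h2 : Real.exp (K * s) ≤ Real.exp ((K + 1) * s) :=
        Real.exp_le_exp.2 (by nlinarith [hs.1])
      linarith
    have hnear : ∀ᶠ p : F × F in 𝓝 (x, x), dist p.1 x < δ / 2 ∧ dist p.2 x < δ / 2 :=
      (((continuous_fst.tendsto (x, x)).eventually (Metric.ball_mem_nhds x (half_pos hδ))).and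
        ((continuous_snd.tendsto (x, x)).eventually (Metric.ball_mem_nhds x (half_pos hδ))))
    filter_upwards [hnear] with p hp
    have hball : ∀ y, dist y x < δ / 2 → ∀ s ∈ Icc 0 ε, Φ y s ∈ Metric.ball (Φ x s) δ := by
      intro y hy s hs
      have := dist_solution_le (v := fun _ => G) (fun _ => hG) (hΦ y) (hΦ x) hs
      rw [h0, h0] at this
      have h3 := hexp s hs
      rw [Metric.mem_ball]
      nlinarith [dist_nonneg (x := y) (y := x), (Real.exp_pos (K * s)).le]
    have hd : ∀ s ∈ Icc 0 ε, ‖Φ p.1 s - Φ p.2 s‖ ≤ 3 / 2 * ‖p.1 - p.2‖ := by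
      intro s hs
      have := dist_solution_le (v := fun _ => G) (fun _ => hG) (hΦ p.1) (hΦ p.2) hs
      rw [h0, h0, dist_eq_norm, dist_eq_norm] at this
      nlinarith [hexp s hs, norm_nonneg (p.1 - p.2)]
    -- The Gronwall rate is `K + 1` rather than `K` because it has to be positive.
    have key := norm_le_mul_exp_sub_one (c := fun s => Φ p.1 s - Φ p.2 s - L s (p.1 - p.2))
      (c' := fun s => G (Φ p.1 s) - G (Φ p.2 s) - (fderiv ℝ G (Φ x s)) (L s (p.1 - p.2)))
      (K := K + 1) (δ := 0) (ε := ε) (η := κ / 4 * (3 / 2 * ‖p.1 - p.2‖)) (by positivity)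
      (fun s hs => ((hΦ p.1 s hs).sub (hΦ p.2 s hs)).sub
        (by simpa using (hL s hs).clm_apply (hasDerivWithinAt_const s _ (p.1 - p.2))))
      (by simp [h0, hL0])
      (fun s hs => by
        have h1 := hlin (Φ x s) (mem_image_of_mem _ hs) _ (hball _ hp.1 s hs) _
          (hball _ hp.2 s hs)
        have h2 : G (Φ p.1 s) - G (Φ p.2 s) - (fderiv ℝ G (Φ x s)) (L s (p.1 - p.2)) =
            (G (Φ p.1 s) - G (Φ p.2 s) - fderiv ℝ G (Φ x s) (Φ p.1 s - Φ p.2 s)) +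
              fderiv ℝ G (Φ x s) (Φ p.1 s - Φ p.2 s - L s (p.1 - p.2)) := by
          simp only [map_sub]; abel
        rw [h2]
        refine (norm_add_le _ _).trans ?_
        have h3 := (fderiv ℝ G (Φ x s)).le_opNorm (Φ p.1 s - Φ p.2 s - L s (p.1 - p.2))
        have h4 := hd s hs
        have h5 := hAn s
        have h6 := norm_nonneg (Φ p.1 s - Φ p.2 s - L s (p.1 - p.2))
        have h7 : κ / 4 * ‖Φ p.1 s - Φ p.2 s‖ ≤ κ / 4 * (3 / 2 * ‖p.1 - p.2‖) := by gcongr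
        nlinarith)
      ht
    have h1 := exp_sub_one_le_half hK0 hεK ht
    have h2 : κ / 4 * (3 / 2 * ‖p.1 - p.2‖) / (K + 1) ≤ κ * ‖p.1 - p.2‖ := by
      rw [div_le_iff₀ (by positivity)]
      have : 0 ≤ κ * ‖p.1 - p.2‖ := by positivity
      nlinarith
    have h3 : 0 ≤ κ / 4 * (3 / 2 * ‖p.1 - p.2‖) / (K + 1) := by positivity
    refine key.trans ?_
    have : 0 ≤ κ * ‖p.1 - p.2‖ := by positivity
    nlinarith
  · have key := norm_le_mul_exp_sub_one (c := fun s => L s - ContinuousLinearMap.id ℝ F)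
      (c' := fun s => (fderiv ℝ G (Φ x s)).comp (L s)) (K := K + 1) (δ := 0) (ε := ε)
      (η := K + 1) (by positivity) (fun s hs => (hL s hs).sub_const _) (by simp [hL0])
      (fun s hs => by
        have h1 := (ContinuousLinearMap.opNorm_comp_le (fderiv ℝ G (Φ x s)) (L s))
        have h2 := norm_le_norm_sub_add (L s) (ContinuousLinearMap.id ℝ F)
        have h3 : ‖ContinuousLinearMap.id ℝ F‖ ≤ 1 := ContinuousLinearMap.norm_id_le
        have h4 := hAn s
        have h5 : ‖fderiv ℝ G (Φ x s)‖ * ‖L s‖ ≤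
            (K + 1) * (‖L s - ContinuousLinearMap.id ℝ F‖ + 1) := by
          gcongr <;> linarith
        linarith) ht
    rw [div_self (by positivity), one_mul, zero_mul, zero_add] at key
    have h1 := key.trans (exp_sub_one_le_half hK0 hεK ht)
    rw [injective_iff_map_eq_zero]
    intro v hv
    have h2 := (L t - ContinuousLinearMap.id ℝ F).le_opNorm v
    have h3 : ‖(L t - ContinuousLinearMap.id ℝ F) v‖ = ‖v‖ := by simp [hv]
    rw [h3] at h2
    have : ‖v‖ ≤ 0 := by nlinarith [norm_nonneg v]
    exact norm_le_zero_iff.1 this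

/-- Strictness at y says that f - f'(y) has small Lipschitz constant near y, and this constant
bounds the derivative f'(z) - f'(y) at every nearby z. -/
theorem contDiffAt_one_of_hasStrictFDerivAt {F' : Type*} [NormedAddCommGroup F']
    [NormedSpace ℝ F'] {f : F → F'} {U : Set F} (hU : IsOpen U)
    (h : ∀ y ∈ U, ∃ L : F →L[ℝ] F', HasStrictFDerivAt f L y) {x : F} (hx : x ∈ U) :
    ContDiffAt ℝ 1 f x := by
  rw [contDiffAt_one_iff]
  refine ⟨fderiv ℝ f, U, hU.mem_nhds hx, fun y hy => ?_, fun y hy => ?_⟩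
  · obtain ⟨L, hL⟩ := h y hy
    rw [← hL.hasFDerivAt.fderiv] at hL
    refine ContinuousAt.continuousWithinAt ?_
    rw [Metric.continuousAt_iff']
    intro η hη
    rw [hasStrictFDerivAt_iff_isLittleO, Asymptotics.isLittleO_iff] at hL
    have h1 := (eventually_eventually_nhds.2 (hL (half_pos hη)))
    have h2 : Tendsto (fun z : F => (z, z)) (𝓝 y) (𝓝 (y, y)) :=
      (continuous_id.prodMk continuous_id).tendsto y
    filter_upwards [h2.eventually h1, hU.mem_nhds hy] with z hz hzU
    obtain ⟨L', hL'⟩ := h z hzU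
    rw [← hL'.hasFDerivAt.fderiv] at hL'
    rw [dist_eq_norm]
    refine lt_of_le_of_lt ?_ (half_lt_self hη)
    refine (hL'.hasFDerivAt.sub (fderiv ℝ f y).hasFDerivAt).le_of_lip' (half_pos hη).le ?_
    have h3 : Tendsto (fun w : F => (w, z)) (𝓝 z) (𝓝 (z, z)) :=
      (continuous_id.prodMk continuous_const).tendsto z
    filter_upwards [h3.eventually hz] with w hw
    have h4 : (f - fderiv ℝ f y) w - (f - fderiv ℝ f y) z =
        f w - f z - fderiv ℝ f y (w - z) := by
      simp only [Pi.sub_apply, map_sub]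
      abel
    rw [h4]
    exact hw
  · obtain ⟨L, hL⟩ := h y hy
    exact hL.hasFDerivAt.differentiableAt.hasFDerivAt

end ODE

end HypAttr

/-! ### The vector field in a chart, and local flows at interior and boundary points. -/

namespace HypAttr

variable {n : ℕ} [NeZero n] {M : Type*} [TopologicalSpace M]
  [ChartedSpace (EuclideanHalfSpace n) M]

section Charts

variable [IsManifold (𝓡∂ n) ∞ M]

/-- The vector field `X` read in the chart at `p`. -/
def chartField (X : ∀ x : M, TangentSpace (𝓡∂ n) x) (p : M) (u : EuclideanSpace ℝ (Fin n)) :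
    EuclideanSpace ℝ (Fin n) :=
  tangentCoordChange (𝓡∂ n) ((extChartAt (𝓡∂ n) p).symm u) p ((extChartAt (𝓡∂ n) p).symm u)
    (X ((extChartAt (𝓡∂ n) p).symm u))

theorem chartField_self (X : ∀ x : M, TangentSpace (𝓡∂ n) x) (p : M) :
    chartField X p (extChartAt (𝓡∂ n) p p) = X p := by
  unfold chartField
  rw [extChartAt_to_inv]
  exact tangentCoordChange_self (mem_extChartAt_source p)

theorem contDiffWithinAt_chartField {X : ∀ x : M, TangentSpace (𝓡∂ n) x}
    (hX : ContMDiff (𝓡∂ n) (𝓡∂ n).tangent 1 (fun x => (⟨x, X x⟩ : TangentBundle (𝓡∂ n) M)))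
    (p : M) : ContDiffWithinAt ℝ 1 (chartField X p) (range (𝓡∂ n)) (extChartAt (𝓡∂ n) p p) :=
  (contMDiffAt_iff.mp (hX p)).2.snd

theorem hasDerivWithinAt_extChartAt_comp {X : ∀ x : M, TangentSpace (𝓡∂ n) x} {γ : ℝ → M}
    {s : Set ℝ} (hγ : IsMIntegralCurveOn γ X s) {t : ℝ} (ht : t ∈ s) {p : M}
    (hsrc : γ t ∈ (extChartAt (𝓡∂ n) p).source) :
    HasDerivWithinAt (extChartAt (𝓡∂ n) p ∘ γ)
      (chartField X p (extChartAt (𝓡∂ n) p (γ t))) s t := by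
  unfold chartField
  rw [(extChartAt (𝓡∂ n) p).left_inv hsrc]
  replace hsrc := extChartAt_source (𝓡∂ n) p ▸ hsrc
  have h := HasMFDerivWithinAt.comp t (hasMFDerivWithinAt_extChartAt (I := 𝓡∂ n) hsrc) (hγ t ht)
    (Set.subset_preimage_image _ _)
  rw [mfderiv_chartAt_eq_tangentCoordChange hsrc] at h
  let v : EuclideanSpace ℝ (Fin n) := X (γ t)
  have h2 : HasFDerivWithinAt (extChartAt (𝓡∂ n) p ∘ γ)
      ((tangentCoordChange (𝓡∂ n) (γ t) p (γ t)).comp ((1 : ℝ →L[ℝ] ℝ).smulRight v)) s t :=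
    hasMFDerivWithinAt_iff_hasFDerivWithinAt.1 h
  refine h2.hasDerivWithinAt.congr_deriv ?_
  change (tangentCoordChange (𝓡∂ n) (γ t) p (γ t)) ((1 : ℝ) • v) = _
  rw [one_smul]

/-- The curve must stay in the half-space, since a change of charts is differentiable only within
it. -/
theorem hasMFDerivWithinAt_extChartAt_symm_comp {X : ∀ x : M, TangentSpace (𝓡∂ n) x}
    {c : ℝ → EuclideanSpace ℝ (Fin n)} {s : Set ℝ} {p : M} {t : ℝ}
    (hc : HasDerivWithinAt c (chartField X p (c t)) s t)
    (ht : c t ∈ (extChartAt (𝓡∂ n) p).target) (hs : MapsTo c s (range (𝓡∂ n))) :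
    HasMFDerivWithinAt 𝓘(ℝ, ℝ) (𝓡∂ n) ((extChartAt (𝓡∂ n) p).symm ∘ c) s t
      ((1 : ℝ →L[ℝ] ℝ).smulRight (X ((extChartAt (𝓡∂ n) p).symm (c t)))) := by
  set xₜ : M := (extChartAt (𝓡∂ n) p).symm (c t)
  let v : EuclideanSpace ℝ (Fin n) := X xₜ
  have h : HasDerivWithinAt c (tangentCoordChange (𝓡∂ n) xₜ p xₜ v) s t := hc
  have hft1 : xₜ ∈ (extChartAt (𝓡∂ n) p).source := (extChartAt (𝓡∂ n) p).map_target ht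
  have hft2 := mem_extChartAt_source (I := 𝓡∂ n) xₜ
  have hv : tangentCoordChange (𝓡∂ n) p xₜ xₜ (tangentCoordChange (𝓡∂ n) xₜ p xₜ v) = v := by
    rw [tangentCoordChange_comp ⟨⟨hft2, hft1⟩, hft2⟩, tangentCoordChange_self hft2]
  have hD : HasFDerivWithinAt (extChartAt (𝓡∂ n) xₜ ∘ (extChartAt (𝓡∂ n) p).symm)
      (tangentCoordChange (𝓡∂ n) p xₜ xₜ) (range (𝓡∂ n)) (c t) := by
    rw [← (extChartAt (𝓡∂ n) p).right_inv ht]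
    exact hasFDerivWithinAt_tangentCoordChange ⟨hft1, hft2⟩
  have key := hD.comp_hasDerivWithinAt t h hs
  rw [hv] at key
  refine ⟨(continuousAt_extChartAt_symm'' ht).comp_continuousWithinAt h.continuousWithinAt, ?_⟩
  simp only [mfld_simps]
  exact key.hasFDerivWithinAt

theorem inner_component_pos {X : ∀ x : M, TangentSpace (𝓡∂ n) x} (hin : InwardlyTransverse X)
    {p : M} (hp : p ∈ (𝓡∂ n).boundary M) :
    0 < chartField X p (extChartAt (𝓡∂ n) p p) 0 := by
  have h := hin p hp
  have h2 : mfderiv (𝓡∂ n) 𝓘(ℝ, EuclideanSpace ℝ (Fin n)) (extChartAt (𝓡∂ n) p) p =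
      tangentCoordChange (𝓡∂ n) p p p := by
    rw [(hasMFDerivAt_extChartAt (I := 𝓡∂ n) (mem_chart_source _ p)).mfderiv]
    exact mfderiv_chartAt_eq_tangentCoordChange (mem_chart_source _ p)
  rw [h2] at h
  rw [chartField_self]
  have h3 := tangentCoordChange_self (I := 𝓡∂ n) (v := X p) (mem_extChartAt_source p)
  change 0 < (tangentCoordChange (𝓡∂ n) p p p (X p)) 0 at h
  rw [h3] at h
  exact h

/-- A Lipschitz vector field on the whole of `ℝⁿ` that extends `X` read in the chart at `p` near
`p`, with the time for which its solutions stay in the domain of the chart. -/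
structure LocalFlow (X : ∀ x : M, TangentSpace (𝓡∂ n) x) (p : M) where
  (r ρ ε : ℝ) (K : ℝ≥0)
  G : EuclideanSpace ℝ (Fin n) → EuclideanSpace ℝ (Fin n)
  Φ : EuclideanSpace ℝ (Fin n) → ℝ → EuclideanSpace ℝ (Fin n)
  hr : 0 < r
  hρ : 0 < ρ
  hε : 0 < ε
  lip : LipschitzWith K G
  small : ε * (K + 1) ≤ 1 / 4
  Φ_zero : ∀ u, Φ u 0 = u
  deriv : ∀ u, ∀ t ∈ Icc 0 ε, HasDerivWithinAt (Φ u) (G (Φ u t)) (Icc 0 ε) t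
  target : Metric.ball (extChartAt (𝓡∂ n) p p) r ∩ range (𝓡∂ n) ⊆ (extChartAt (𝓡∂ n) p).target
  eqOn : EqOn G (chartField X p) (Metric.ball (extChartAt (𝓡∂ n) p p) r ∩ range (𝓡∂ n))
  stays : ∀ u ∈ Metric.ball (extChartAt (𝓡∂ n) p p) ρ, ∀ t ∈ Icc 0 ε,
    Φ u t ∈ Metric.ball (extChartAt (𝓡∂ n) p p) r
  inward : ∀ u ∈ Metric.ball (extChartAt (𝓡∂ n) p p) ρ ∩ range (𝓡∂ n), ∀ t ∈ Ioc 0 ε,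
    Φ u t ∈ interior (range (𝓡∂ n))
  smooth : p ∈ (𝓡∂ n).interior M →
    Metric.ball (extChartAt (𝓡∂ n) p p) r ⊆ interior (range (𝓡∂ n)) ∧
      ContDiffOn ℝ 1 G (Metric.ball (extChartAt (𝓡∂ n) p p) r)

/-- Near p the field is Lipschitz on the convex half-space, and a Lipschitz extension to ℝⁿ makes
the equation solvable without regard to the boundary. A solution of the extended equation concerns X
only if it stays in the half-space. At an interior point a small ball suffices; at a boundary point
the normal component is positive on a small ball and pushes solutions inwards. -/
theorem exists_localFlow {X : ∀ x : M, TangentSpace (𝓡∂ n) x}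
    (hX : ContMDiff (𝓡∂ n) (𝓡∂ n).tangent 1 (fun x => (⟨x, X x⟩ : TangentBundle (𝓡∂ n) M)))
    (hin : InwardlyTransverse X) (p : M) : Nonempty (LocalFlow X p) := by
  set a := extChartAt (𝓡∂ n) p p with ha
  have haR : a ∈ range (𝓡∂ n) := extChartAt_target_subset_range p (mem_extChartAt_target p)
  have hF := contDiffWithinAt_chartField hX p
  obtain ⟨K₀, s, hs, hlip⟩ := hF.exists_lipschitzOnWith (𝓡∂ n).convex_range
  obtain ⟨r₀, hr₀, hr₀s⟩ := Metric.mem_nhdsWithin_iff.1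
    (inter_mem hs (extChartAt_target_mem_nhdsWithin (I := 𝓡∂ n) p))
  obtain ⟨G, hG, hGF⟩ := (hlip.mono (hr₀s.trans inter_subset_left)).extend_finite_dimension
  set K : ℝ≥0 := lipschitzExtensionConstant (EuclideanSpace ℝ (Fin n)) * K₀
  have hGa : G a = chartField X p a := (hGF ⟨Metric.mem_ball_self hr₀, haR⟩).symm
  have main : ∃ r, 0 < r ∧ r ≤ r₀ ∧
      ((a ∈ interior (range (𝓡∂ n)) ∧ Metric.ball a r ⊆ interior (range (𝓡∂ n)) ∧
        ContDiffOn ℝ 1 G (Metric.ball a r)) ∨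
        (a ∉ interior (range (𝓡∂ n)) ∧ ∀ u ∈ Metric.ball a r, 0 < G u 0)) := by
    by_cases hi : a ∈ interior (range (𝓡∂ n))
    · obtain ⟨u, huo, hau, hu⟩ := hF.contDiffOn' le_rfl (by simp)
      have hnhds : u ∩ interior (range (𝓡∂ n)) ∩ Metric.ball a r₀ ∈ 𝓝 a :=
        inter_mem (inter_mem (huo.mem_nhds hau) (isOpen_interior.mem_nhds hi))
          (Metric.ball_mem_nhds _ hr₀)
      obtain ⟨r, hr, hru⟩ := Metric.mem_nhds_iff.1 hnhds
      refine ⟨min r r₀, lt_min hr hr₀, min_le_right _ _, Or.inl ⟨hi, fun y hy => ?_, ?_⟩⟩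
      · exact (hru (Metric.ball_subset_ball (min_le_left _ _) hy)).1.2
      · refine (hu.mono fun y hy => ?_).congr fun y hy => ?_
        · have := hru (Metric.ball_subset_ball (min_le_left _ _) hy)
          exact ⟨Or.inr (interior_subset this.1.2), this.1.1⟩
        · have := hru (Metric.ball_subset_ball (min_le_left _ _) hy)
          exact (hGF ⟨this.2, interior_subset this.1.2⟩).symm
    · have hb : p ∈ (𝓡∂ n).boundary M := by
        rw [← ModelWithCorners.compl_interior]; exact hi
      have hpos : 0 < G a 0 := by rw [hGa]; exact inner_component_pos hin hb
      have hc : Continuous fun u => G u 0 :=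
        (EuclideanSpace.proj (𝕜 := ℝ) (0 : Fin n)).continuous.comp hG.continuous
      obtain ⟨r, hr, hru⟩ := Metric.mem_nhds_iff.1 ((isOpen_lt continuous_const hc).mem_nhds hpos)
      exact ⟨min r r₀, lt_min hr hr₀, min_le_right _ _, Or.inr ⟨hi, fun u hu =>
        hru (Metric.ball_subset_ball (min_le_left _ _) hu)⟩⟩
  obtain ⟨r, hr, hrr, hcase⟩ := main
  have hK0 : (0 : ℝ) ≤ K := K.2
  set ε₀ : ℝ := 1 / (4 * (K + 1)) with hε₀
  have hε₀pos : 0 < ε₀ := by positivity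
  have hεK : ε₀ * (K + 1) = 1 / 4 := by rw [hε₀]; field_simp
  choose Φ hΦ0 hΦ using fun u => exists_solution_of_lipschitz (v := fun _ => G) hε₀pos.le
    (by linarith) (fun _ _ => hG) (fun _ => continuousOn_const) u
  have hcont : ContinuousWithinAt (Φ a) (Icc 0 ε₀) 0 :=
    (hΦ a 0 ⟨le_rfl, hε₀pos.le⟩).continuousWithinAt
  obtain ⟨τ, hτ, hτb⟩ := Metric.continuousWithinAt_iff.1 hcont (r / 2) (half_pos hr)
  rw [hΦ0] at hτb
  set ε : ℝ := min ε₀ (τ / 2)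
  have hεpos : 0 < ε := lt_min hε₀pos (half_pos hτ)
  have hεle : ε ≤ ε₀ := min_le_left _ _
  have hsub : Icc 0 ε ⊆ Icc 0 ε₀ := Icc_subset_Icc_right hεle
  have hder : ∀ u, ∀ t ∈ Icc 0 ε, HasDerivWithinAt (Φ u) (G (Φ u t)) (Icc 0 ε) t :=
    fun u t ht => (hΦ u t (hsub ht)).mono hsub
  have hεK' : ε * (K + 1) ≤ 1 / 4 := by rw [← hεK]; gcongr
  -- Up to time ε solutions spread by a factor at most 3/2 and the one from `a` moves by less than
  -- r/2; and 3/2 · r/4 + r/2 < r.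
  have hstay : ∀ u ∈ Metric.ball a (r / 4), ∀ t ∈ Icc 0 ε, Φ u t ∈ Metric.ball a r := by
    intro u hu t ht
    have h1 := dist_solution_le (v := fun _ => G) (fun _ => hG) (hder u) (hder a) ht
    rw [hΦ0, hΦ0] at h1
    have h2 := hτb (hsub ht) (by
      rw [Real.dist_eq, sub_zero, abs_of_nonneg ht.1]
      exact lt_of_le_of_lt (ht.2.trans (min_le_right _ _)) (half_lt_self hτ))
    have h3 := exp_sub_one_le_half hK0 hεK' ht
    have h4 : Real.exp (K * t) ≤ Real.exp ((K + 1) * t) := Real.exp_le_exp.2 (by nlinarith [ht.1])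
    rw [Metric.mem_ball] at hu ⊢
    have h5 := dist_triangle (Φ u t) (Φ a t) a
    nlinarith [dist_nonneg (x := u) (y := a), (Real.exp_pos (K * t)).le]
  refine ⟨⟨r, r / 4, ε, K, G, Φ, hr, by positivity, hεpos, hG, hεK', hΦ0, hder,
    fun u hu => (hr₀s ⟨Metric.ball_subset_ball hrr hu.1, hu.2⟩).2,
    fun u hu => (hGF ⟨Metric.ball_subset_ball hrr hu.1, hu.2⟩).symm, hstay, ?_, ?_⟩⟩
  · rintro u ⟨hu, huR⟩ t ht
    rcases hcase with ⟨-, h, -⟩ | ⟨-, h⟩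
    · exact h (hstay u hu t (Ioc_subset_Icc_self ht))
    · rw [interior_range_modelWithCornersEuclideanHalfSpace]
      rw [range_modelWithCornersEuclideanHalfSpace] at huR
      -- The normal coordinate starts nonnegative and has positive derivative, so it is positive at
      -- every later time.
      have hd : ∀ s ∈ Icc 0 ε, HasDerivWithinAt (fun s => Φ u s 0) (G (Φ u s) 0) (Icc 0 ε) s :=
        fun s hs => (EuclideanSpace.proj (𝕜 := ℝ) (0 : Fin n)).hasFDerivAt.comp_hasDerivWithinAt
          s (hder u s hs)
      have hmono := strictMonoOn_of_deriv_pos (convex_Icc (0 : ℝ) ε)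
        (fun s hs => (hd s hs).continuousWithinAt) (fun s hs => by
          rw [interior_Icc] at hs
          rw [((hd s (Ioo_subset_Icc_self hs)).hasDerivAt (Icc_mem_nhds hs.1 hs.2)).deriv]
          exact h _ (hstay u hu s (Ioo_subset_Icc_self hs)))
      have := hmono ⟨le_rfl, hεpos.le⟩ (Ioc_subset_Icc_self ht) ht.1
      simp only [hΦ0] at this
      exact lt_of_le_of_lt huR this
  · intro hp
    rcases hcase with ⟨-, h⟩ | ⟨h, -⟩
    · exact h
    · exact absurd hp h

end Charts

end HypAttr

/-! ### Uniqueness and existence of forward integral curves; the semiflow. -/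

namespace HypAttr

variable {n : ℕ} [NeZero n] {M : Type*} [TopologicalSpace M]
  [ChartedSpace (EuclideanHalfSpace n) M] [IsManifold (𝓡∂ n) ∞ M]
  {X : ∀ x : M, TangentSpace (𝓡∂ n) x}

namespace LocalFlow

variable {p : M} (l : LocalFlow X p)

/-- The neighbourhood of `p` on which the local flow is defined. -/
def dom : Set M :=
  (extChartAt (𝓡∂ n) p).source ∩ extChartAt (𝓡∂ n) p ⁻¹'
    Metric.ball (extChartAt (𝓡∂ n) p p) l.ρ

theorem isOpen_dom : IsOpen l.dom :=
  isOpen_extChartAt_preimage' p Metric.isOpen_ball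

theorem mem_dom : p ∈ l.dom :=
  ⟨mem_extChartAt_source p, Metric.mem_ball_self l.hρ⟩

theorem dom_mem_nhds : l.dom ∈ 𝓝 p := l.isOpen_dom.mem_nhds l.mem_dom

theorem mem_range {x : M} (hx : x ∈ l.dom) {t : ℝ} (ht : t ∈ Icc 0 l.ε) :
    l.Φ (extChartAt (𝓡∂ n) p x) t ∈ range (𝓡∂ n) := by
  have hR : extChartAt (𝓡∂ n) p x ∈ range (𝓡∂ n) :=
    extChartAt_target_subset_range p ((extChartAt (𝓡∂ n) p).map_source hx.1)
  rcases ht.1.eq_or_lt with rfl | h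
  · rwa [l.Φ_zero]
  · exact interior_subset (l.inward _ ⟨hx.2, hR⟩ t ⟨h, ht.2⟩)

theorem mem_target {x : M} (hx : x ∈ l.dom) {t : ℝ} (ht : t ∈ Icc 0 l.ε) :
    l.Φ (extChartAt (𝓡∂ n) p x) t ∈ (extChartAt (𝓡∂ n) p).target :=
  l.target ⟨l.stays _ hx.2 t ht, l.mem_range hx ht⟩

/-- The integral curve of `X` given by the local flow. -/
def curve (x : M) (t : ℝ) : M :=
  (extChartAt (𝓡∂ n) p).symm (l.Φ (extChartAt (𝓡∂ n) p x) t)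

theorem curve_zero {x : M} (hx : x ∈ l.dom) : l.curve x 0 = x := by
  rw [curve, l.Φ_zero, (extChartAt (𝓡∂ n) p).left_inv hx.1]

theorem isMIntegralCurveOn_curve {x : M} (hx : x ∈ l.dom) :
    IsMIntegralCurveOn (l.curve x) X (Icc 0 l.ε) := by
  intro t ht
  refine hasMFDerivWithinAt_extChartAt_symm_comp (c := l.Φ (extChartAt (𝓡∂ n) p x)) ?_
    (l.mem_target hx ht) fun s hs => l.mem_range hx hs
  rw [← l.eqOn ⟨l.stays _ hx.2 t ht, l.mem_range hx ht⟩]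
  exact l.deriv _ t ht

theorem curve_mem_interior {x : M} (hx : x ∈ l.dom) {t : ℝ} (ht : t ∈ Ioc 0 l.ε) :
    l.curve x t ∈ (𝓡∂ n).interior M := by
  have ht' := Ioc_subset_Icc_self ht
  have hR : extChartAt (𝓡∂ n) p x ∈ range (𝓡∂ n) :=
    extChartAt_target_subset_range p ((extChartAt (𝓡∂ n) p).map_source hx.1)
  have h1 := l.inward _ ⟨hx.2, hR⟩ t ht
  have h2 := l.mem_target hx ht'
  have h3 : l.curve x t ∈ (chartAt (EuclideanHalfSpace n) p).source := by
    rw [← extChartAt_source (𝓡∂ n)]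
    exact (extChartAt (𝓡∂ n) p).map_target h2
  -- Being an interior point is defined by the preferred chart at that point; here it is tested in
  -- the chart at `p`.
  refine ((𝓡∂ n).isInteriorPoint_iff_of_mem_atlas (n := 1) one_ne_zero
    (chart_mem_atlas _ p) h3).2 ?_
  have h4 : ((chartAt (EuclideanHalfSpace n) p).extend (𝓡∂ n)) (l.curve x t) =
      l.Φ (extChartAt (𝓡∂ n) p x) t := (extChartAt (𝓡∂ n) p).right_inv h2
  rw [h4]
  refine mem_interior_iff_mem_nhds.2 ?_
  have h5 := extChartAt_target_mem_nhdsWithin_of_mem (I := 𝓡∂ n) h2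
  rwa [nhdsWithin_eq_nhds.2 (mem_interior_iff_mem_nhds.1 h1)] at h5

end LocalFlow

section Uniqueness

variable
  (hX : ContMDiff (𝓡∂ n) (𝓡∂ n).tangent 1 (fun x => (⟨x, X x⟩ : TangentBundle (𝓡∂ n) M)))
  (hin : InwardlyTransverse X)

include hX hin

/-- In the chart at the common starting point both curves solve the equation of the globally
Lipschitz field `l.G`. -/
theorem exists_eqOn_Icc {γ γ' : ℝ → M} {a b : ℝ} (hab : a < b)
    (hγ : IsMIntegralCurveOn γ X (Icc a b)) (hγ' : IsMIntegralCurveOn γ' X (Icc a b))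
    (h : γ a = γ' a) : ∃ c ∈ Ioc a b, EqOn γ γ' (Icc a c) := by
  obtain ⟨l⟩ := exists_localFlow hX hin (γ a)
  set φ := extChartAt (𝓡∂ n) (γ a)
  set B := Metric.ball (φ (γ a)) l.r
  have hmem : ∀ {g : ℝ → M}, IsMIntegralCurveOn g X (Icc a b) → g a = γ a →
      ∀ᶠ t in 𝓝[≥] a, g t ∈ φ.source ∩ φ ⁻¹' B := by
    intro g hg hga
    have h1 : ContinuousWithinAt g (Ici a) a :=
      (hg.continuousWithinAt ⟨le_rfl, hab.le⟩).mono_of_mem_nhdsWithin (Icc_mem_nhdsGE hab)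
    refine h1.eventually_mem ((isOpen_extChartAt_preimage' (γ a) Metric.isOpen_ball).mem_nhds ?_)
    rw [hga]
    exact ⟨mem_extChartAt_source _, Metric.mem_ball_self l.hr⟩
  obtain ⟨c, hc, hcs⟩ := mem_nhdsGE_iff_exists_Icc_subset.1
    (inter_mem (inter_mem (hmem hγ rfl) (hmem hγ' h.symm)) (Icc_mem_nhdsGE hab))
  have hd : ∀ {g : ℝ → M}, IsMIntegralCurveOn g X (Icc a b) →
      (∀ t ∈ Icc a c, g t ∈ φ.source ∩ φ ⁻¹' B) →
      ∀ t ∈ Icc a c, HasDerivWithinAt (φ ∘ g) (l.G ((φ ∘ g) t)) (Icc a b) t := by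
    intro g hg hgs t ht
    have h1 := hasDerivWithinAt_extChartAt_comp hg (hcs ht).2 (hgs t ht).1
    rwa [← l.eqOn ⟨(hgs t ht).2, extChartAt_target_subset_range _ (φ.map_source (hgs t ht).1)⟩]
      at h1
  have hcb : c ≤ b := (hcs ⟨hc.le, le_rfl⟩).2.2
  have hsub : Icc a c ⊆ Icc a b := Icc_subset_Icc_right hcb
  have d1 := hd hγ fun t ht => (hcs ht).1.1
  have d2 := hd hγ' fun t ht => (hcs ht).1.2
  refine ⟨c, ⟨hc, hcb⟩, fun t ht => φ.injOn (hcs ht).1.1.1 (hcs ht).1.2.1 ?_⟩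
  exact ODE_solution_unique (v := fun _ => l.G) (fun _ => l.lip)
    (fun s hs => ((d1 s hs).mono hsub).continuousWithinAt)
    (fun s hs => hasDerivWithinAt_Ici_of_Icc hs ((d1 s (Ico_subset_Icc_self hs)).mono hsub))
    (fun s hs => ((d2 s hs).mono hsub).continuousWithinAt)
    (fun s hs => hasDerivWithinAt_Ici_of_Icc hs ((d2 s (Ico_subset_Icc_self hs)).mono hsub))
    (by simp [h]) ht

theorem eqOn_Icc_of_isMIntegralCurveOn [T2Space M] {γ γ' : ℝ → M} {a b : ℝ}
    (hγ : IsMIntegralCurveOn γ X (Icc a b)) (hγ' : IsMIntegralCurveOn γ' X (Icc a b))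
    (h : γ a = γ' a) : EqOn γ γ' (Icc a b) := by
  have hcl : IsClosed ({t | γ t = γ' t} ∩ Icc a b) := by
    rw [inter_comm]
    exact (hγ.continuousOn.prodMk hγ'.continuousOn).preimage_isClosed_of_isClosed isClosed_Icc
      isClosed_diagonal
  refine hcl.Icc_subset_of_forall_exists_gt h ?_
  rintro t ⟨hteq, ht⟩ y hy
  have hsub : Icc t b ⊆ Icc a b := Icc_subset_Icc_left ht.1
  obtain ⟨c, hc, hceq⟩ := exists_eqOn_Icc hX hin ht.2 (hγ.mono hsub) (hγ'.mono hsub) hteq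
  have hm : t < min c y := lt_min hc.1 hy
  exact ⟨min c y, hceq ⟨hm.le, min_le_left _ _⟩, hm, min_le_right _ _⟩

end Uniqueness

section Existence

omit [IsManifold (𝓡∂ n) ∞ M] in
theorem exists_concat {γ γ' : ℝ → M} {a b : ℝ} (ha : 0 ≤ a) (hb : 0 ≤ b)
    (hγ : IsMIntegralCurveOn γ X (Icc 0 a)) (hγ' : IsMIntegralCurveOn γ' X (Icc 0 b))
    (h : γ a = γ' 0) :
    ∃ γ'' : ℝ → M, γ'' 0 = γ 0 ∧ IsMIntegralCurveOn γ'' X (Icc 0 (a + b)) := by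
  classical
  set δ : ℝ → M := fun t => if t ≤ a then γ t else γ' (t - a) with hδ
  have e1 : ∀ t ≤ a, δ t = γ t := fun t ht => by simp [hδ, ht]
  have e2 : ∀ t, a ≤ t → δ t = γ' (t + -a) := fun t ht => by
    rcases ht.eq_or_lt with rfl | h'
    · simp [hδ, h]
    · simp [hδ, not_le.2 h', sub_eq_add_neg]
  have hs := hγ'.comp_add (-a)
  have d1 : ∀ t ∈ Icc 0 a, HasMFDerivWithinAt 𝓘(ℝ, ℝ) (𝓡∂ n) δ (Icc 0 a) t
      ((1 : ℝ →L[ℝ] ℝ).smulRight (X (δ t))) := fun t ht => by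
    have := hγ t ht
    rw [← e1 t ht.2] at this
    exact this.congr_of_eventuallyEq (eventually_of_mem self_mem_nhdsWithin
      fun s hs => e1 s hs.2) (e1 t ht.2)
  have d2 : ∀ t ∈ Icc a (a + b), HasMFDerivWithinAt 𝓘(ℝ, ℝ) (𝓡∂ n) δ (Icc a (a + b)) t
      ((1 : ℝ →L[ℝ] ℝ).smulRight (X (δ t))) := fun t ht => by
    have hm : ∀ s ∈ Icc a (a + b), s + -a ∈ Icc 0 b := fun s hs =>
      ⟨by linarith [hs.1], by linarith [hs.2]⟩
    have := (hs t (hm t ht)).mono (s := Icc a (a + b)) fun s hs => hm s hs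
    simp only [Function.comp_apply] at this
    rw [← e2 t ht.1] at this
    exact this.congr_of_eventuallyEq (eventually_of_mem self_mem_nhdsWithin
      fun s hs => e2 s hs.1) (e2 t ht.1)
  refine ⟨δ, e1 0 ha, fun t ht => ?_⟩
  rcases lt_trichotomy t a with h' | rfl | h'
  · exact (d1 t ⟨ht.1, h'.le⟩).mono_of_mem_nhdsWithin
      (mem_nhdsWithin.2 ⟨Iio a, isOpen_Iio, h', fun s hs => ⟨hs.2.1, hs.1.le⟩⟩)
  · rw [← Icc_union_Icc_eq_Icc ha (by linarith : t ≤ t + b)]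
    exact (d1 t ⟨ha, le_rfl⟩).union (d2 t ⟨le_rfl, by linarith⟩)
  · exact (d2 t ⟨h'.le, ht.2⟩).mono_of_mem_nhdsWithin
      (mem_nhdsWithin.2 ⟨Ioi a, isOpen_Ioi, h', fun s hs => ⟨hs.1.le, hs.2.2⟩⟩)

variable [CompactSpace M] [T2Space M]
  (hX : ContMDiff (𝓡∂ n) (𝓡∂ n).tangent 1 (fun x => (⟨x, X x⟩ : TangentBundle (𝓡∂ n) M)))
  (hin : InwardlyTransverse X)

include hX hin

omit [T2Space M] in
theorem exists_uniform_time : ∃ ε > 0, ∀ x : M, ∃ γ : ℝ → M, γ 0 = x ∧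
    IsMIntegralCurveOn γ X (Icc 0 ε) := by
  let l : ∀ p : M, LocalFlow X p := fun p => (exists_localFlow hX hin p).some
  obtain ⟨s, hs⟩ := CompactSpace.elim_nhds_subcover (fun p => (l p).dom)
    fun p => (l p).dom_mem_nhds
  have hmin : ∃ ε > 0, ∀ p ∈ s, ε ≤ (l p).ε := by
    clear hs
    induction s using Finset.cons_induction with
    | empty => exact ⟨1, one_pos, by simp⟩
    | cons a s ha ih =>
      obtain ⟨ε, hε, h⟩ := ih
      refine ⟨min ε (l a).ε, lt_min hε (l a).hε, fun p hp => ?_⟩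
      rcases Finset.mem_cons.1 hp with rfl | hp
      · exact min_le_right _ _
      · exact (min_le_left _ _).trans (h p hp)
  obtain ⟨ε, hε, h⟩ := hmin
  refine ⟨ε, hε, fun x => ?_⟩
  obtain ⟨p, hp, hx⟩ := mem_iUnion₂.1 (hs ▸ mem_univ x : x ∈ ⋃ p ∈ s, (l p).dom)
  exact ⟨(l p).curve x, (l p).curve_zero hx,
    ((l p).isMIntegralCurveOn_curve hx).mono (Icc_subset_Icc_right (h p hp))⟩

theorem exists_isMIntegralCurveOn_Ici (x : M) :
    ∃ γ : ℝ → M, γ 0 = x ∧ IsMIntegralCurveOn γ X (Ici 0) := by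
  obtain ⟨ε, hε, h⟩ := exists_uniform_time hX hin
  have hk : ∀ k : ℕ, ∃ γ : ℝ → M, γ 0 = x ∧ IsMIntegralCurveOn γ X (Icc 0 (k * ε)) := by
    intro k
    induction k with
    | zero =>
      obtain ⟨γ, h0, hγ⟩ := h x
      exact ⟨γ, h0, hγ.mono (Icc_subset_Icc_right (by simpa using hε.le))⟩
    | succ k ih =>
      obtain ⟨γ, h0, hγ⟩ := ih
      obtain ⟨γ', h0', hγ'⟩ := h (γ (k * ε))
      obtain ⟨γ'', h0'', hγ''⟩ := exists_concat (by positivity) hε.le hγ hγ' h0'.symm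
      refine ⟨γ'', h0''.trans h0, ?_⟩
      convert hγ'' using 2
      push_cast; ring
  choose γ h0 hγ using hk
  have heq : ∀ {j k : ℕ}, j ≤ k → EqOn (γ j) (γ k) (Icc 0 (j * ε)) := fun {j k} hjk =>
    eqOn_Icc_of_isMIntegralCurveOn hX hin (hγ j)
      ((hγ k).mono (Icc_subset_Icc_right (by gcongr))) (by rw [h0, h0])
  obtain ⟨N, hN⟩ : ∃ N : ℝ → ℕ, ∀ t, t < N t * ε := by
    choose N hN using fun t => exists_nat_gt (t / ε)
    exact ⟨N, fun t => by rw [← div_lt_iff₀ hε]; exact hN t⟩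
  have hval : ∀ {k : ℕ} {t : ℝ}, t ∈ Icc 0 (k * ε) → γ (N t) t = γ k t := fun {k t} ht => by
    rcases le_total (N t) k with hle | hle
    · exact heq hle ⟨ht.1, (hN t).le⟩
    · exact (heq hle ht).symm
  refine ⟨fun t => γ (N t) t, h0 _, fun t ht => ?_⟩
  set k := N t
  have htk : t ∈ Icc 0 (k * ε) := ⟨ht, (hN t).le⟩
  have hnb : Icc 0 (k * ε) ∈ 𝓝[Ici 0] t :=
    mem_nhdsWithin.2 ⟨Iio (k * ε), isOpen_Iio, hN t, fun s hs => ⟨hs.2, hs.1.le⟩⟩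
  exact ((hγ k t htk).mono_of_mem_nhdsWithin hnb).congr_of_eventuallyEq
    (eventually_of_mem hnb fun s hs => hval hs) rfl

theorem flow_spec (x : M) :
    flow X 0 x = x ∧ IsMIntegralCurveOn (fun t => flow X t x) X (Ici 0) := by
  have h := exists_isMIntegralCurveOn_Ici hX hin x
  have e : (fun t => flow X t x) = h.choose := by
    funext t
    exact dif_pos h
  exact ⟨(congrFun e 0).trans h.choose_spec.1, e ▸ h.choose_spec.2⟩

theorem flow_zero (x : M) : flow X 0 x = x := (flow_spec hX hin x).1

theorem isMIntegralCurveOn_flow (x : M) : IsMIntegralCurveOn (fun t => flow X t x) X (Ici 0) :=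
  (flow_spec hX hin x).2

theorem continuousOn_flow (x : M) : ContinuousOn (fun t => flow X t x) (Ici 0) :=
  (isMIntegralCurveOn_flow hX hin x).continuousOn

theorem flow_eq_of_isMIntegralCurveOn {x : M} {γ : ℝ → M} {T : ℝ}
    (hγ : IsMIntegralCurveOn γ X (Icc 0 T)) (h0 : γ 0 = x) {t : ℝ} (ht : t ∈ Icc 0 T) :
    flow X t x = γ t :=
  eqOn_Icc_of_isMIntegralCurveOn hX hin
    ((isMIntegralCurveOn_flow hX hin x).mono Icc_subset_Ici_self) hγ
    (by rw [h0]; exact flow_zero hX hin x) ht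

theorem flow_add {s t : ℝ} (hs : 0 ≤ s) (ht : 0 ≤ t) (x : M) :
    flow X (s + t) x = flow X t (flow X s x) := by
  have h1 := (isMIntegralCurveOn_flow hX hin x).comp_add s
  have h2 : IsMIntegralCurveOn ((fun t => flow X t x) ∘ (· + s)) X (Icc 0 t) :=
    h1.mono fun r hr => by
      have := hr.1
      simp only [mem_ofPred_eq, mem_Ici]
      linarith
  rw [flow_eq_of_isMIntegralCurveOn hX hin h2 (by simp) ⟨ht, le_rfl⟩]
  simp [add_comm]

theorem LocalFlow.flow_eq {p : M} (l : LocalFlow X p) {x : M} (hx : x ∈ l.dom) {t : ℝ}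
    (ht : t ∈ Icc 0 l.ε) : flow X t x = l.curve x t :=
  flow_eq_of_isMIntegralCurveOn hX hin (l.isMIntegralCurveOn_curve hx) (l.curve_zero hx) ht

/-- Restart slightly before time t, within the domain of the local flow centred at X_t(x): at
positive times this local flow lands in the interior, even if its centre were on the boundary. -/
theorem flow_mem_interior (x : M) {t : ℝ} (ht : 0 < t) :
    flow X t x ∈ (𝓡∂ n).interior M := by
  obtain ⟨l⟩ := exists_localFlow hX hin (flow X t x)
  have hc : ContinuousAt (fun s => flow X s x) t :=
    (continuousOn_flow hX hin x).continuousAt (Ici_mem_nhds ht)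
  obtain ⟨τ, hτ, h⟩ := Metric.continuousAt_iff'.1 (continuousAt_id (x := t)) (min t l.ε)
    (lt_min ht l.hε) |>.and (hc.eventually_mem l.dom_mem_nhds) |>.filter_mono
      (nhdsWithin_le_nhds (s := Iio t)) |>.and self_mem_nhdsWithin |>.exists
  rw [id, id, Real.dist_eq, abs_lt] at hτ
  have h0 : 0 ≤ τ := by linarith [hτ.1.1, min_le_left t l.ε]
  have h1 : t - τ ∈ Ioc 0 l.ε :=
    ⟨sub_pos.2 h, by linarith [hτ.1.1, min_le_right t l.ε]⟩
  have h2 : flow X t x = flow X (t - τ) (flow X τ x) := by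
    rw [← flow_add hX hin h0 h1.1.le]; congr 1; ring
  rw [h2, l.flow_eq hX hin hτ.2 (Ioc_subset_Icc_self h1)]
  exact l.curve_mem_interior hτ.2 h1

end Existence

end HypAttr

/-! ### Differentiability of the flow at interior points. -/

namespace HypAttr

variable {n : ℕ} [NeZero n] {M : Type*} [TopologicalSpace M]
  [ChartedSpace (EuclideanHalfSpace n) M] [IsManifold (𝓡∂ n) ∞ M]

section Strict

variable {E' : Type*} [NormedAddCommGroup E'] [NormedSpace ℝ E'] {H' : Type*} [TopologicalSpace H']
  {I' : ModelWithCorners ℝ E' H'} {N : Type*} [TopologicalSpace N] [ChartedSpace H' N]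

omit [IsManifold (𝓡∂ n) ∞ M] in
theorem hasStrictFDerivAt_writtenInExtChartAt {f : M → N} {x : M}
    (hx : x ∈ (𝓡∂ n).interior M) (hf : ContMDiffAt (𝓡∂ n) I' 1 f x) :
    HasStrictFDerivAt (writtenInExtChartAt (𝓡∂ n) I' x f)
      (show EuclideanSpace ℝ (Fin n) →L[ℝ] E' from mfderiv (𝓡∂ n) I' f x)
      (extChartAt (𝓡∂ n) x x) := by
  have hR : range (𝓡∂ n) ∈ 𝓝 (extChartAt (𝓡∂ n) x x) := range_mem_nhds_isInteriorPoint hx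
  have h1 := ((contMDiffAt_iff.1 hf).2).contDiffAt hR
  have h2 := (hf.mdifferentiableAt one_ne_zero).hasMFDerivAt.2
  exact h1.hasStrictFDerivAt' (h2.hasFDerivAt hR) one_ne_zero

omit [IsManifold (𝓡∂ n) ∞ M] in
theorem hasStrictFDerivAt_comp_extChartAt_symm {f : M → E'} {x : M}
    (hx : x ∈ (𝓡∂ n).interior M) (hf : ContMDiffAt (𝓡∂ n) 𝓘(ℝ, E') 1 f x) :
    HasStrictFDerivAt (f ∘ (extChartAt (𝓡∂ n) x).symm)
      (show EuclideanSpace ℝ (Fin n) →L[ℝ] E' from mfderiv (𝓡∂ n) 𝓘(ℝ, E') f x)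
      (extChartAt (𝓡∂ n) x x) :=
  hasStrictFDerivAt_writtenInExtChartAt hx hf

omit [IsManifold (𝓡∂ n) ∞ M] in
theorem extChartAt_target_mem_nhds_of_interior {x : M} (hx : x ∈ (𝓡∂ n).interior M) :
    (extChartAt (𝓡∂ n) x).target ∈ 𝓝 (extChartAt (𝓡∂ n) x x) := by
  have h := extChartAt_target_mem_nhdsWithin (I := 𝓡∂ n) x
  rwa [nhdsWithin_eq_nhds.2 (range_mem_nhds_isInteriorPoint hx)] at h

end Strict

variable {X : ∀ x : M, TangentSpace (𝓡∂ n) x}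

namespace LocalFlow

variable {p : M} (l : LocalFlow X p)

theorem hasStrictFDerivAt_Φ (hp : p ∈ (𝓡∂ n).interior M) {u : EuclideanSpace ℝ (Fin n)}
    (hu : u ∈ Metric.ball (extChartAt (𝓡∂ n) p p) l.ρ) {t : ℝ} (ht : t ∈ Icc 0 l.ε) :
    ∃ L : EuclideanSpace ℝ (Fin n) →L[ℝ] EuclideanSpace ℝ (Fin n),
      HasStrictFDerivAt (l.Φ · t) L u ∧ Function.Injective L :=
  hasStrictFDerivAt_flow l.lip Metric.isOpen_ball (l.smooth hp).2 l.small l.Φ_zero l.deriv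
    (fun _ hs => l.stays u hu _ hs) ht

end LocalFlow

variable [CompactSpace M] [T2Space M]
  (hX : ContMDiff (𝓡∂ n) (𝓡∂ n).tangent 1 (fun x => (⟨x, X x⟩ : TangentBundle (𝓡∂ n) M)))
  (hin : InwardlyTransverse X)

include hX hin

theorem LocalFlow.contMDiffAt_flow {p : M} (l : LocalFlow X p) (hp : p ∈ (𝓡∂ n).interior M)
    {x : M} (hx : x ∈ l.dom) {t : ℝ} (ht : t ∈ Icc 0 l.ε) :
    ContMDiffAt (𝓡∂ n) (𝓡∂ n) 1 (flow X t) x ∧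
      Function.Injective (mfderiv (𝓡∂ n) (𝓡∂ n) (flow X t) x) := by
  set φ := extChartAt (𝓡∂ n) p
  have heq : flow X t =ᶠ[𝓝 x] φ.symm ∘ (l.Φ · t) ∘ φ :=
    eventually_of_mem (l.isOpen_dom.mem_nhds hx) fun y hy => l.flow_eq hX hin hy ht
  have hsrc : x ∈ (chartAt (EuclideanHalfSpace n) p).source := by
    rw [← extChartAt_source (𝓡∂ n)]; exact hx.1
  have h1 : ContMDiffAt (𝓡∂ n) 𝓘(ℝ, EuclideanSpace ℝ (Fin n)) 1 φ x := contMDiffAt_extChartAt' hsrc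
  obtain ⟨L, hL, hLinj⟩ := l.hasStrictFDerivAt_Φ hp hx.2 ht
  have h2 : ContMDiffAt 𝓘(ℝ, EuclideanSpace ℝ (Fin n)) 𝓘(ℝ, EuclideanSpace ℝ (Fin n)) 1
      (l.Φ · t) (φ x) :=
    (contDiffAt_one_of_hasStrictFDerivAt Metric.isOpen_ball (fun y hy => by
      obtain ⟨L, hL, -⟩ := l.hasStrictFDerivAt_Φ hp hy ht
      exact ⟨L, hL⟩) hx.2).contMDiffAt
  have hint := (l.smooth hp).1 (l.stays _ hx.2 t ht)
  have htar := l.mem_target hx ht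
  have hR : range (𝓡∂ n) ∈ 𝓝 (l.Φ (φ x) t) := mem_interior_iff_mem_nhds.1 hint
  have hT : φ.target ∈ 𝓝 (l.Φ (φ x) t) := by
    have h := extChartAt_target_mem_nhdsWithin_of_mem (I := 𝓡∂ n) htar
    rwa [nhdsWithin_eq_nhds.2 hR] at h
  have h3 : ContMDiffAt 𝓘(ℝ, EuclideanSpace ℝ (Fin n)) (𝓡∂ n) 1 φ.symm (l.Φ (φ x) t) :=
    (contMDiffOn_extChartAt_symm p).contMDiffAt hT
  have h32 := h3.comp (φ x) h2
  have h321 := h32.comp x h1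
  refine ⟨h321.congr_of_eventuallyEq heq, ?_⟩
  rw [heq.mfderiv_eq]
  have e1 := (h1.mdifferentiableAt one_ne_zero).hasMFDerivAt
  have e2 := hL.hasFDerivAt.hasMFDerivAt
  have e3 := (h3.mdifferentiableAt one_ne_zero).hasMFDerivAt
  have e := (HasMFDerivAt.comp x (HasMFDerivAt.comp (φ x) e3 e2) e1).mfderiv
  have i1 : Function.Injective (mfderiv (𝓡∂ n) 𝓘(ℝ, EuclideanSpace ℝ (Fin n)) φ x) :=
    (isInvertible_mfderiv_extChartAt hx.1).injective
  have i3 : Function.Injective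
      (mfderiv 𝓘(ℝ, EuclideanSpace ℝ (Fin n)) (𝓡∂ n) φ.symm (l.Φ (φ x) t)) := by
    rw [← mfderivWithin_of_mem_nhds hR]
    exact (isInvertible_mfderivWithin_extChartAt_symm htar).injective
  have e' : mfderiv (𝓡∂ n) (𝓡∂ n) (φ.symm ∘ (l.Φ · t) ∘ φ) x =
      ((mfderiv 𝓘(ℝ, EuclideanSpace ℝ (Fin n)) (𝓡∂ n) φ.symm (l.Φ (φ x) t)).comp L).comp
        (mfderiv (𝓡∂ n) 𝓘(ℝ, EuclideanSpace ℝ (Fin n)) φ x) := e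
  rw [e']
  exact (i3.comp hLinj).comp i1

theorem flow_mem_interior_of_mem {x : M} (hx : x ∈ (𝓡∂ n).interior M) {t : ℝ} (ht : 0 ≤ t) :
    flow X t x ∈ (𝓡∂ n).interior M := by
  rcases ht.eq_or_lt with rfl | h
  · rwa [flow_zero hX hin]
  · exact flow_mem_interior hX hin x h

/-- Compactness of the orbit segment over [0, T]: a Lebesgue number cuts it into steps short enough
for `hloc`, and `hadd` glues them. -/
theorem orbit_induction {P : M → ℝ → Prop}
    (hadd : ∀ x ∈ (𝓡∂ n).interior M, ∀ s t : ℝ, 0 ≤ s → 0 ≤ t → P x s → P (flow X s x) t →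
      P x (s + t))
    (hloc : ∀ p ∈ (𝓡∂ n).interior M, ∃ W ∈ 𝓝 p, ∃ ε > 0, ∀ x ∈ W, ∀ t ∈ Icc 0 ε, P x t)
    {x : M} (hx : x ∈ (𝓡∂ n).interior M) {T : ℝ} (hT : 0 ≤ T) : P x T := by
  have h1 : ∀ t : ℝ, 0 ≤ t → ∃ δ > 0, ∀ s ∈ Metric.ball t δ, ∀ r ∈ Metric.ball t δ, 0 ≤ s → s ≤ r →
      P (flow X s x) (r - s) := by
    intro t ht
    obtain ⟨W, hW, ε, hε, h⟩ := hloc _ (flow_mem_interior_of_mem hX hin hx ht)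
    obtain ⟨δ, hδ, hδW⟩ := Metric.mem_nhdsWithin_iff.1
      ((continuousOn_flow hX hin x t ht).preimage_mem_nhdsWithin hW)
    refine ⟨min δ (ε / 2), lt_min hδ (half_pos hε), fun s hs r hr hs0 hsr => ?_⟩
    refine h _ (hδW ⟨Metric.ball_subset_ball (min_le_left _ _) hs, hs0⟩) _
      ⟨sub_nonneg.2 hsr, ?_⟩
    have a1 := Metric.ball_subset_ball (min_le_right _ _) hs
    have a2 := Metric.ball_subset_ball (min_le_right _ _) hr
    rw [Metric.mem_ball, Real.dist_eq, abs_lt] at a1 a2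
    linarith [a1.1, a2.2]
  choose! δ hδ h1 using h1
  obtain ⟨η, hη, hcov⟩ := lebesgue_number_lemma_of_metric (isCompact_Icc (a := (0 : ℝ)) (b := T))
    (c := fun t : Icc (0 : ℝ) T => Metric.ball t.1 (δ t.1)) (fun _ => Metric.isOpen_ball)
    (fun t ht => mem_iUnion.2 ⟨⟨t, ht⟩, Metric.mem_ball_self (hδ t ht.1)⟩)
  obtain ⟨N, hN⟩ := exists_nat_gt (T / η)
  have hN0 : (0 : ℝ) < N := lt_of_le_of_lt (by positivity) hN
  have hstep : T / N < η := by
    rw [div_lt_iff₀ hη] at hN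
    rw [div_lt_iff₀ hN0]; linarith
  have hstep0 : 0 ≤ T / N := by positivity
  have key : ∀ k : ℕ, k ≤ N → P x (k * (T / N)) := by
    intro k
    induction k with
    | zero =>
      intro _
      obtain ⟨W, hW, ε, hε, h⟩ := hloc x hx
      simpa using h x (mem_of_mem_nhds hW) 0 ⟨le_rfl, hε.le⟩
    | succ k ih =>
      intro hk
      have hkN : (k : ℝ) + 1 ≤ N := by exact_mod_cast hk
      have hkT : k * (T / N) ∈ Icc 0 T := by
        refine ⟨by positivity, ?_⟩
        calc k * (T / N) ≤ N * (T / N) := by gcongr; linarith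
          _ = T := by field_simp
      obtain ⟨i, hi⟩ := hcov _ hkT
      have h3 := h1 i.1 i.2.1 (k * (T / N)) (hi (Metric.mem_ball_self hη)) ((k + 1) * (T / N))
        (hi (by rw [Metric.mem_ball, Real.dist_eq, abs_lt]; constructor <;> nlinarith))
        hkT.1 (by nlinarith)
      have h4 : (k + 1) * (T / N) - k * (T / N) = T / N := by ring
      rw [h4] at h3
      have h5 := hadd x hx _ _ hkT.1 hstep0 (ih (by omega)) h3
      convert h5 using 1
      push_cast; ring
  have := key N le_rfl
  rwa [mul_div_cancel₀ _ hN0.ne'] at this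

theorem contMDiffAt_flow_and_injective {x : M} (hx : x ∈ (𝓡∂ n).interior M) {t : ℝ}
    (ht : 0 ≤ t) : ContMDiffAt (𝓡∂ n) (𝓡∂ n) 1 (flow X t) x ∧
      Function.Injective (mfderiv (𝓡∂ n) (𝓡∂ n) (flow X t) x) := by
  refine orbit_induction hX hin (P := fun x t => ContMDiffAt (𝓡∂ n) (𝓡∂ n) 1 (flow X t) x ∧
      Function.Injective (mfderiv (𝓡∂ n) (𝓡∂ n) (flow X t) x)) ?_ ?_ hx ht
  · rintro y - s r hs hr ⟨c1, i1⟩ ⟨c2, i2⟩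
    have e : flow X (s + r) = flow X r ∘ flow X s := funext fun z => flow_add hX hin hs hr z
    rw [e]
    refine ⟨c2.comp y c1, ?_⟩
    rw [mfderiv_comp y (c2.mdifferentiableAt one_ne_zero) (c1.mdifferentiableAt one_ne_zero)]
    exact i2.comp i1
  · intro p hp
    obtain ⟨l⟩ := exists_localFlow hX hin p
    exact ⟨l.dom, l.dom_mem_nhds, l.ε, l.hε, fun y hy r hr => l.contMDiffAt_flow hX hin hp hy hr⟩

theorem contMDiffAt_flow {x : M} (hx : x ∈ (𝓡∂ n).interior M) {t : ℝ} (ht : 0 ≤ t) :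
    ContMDiffAt (𝓡∂ n) (𝓡∂ n) 1 (flow X t) x :=
  (contMDiffAt_flow_and_injective hX hin hx ht).1

theorem injective_dflow {x : M} (hx : x ∈ (𝓡∂ n).interior M) {t : ℝ} (ht : 0 ≤ t) :
    Function.Injective (dflow X t x) :=
  (contMDiffAt_flow_and_injective hX hin hx ht).2

/-- An injective derivative between spaces of the same dimension is onto, and the surjective mapping
theorem applies. It is what lets a point chosen near X_t(x) be traced back to a point near x. -/
theorem image_flow_mem_nhds {x : M} (hx : x ∈ (𝓡∂ n).interior M) {t : ℝ} (ht : 0 ≤ t) {V : Set M}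
    (hV : V ∈ 𝓝 x) : flow X t '' V ∈ 𝓝 (flow X t x) := by
  set y := flow X t x
  have hs := hasStrictFDerivAt_writtenInExtChartAt hx (contMDiffAt_flow hX hin hx ht)
  set L : EuclideanSpace ℝ (Fin n) →L[ℝ] EuclideanSpace ℝ (Fin n) :=
    mfderiv (𝓡∂ n) (𝓡∂ n) (flow X t) x
  have hLi : Function.Injective L := injective_dflow hX hin hx ht
  have hLs : L.range = ⊤ :=
    LinearMap.range_eq_top.2 (LinearMap.surjective_of_injective (f := L.toLinearMap) hLi)
  have hmap := HasStrictFDerivAt.map_nhds_eq_of_surj (f' := L) hs hLs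
  have hval : writtenInExtChartAt (𝓡∂ n) (𝓡∂ n) x (flow X t) (extChartAt (𝓡∂ n) x x) =
      extChartAt (𝓡∂ n) y y := by
    simp only [writtenInExtChartAt, Function.comp_apply, extChartAt_to_inv, y]
  rw [hval] at hmap
  have hA : (extChartAt (𝓡∂ n) x).symm ⁻¹' (V ∩ flow X t ⁻¹' (extChartAt (𝓡∂ n) y).source) ∈
      𝓝 (extChartAt (𝓡∂ n) x x) := by
    refine (continuousAt_extChartAt_symm x).preimage_mem_nhds ?_
    rw [extChartAt_to_inv]
    exact inter_mem hV ((contMDiffAt_flow hX hin hx ht).continuousAt.preimage_mem_nhds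
      (extChartAt_source_mem_nhds y))
  have hB := image_mem_map (m := writtenInExtChartAt (𝓡∂ n) (𝓡∂ n) x (flow X t)) hA
  rw [hmap] at hB
  have hC := inter_mem ((continuousAt_extChartAt (I := 𝓡∂ n) y).preimage_mem_nhds hB)
    (extChartAt_source_mem_nhds (I := 𝓡∂ n) y)
  refine mem_of_superset hC ?_
  rintro z ⟨⟨u, ⟨hu1, hu2⟩, huz⟩, hz⟩
  exact ⟨_, hu1, (extChartAt (𝓡∂ n) y).injOn hu2 hz huz⟩

/-- Differentiate X_t(X_s(x)) = X_{s+t}(x) at s = 0, from the right only. -/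
theorem dflow_apply_self {x : M} (hx : x ∈ (𝓡∂ n).interior M) {t : ℝ} (ht : 0 ≤ t) :
    dflow X t x (X x) = X (flow X t x) := by
  have h0 := flow_zero hX hin x
  have hγ : HasMFDerivWithinAt 𝓘(ℝ, ℝ) (𝓡∂ n) (fun s => flow X s x) (Ici 0) 0
      ((1 : ℝ →L[ℝ] ℝ).smulRight (X (flow X 0 x))) :=
    isMIntegralCurveOn_flow hX hin x 0 self_mem_Ici
  have hflow : HasMFDerivAt (𝓡∂ n) (𝓡∂ n) (flow X t) (flow X 0 x)
      (mfderiv (𝓡∂ n) (𝓡∂ n) (flow X t) (flow X 0 x)) := by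
    rw [h0]
    exact ((contMDiffAt_flow hX hin hx ht).mdifferentiableAt one_ne_zero).hasMFDerivAt
  have h1 := hflow.comp_hasMFDerivWithinAt 0 hγ
  have h2 : HasMFDerivWithinAt 𝓘(ℝ, ℝ) (𝓡∂ n) (fun s => flow X (s + t) x) (Ici 0) 0
      ((1 : ℝ →L[ℝ] ℝ).smulRight (X (flow X (0 + t) x))) :=
    ((isMIntegralCurveOn_flow hX hin x).comp_add t 0 (by simpa using ht)).mono
      fun s hs => by
        have : 0 ≤ s := hs
        simp only [mem_ofPred_eq, mem_Ici]; linarith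
  have heq : ∀ s ∈ Ici (0 : ℝ), (flow X t ∘ fun s => flow X s x) s = flow X (s + t) x :=
    fun s hs => (flow_add hX hin hs ht x).symm
  have h3 := h2.congr_of_eventuallyEq (eventually_of_mem self_mem_nhdsWithin heq)
    (heq 0 self_mem_Ici)
  have hu : UniqueMDiffWithinAt 𝓘(ℝ, ℝ) (Ici (0 : ℝ)) 0 :=
    (uniqueDiffOn_Ici (0 : ℝ) 0 self_mem_Ici).uniqueMDiffWithinAt
  have h4 := hu.eq h1 h3
  let X' : M → EuclideanSpace ℝ (Fin n) := X
  let D : M → EuclideanSpace ℝ (Fin n) →L[ℝ] EuclideanSpace ℝ (Fin n) :=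
    fun z => mfderiv (𝓡∂ n) (𝓡∂ n) (flow X t) z
  have h5 : D (flow X 0 x) ((1 : ℝ) • X' (flow X 0 x)) = (1 : ℝ) • X' (flow X (0 + t) x) :=
    DFunLike.congr_fun h4 (1 : ℝ)
  rw [one_smul, one_smul, h0, zero_add] at h5
  exact h5

omit hX hin in
theorem flow_eq_self_of_eq_zero
    (hX : ContMDiff (𝓡∂ n) (𝓡∂ n).tangent 1 (fun x => (⟨x, X x⟩ : TangentBundle (𝓡∂ n) M)))
    (hin : InwardlyTransverse X) {z : M} (hz : X z = 0) {t : ℝ} (ht : 0 ≤ t) :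
    flow X t z = z :=
  flow_eq_of_isMIntegralCurveOn hX hin (γ := fun _ => z) (T := t)
    ((isMIntegralCurve_const hz).isMIntegralCurveOn _) rfl ⟨ht, le_rfl⟩

/-- A constant orbit never leaves one chart, so Gronwall there covers a short time; iteration covers
[0, T]. -/
theorem eventually_flow_mem_of_eq_zero {σ : M} (hσ : X σ = 0) (T : ℝ) {U : Set M}
    (hU : U ∈ 𝓝 σ) : ∀ᶠ z in 𝓝 σ, ∀ t ∈ Icc 0 T, flow X t z ∈ U := by
  obtain ⟨l⟩ := exists_localFlow hX hin σ
  set φ := extChartAt (𝓡∂ n) σ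
  have hK0 : (0 : ℝ) ≤ l.K := l.K.2
  have step : ∀ U ∈ 𝓝 σ, ∀ᶠ z in 𝓝 σ, ∀ t ∈ Icc 0 l.ε, flow X t z ∈ U := by
    intro U hU
    have hfix : ∀ t ∈ Icc 0 l.ε, l.Φ (φ σ) t = φ σ := by
      intro t ht
      have h1 := l.flow_eq hX hin l.mem_dom ht
      rw [flow_eq_self_of_eq_zero hX hin hσ ht.1] at h1
      rw [← φ.right_inv (l.mem_target l.mem_dom ht)]
      exact congrArg φ h1.symm
    have hU' : φ.symm ⁻¹' U ∈ 𝓝 (φ σ) := by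
      refine (continuousAt_extChartAt_symm σ).preimage_mem_nhds ?_
      rwa [extChartAt_to_inv]
    obtain ⟨η, hη, hηU⟩ := Metric.mem_nhds_iff.1 hU'
    have hnear : ∀ᶠ z in 𝓝 σ, φ z ∈ Metric.ball (φ σ) (η / 2) :=
      (continuousAt_extChartAt (I := 𝓡∂ n) σ).eventually_mem (Metric.ball_mem_nhds _ (half_pos hη))
    filter_upwards [hnear, l.dom_mem_nhds] with z hz hzd t ht
    rw [l.flow_eq hX hin hzd ht]
    refine hηU ?_
    have h1 := dist_solution_le (v := fun _ => l.G) (fun _ => l.lip) (l.deriv (φ z))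
      (l.deriv (φ σ)) ht
    rw [l.Φ_zero, l.Φ_zero, hfix t ht] at h1
    have h3 := exp_sub_one_le_half hK0 l.small ht
    have h4 : Real.exp (l.K * t) ≤ Real.exp ((l.K + 1) * t) :=
      Real.exp_le_exp.2 (by nlinarith [ht.1])
    rw [Metric.mem_ball] at hz ⊢
    nlinarith [dist_nonneg (x := φ z) (y := φ σ)]
  have hk : ∀ k : ℕ, ∀ U ∈ 𝓝 σ, ∀ᶠ z in 𝓝 σ, ∀ t ∈ Icc 0 (k * l.ε), flow X t z ∈ U := by
    intro k
    induction k with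
    | zero =>
      intro U hU
      filter_upwards [hU] with z hz t ht
      have : t = 0 := le_antisymm (by simpa using ht.2) ht.1
      rw [this, flow_zero hX hin]
      exact hz
    | succ k ih =>
      intro U hU
      filter_upwards [ih _ (step U hU), ih U hU] with z hz hz' t ht
      rcases le_total t (k * l.ε) with h | h
      · exact hz' t ⟨ht.1, h⟩
      · have h0 : 0 ≤ k * l.ε := mul_nonneg (Nat.cast_nonneg k) l.hε.le
        have := hz (k * l.ε) ⟨h0, le_rfl⟩ (t - k * l.ε) ⟨by linarith, by
          have := ht.2
          push_cast at this
          linarith⟩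
        rwa [← flow_add hX hin h0 (by linarith), add_sub_cancel] at this
  obtain ⟨k, hkT⟩ := exists_nat_gt (T / l.ε)
  rw [div_lt_iff₀ l.hε] at hkT
  filter_upwards [hk k U hU] with z hz t ht
  exact hz t ⟨ht.1, ht.2.trans hkT.le⟩

/-- Every point of Λ = X_1(Λ) has flowed for a positive time. -/
theorem InvariantSet.subset_interior {Λ : Set M} (hΛ : InvariantSet X Λ) :
    Λ ⊆ (𝓡∂ n).interior M := by
  intro z hz
  rw [← hΛ 1 zero_le_one] at hz
  obtain ⟨w, -, rfl⟩ := hz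
  exact flow_mem_interior hX hin w one_pos

end HypAttr

/-! ### Derivatives of the time-t maps read through e; persistence of cone conditions. -/

namespace HypAttr

variable {n : ℕ} [NeZero n] {M : Type*} [TopologicalSpace M]
  [ChartedSpace (EuclideanHalfSpace n) M] [IsManifold (𝓡∂ n) ∞ M]
  {F : Type*} [NormedAddCommGroup F] [NormedSpace ℝ F]

instance (z : M) : FiniteDimensional ℝ (TangentSpace (𝓡∂ n) z) :=
  inferInstanceAs (FiniteDimensional ℝ (EuclideanSpace ℝ (Fin n)))

omit [IsManifold (𝓡∂ n) ∞ M] in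
theorem finrank_tangentSpace (z : M) : Module.finrank ℝ (TangentSpace (𝓡∂ n) z) = n :=
  (finrank_euclideanSpace (𝕜 := ℝ) (ι := Fin n)).trans (Fintype.card_fin n)

/-- The derivative at `z` of the time-`t` map, read through a map `e : M → F`. -/
def embDeriv (e : M → F) (X : ∀ x : M, TangentSpace (𝓡∂ n) x) (t : ℝ) (z : M) :
    TangentSpace (𝓡∂ n) z →L[ℝ] F :=
  mfderiv (𝓡∂ n) 𝓘(ℝ, F) (e ∘ flow X t) z

variable {X : ∀ x : M, TangentSpace (𝓡∂ n) x} {e : M → F}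
  [CompactSpace M] [T2Space M]
  (hX : ContMDiff (𝓡∂ n) (𝓡∂ n).tangent 1 (fun x => (⟨x, X x⟩ : TangentBundle (𝓡∂ n) M)))
  (hin : InwardlyTransverse X) (he : ContMDiff (𝓡∂ n) 𝓘(ℝ, F) 1 e)

include hX hin he

theorem embDeriv_add {z : M} (hz : z ∈ (𝓡∂ n).interior M) {s t : ℝ} (hs : 0 ≤ s) (ht : 0 ≤ t)
    (v : TangentSpace (𝓡∂ n) z) :
    embDeriv e X (s + t) z v = embDeriv e X t (flow X s z) (dflow X s z v) := by
  have h1 := (contMDiffAt_flow hX hin hz hs).mdifferentiableAt one_ne_zero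
  have h2 := (he.contMDiffAt.comp (flow X s z) (contMDiffAt_flow hX hin
    (flow_mem_interior_of_mem hX hin hz hs) ht)).mdifferentiableAt one_ne_zero
  have e1 : e ∘ flow X (s + t) = (e ∘ flow X t) ∘ flow X s :=
    funext fun y => congrArg e (flow_add hX hin hs ht y)
  unfold embDeriv dflow
  rw [e1, mfderiv_comp z h2 h1]
  rfl

omit he in
theorem embDeriv_zero (z : M) : embDeriv e X 0 z = mfderiv (𝓡∂ n) 𝓘(ℝ, F) e z := by
  have : e ∘ flow X 0 = e := funext fun y => congrArg e (flow_zero hX hin y)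
  unfold embDeriv
  rw [this]

theorem embDeriv_eq {z : M} (hz : z ∈ (𝓡∂ n).interior M) {t : ℝ} (ht : 0 ≤ t)
    (v : TangentSpace (𝓡∂ n) z) :
    embDeriv e X t z v = embDeriv e X 0 (flow X t z) (dflow X t z v) := by
  rw [← embDeriv_add hX hin he hz ht le_rfl, add_zero]

theorem embDeriv_self {z : M} (hz : z ∈ (𝓡∂ n).interior M) {t : ℝ} (ht : 0 ≤ t) :
    embDeriv e X t z (X z) = embDeriv e X 0 (flow X t z) (X (flow X t z)) := by
  rw [embDeriv_eq hX hin he hz ht, dflow_apply_self hX hin hz ht]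

theorem injective_embDeriv (hinj : ∀ x, Function.Injective (mfderiv (𝓡∂ n) 𝓘(ℝ, F) e x)) {z : M}
    (hz : z ∈ (𝓡∂ n).interior M) {t : ℝ} (ht : 0 ≤ t) : Function.Injective (embDeriv e X t z) := by
  intro v w h
  rw [embDeriv_eq hX hin he hz ht, embDeriv_eq hX hin he hz ht, embDeriv_zero hX hin] at h
  exact injective_dflow hX hin hz ht (hinj _ h)

theorem contMDiffAt_embed_comp_flow {p : M} (hp : p ∈ (𝓡∂ n).interior M) {t : ℝ} (ht : 0 ≤ t) :
    ContMDiffAt (𝓡∂ n) 𝓘(ℝ, F) 1 (e ∘ flow X t) p :=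
  he.contMDiffAt.comp p (contMDiffAt_flow hX hin hp ht)

theorem contDiffAt_embed_comp_flow {p : M} (hp : p ∈ (𝓡∂ n).interior M) {t : ℝ} (ht : 0 ≤ t) :
    ContDiffAt ℝ 1 ((e ∘ flow X t) ∘ (extChartAt (𝓡∂ n) p).symm) (extChartAt (𝓡∂ n) p p) := by
  have hR : range (𝓡∂ n) ∈ 𝓝 (extChartAt (𝓡∂ n) p p) := range_mem_nhds_isInteriorPoint hp
  exact ((contMDiffAt_iff.1 (contMDiffAt_embed_comp_flow hX hin he hp ht)).2).contDiffAt hR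

/-- This puts the tangent spaces near p into one fixed space, where the derivatives depend
continuously on the point. -/
theorem eventually_embDeriv_eq_fderiv {p : M} (hp : p ∈ (𝓡∂ n).interior M) {t : ℝ} (ht : 0 ≤ t) :
    ∀ᶠ z in 𝓝 p, ∀ v : TangentSpace (𝓡∂ n) z, embDeriv e X t z v =
      fderiv ℝ ((e ∘ flow X t) ∘ (extChartAt (𝓡∂ n) p).symm) (extChartAt (𝓡∂ n) p z)
        (mfderiv (𝓡∂ n) 𝓘(ℝ, EuclideanSpace ℝ (Fin n)) (extChartAt (𝓡∂ n) p) z v) := by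
  set φ := extChartAt (𝓡∂ n) p
  have h1 := (contDiffAt_embed_comp_flow hX hin he hp ht).eventually (by simp)
  have h2 := (continuousAt_extChartAt (I := 𝓡∂ n) p).eventually h1
  filter_upwards [h2, extChartAt_source_mem_nhds (I := 𝓡∂ n) p] with z hz hzs v
  have heq : e ∘ flow X t =ᶠ[𝓝 z] ((e ∘ flow X t) ∘ φ.symm) ∘ φ := by
    filter_upwards [(isOpen_extChartAt_source p).mem_nhds hzs] with y hy
    simp only [Function.comp_apply, φ.left_inv hy]
  have hsrc : z ∈ (chartAt (EuclideanHalfSpace n) p).source := by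
    rwa [← extChartAt_source (𝓡∂ n)]
  have d1 : MDifferentiableAt (𝓡∂ n) 𝓘(ℝ, EuclideanSpace ℝ (Fin n)) φ z :=
    mdifferentiableAt_extChartAt hsrc
  have d2 := (hz.differentiableAt one_ne_zero).hasFDerivAt.hasMFDerivAt
  have := (HasMFDerivAt.comp z d2 d1.hasMFDerivAt).mfderiv
  unfold embDeriv
  rw [heq.mfderiv_eq, this]
  rfl

/-- An open conical condition on the sizes of the derivatives of finitely many time-`t` maps which
holds on a subspace of `T_p M` holds on subspaces of the same dimension at the nearby points. -/
theorem eventually_exists_submodule {ι : Type*} [Finite ι] {t : ι → ℝ} (ht : ∀ i, 0 ≤ t i)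
    {O : Set (ι → ℝ)} (hO : IsOpen O) (hc : ∀ r : ℝ, 0 < r → ∀ x ∈ O, r • x ∈ O) {p : M}
    (hp : p ∈ (𝓡∂ n).interior M) {B : Submodule ℝ (TangentSpace (𝓡∂ n) p)}
    (hB : ∀ v ∈ B, v ≠ 0 → (fun i => ‖embDeriv e X (t i) p v‖) ∈ O) :
    ∀ᶠ z in 𝓝 p, ∃ B' : Submodule ℝ (TangentSpace (𝓡∂ n) z),
      Module.finrank ℝ B' = Module.finrank ℝ B ∧
      ∀ v ∈ B', v ≠ 0 → (fun i => ‖embDeriv e X (t i) z v‖) ∈ O := by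
  set φ := extChartAt (𝓡∂ n) p
  let a : ι → EuclideanSpace ℝ (Fin n) → F := fun i => (e ∘ flow X (t i)) ∘ φ.symm
  have ha := fun i => contDiffAt_embed_comp_flow hX hin he hp (ht i)
  have hev : ∀ᶠ z in 𝓝 p, ∀ i, ∀ v : TangentSpace (𝓡∂ n) z, embDeriv e X (t i) z v =
      fderiv ℝ (a i) (φ z) (mfderiv (𝓡∂ n) 𝓘(ℝ, EuclideanSpace ℝ (Fin n)) φ z v) :=
    eventually_all.2 fun i => eventually_embDeriv_eq_fderiv hX hin he hp (ht i)
  have hequiv : ∀ z ∈ φ.source, ∃ D : TangentSpace (𝓡∂ n) z ≃ₗ[ℝ] EuclideanSpace ℝ (Fin n),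
      ∀ v, D v = mfderiv (𝓡∂ n) 𝓘(ℝ, EuclideanSpace ℝ (Fin n)) φ z v := by
    intro z hz
    obtain ⟨D, hD⟩ := isInvertible_mfderiv_extChartAt hz
    exact ⟨D.toLinearEquiv, fun v => DFunLike.congr_fun hD v⟩
  obtain ⟨D₀, hD₀⟩ := hequiv p (mem_extChartAt_source p)
  -- The subspace at a nearby point is the one with the same coordinates as `B` in the chart at `p`;
  -- homogeneity reduces the condition to the compact unit sphere of `C`.
  let C : Submodule ℝ (EuclideanSpace ℝ (Fin n)) := B.map D₀.toLinearMap
  have hK : IsCompact (Metric.sphere (0 : EuclideanSpace ℝ (Fin n)) 1 ∩ C) :=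
    (isCompact_sphere _ _).inter_right C.closed_of_finiteDimensional
  have hloc : ∀ᶠ u in 𝓝 (φ p), ∀ v ∈ Metric.sphere (0 : EuclideanSpace ℝ (Fin n)) 1 ∩ C,
      (fun i => ‖fderiv ℝ (a i) u v‖) ∈ O := by
    refine hK.eventually_forall_of_forall_eventually fun v hv => ?_
    have hcont : ContinuousAt (fun q : EuclideanSpace ℝ (Fin n) × EuclideanSpace ℝ (Fin n) =>
        fun i => ‖fderiv ℝ (a i) q.1 q.2‖) (φ p, v) := by
      refine continuousAt_pi.2 fun i => ContinuousAt.norm ?_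
      have h1 : ContinuousAt (fderiv ℝ (a i)) (φ p) :=
        ((ha i).fderiv_right (m := 0) (by simp)).continuousAt
      exact (h1.comp (f := Prod.fst) (x := (φ p, v)) continuousAt_fst).clm_apply continuousAt_snd
    refine hcont.eventually (hO.mem_nhds ?_)
    obtain ⟨w, hw, hwv⟩ := hv.2
    have hw0 : w ≠ 0 := by
      rintro rfl
      rw [map_zero] at hwv
      have := hv.1
      rw [← hwv] at this
      simp at this
    have h3 := hB w hw hw0
    have h4 : ∀ i, embDeriv e X (t i) p w = fderiv ℝ (a i) (φ p) v := fun i => by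
      rw [hev.self_of_nhds i w, ← hD₀, ← hwv]; rfl
    simpa only [h4] using h3
  filter_upwards [hev, (continuousAt_extChartAt (I := 𝓡∂ n) p).eventually hloc,
    extChartAt_source_mem_nhds (I := 𝓡∂ n) p] with z hz1 hz2 hz3
  obtain ⟨D, hD⟩ := hequiv z hz3
  refine ⟨C.comap D.toLinearMap, ?_, fun v hv hv0 => ?_⟩
  · have e1 := LinearEquiv.finrank_map_eq D₀ B
    have e2 := LinearEquiv.finrank_map_eq D.symm C
    have e3 : C.comap D.toLinearMap = C.map D.symm.toLinearMap :=
      (Submodule.map_equiv_eq_comap_symm D.symm C).symm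
    rw [e3]
    exact e2.trans e1
  · have hDv : ‖D v‖ ≠ 0 := by simpa using hv0
    have hDv' : 0 < ‖D v‖ := norm_pos_iff.2 (by simpa using hv0)
    have := hc _ hDv' _ (hz2 (‖D v‖⁻¹ • D v) ⟨by simp [norm_smul, hDv], C.smul_mem _ hv⟩)
    convert this using 2 with i
    rw [hz1 i v, ← hD, Pi.smul_apply, map_smul, norm_smul, norm_inv, norm_norm, smul_eq_mul,
      mul_inv_cancel_left₀ hDv]

theorem eventually_of_cone {ι : Type*} [Finite ι] {t : ι → ℝ} (ht : ∀ i, 0 ≤ t i)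
    {O : Set (ι → ℝ)} (hO : IsOpen O) (hc : ∀ r : ℝ, 0 < r → ∀ x ∈ O, r • x ∈ O) {p : M}
    (hp : p ∈ (𝓡∂ n).interior M)
    (h : ∀ v : TangentSpace (𝓡∂ n) p, v ≠ 0 → (fun i => ‖embDeriv e X (t i) p v‖) ∈ O) :
    ∀ᶠ z in 𝓝 p, ∀ v : TangentSpace (𝓡∂ n) z, v ≠ 0 →
      (fun i => ‖embDeriv e X (t i) z v‖) ∈ O := by
  filter_upwards [eventually_exists_submodule hX hin he ht hO hc hp (B := ⊤) fun v _ => h v]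
    with z ⟨B', hB', hz⟩ v hv
  refine hz v ?_ hv
  have : B' = ⊤ := Submodule.eq_top_of_finrank_eq (by
    rw [hB', finrank_top, finrank_tangentSpace, finrank_tangentSpace])
  rw [this]
  exact Submodule.mem_top

/-- At one point the derivative at time s is bounded below by injectivity in finite dimension. The
strict inequality is an open cone condition, so the constant serves a neighborhood, and compactness
of Λ finishes. -/
theorem exists_embDeriv_le (hinj : ∀ x, Function.Injective (mfderiv (𝓡∂ n) 𝓘(ℝ, F) e x))
    {Λ : Set M} (hΛ : IsCompact Λ) (hΛi : Λ ⊆ (𝓡∂ n).interior M) {s t : ℝ} (hs : 0 ≤ s)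
    (ht : 0 ≤ t) :
    ∃ C : ℝ, 0 < C ∧ ∀ z ∈ Λ, ∀ v, ‖embDeriv e X t z v‖ ≤ C * ‖embDeriv e X s z v‖ := by
  refine hΛ.induction_on ⟨1, one_pos, by simp⟩ ?_ ?_ ?_
  · rintro S S' hSS ⟨C, hC, h⟩
    exact ⟨C, hC, fun z hz => h z (hSS hz)⟩
  · rintro S S' ⟨C, hC, h⟩ ⟨C', hC', h'⟩
    refine ⟨max C C', lt_max_of_lt_left hC, ?_⟩
    rintro z (hz | hz) v
    · exact (h z hz v).trans (by gcongr; exact le_max_left _ _)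
    · exact (h' z hz v).trans (by gcongr; exact le_max_right _ _)
  · intro p hp
    have hLi := injective_embDeriv hX hin he hinj (hΛi hp) hs
    let L : EuclideanSpace ℝ (Fin n) →L[ℝ] F := embDeriv e X s p
    let L' : EuclideanSpace ℝ (Fin n) →L[ℝ] F := embDeriv e X t p
    obtain ⟨c, hc, hcL⟩ := L.toLinearMap.exists_antilipschitzWith (LinearMap.ker_eq_bot.2 hLi)
    have hb : ∀ v, ‖v‖ ≤ c * ‖L v‖ := fun v => by
      have := hcL.le_mul_dist v 0
      rw [dist_zero_right, map_zero, dist_zero_right] at this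
      exact this
    -- The summand 1 makes the comparison strict on nonzero vectors, hence stable under
    -- perturbation.
    set C : ℝ := (‖L'‖ + 1) * c
    have hC : 0 < C := by positivity
    have hcone := eventually_of_cone hX hin he (t := fun i : Bool => cond i t s)
      (fun i => by cases i <;> assumption) (O := {x | x true < C * x false})
      (isOpen_lt (by fun_prop) (by fun_prop)) (fun r hr x hx => by
        simp only [mem_ofPred_eq, Pi.smul_apply, smul_eq_mul] at hx ⊢
        nlinarith) (hΛi hp) (fun v hv => by
        change ‖L' v‖ < C * ‖L v‖
        have hv' : (0 : ℝ) < ‖(show EuclideanSpace ℝ (Fin n) from v)‖ := norm_pos_iff.2 hv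
        have h1 := L'.le_opNorm v
        have h2 := hb v
        calc ‖L' v‖ ≤ ‖L'‖ * ‖(show EuclideanSpace ℝ (Fin n) from v)‖ := h1
          _ < (‖L'‖ + 1) * ‖(show EuclideanSpace ℝ (Fin n) from v)‖ := by nlinarith
          _ ≤ (‖L'‖ + 1) * (c * ‖L v‖) := by gcongr
          _ = C * ‖L v‖ := by ring)
    refine ⟨_, mem_nhdsWithin_of_mem_nhds hcone, C, hC, fun z hz v => ?_⟩
    rcases eq_or_ne v 0 with rfl | hv
    · simp
    · exact (hz v hv).le

end HypAttr

/-! ### Comparison of Riemannian norms with norms measured through e. -/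

namespace HypAttr

variable {n : ℕ} [NeZero n] {M : Type*} [TopologicalSpace M]
  [ChartedSpace (EuclideanHalfSpace n) M] [IsManifold (𝓡∂ n) ∞ M]
  {F : Type*} [NormedAddCommGroup F] [NormedSpace ℝ F]

theorem RiemMetric.exists_norm_extChartAt_le (g : RiemMetric n M) (p : M) :
    ∃ C : ℝ, 0 < C ∧ ∀ᶠ z in 𝓝 p, ∀ v : TangentSpace (𝓡∂ n) z,
      g.norm z v ≤ C * ‖(show EuclideanSpace ℝ (Fin n) from
        mfderiv (𝓡∂ n) 𝓘(ℝ, EuclideanSpace ℝ (Fin n)) (extChartAt (𝓡∂ n) p) z v)‖ ∧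
      ‖(show EuclideanSpace ℝ (Fin n) from
        mfderiv (𝓡∂ n) 𝓘(ℝ, EuclideanSpace ℝ (Fin n)) (extChartAt (𝓡∂ n) p) z v)‖ ≤
        C * g.norm z v := by
  let : Bundle.RiemannianBundle (fun x : M => TangentSpace (𝓡∂ n) x) := ⟨g.toRiemannianMetric⟩
  have : IsContinuousRiemannianBundle (EuclideanSpace ℝ (Fin n))
      (fun x : M => TangentSpace (𝓡∂ n) x) :=
    ⟨⟨g.inner, g.contMDiff.continuous, fun _ _ _ => rfl⟩⟩
  obtain ⟨C₁, hC₁, h1⟩ := eventually_norm_trivializationAt_lt (EuclideanSpace ℝ (Fin n))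
    (fun x : M => TangentSpace (𝓡∂ n) x) p
  obtain ⟨C₂, hC₂, h2⟩ := eventually_norm_symmL_trivializationAt_lt (EuclideanSpace ℝ (Fin n))
    (fun x : M => TangentSpace (𝓡∂ n) x) p
  have hnorm : ∀ z (v : TangentSpace (𝓡∂ n) z), ‖v‖ = g.norm z v := fun z v =>
    norm_eq_sqrt_real_inner v
  refine ⟨max C₁ C₂, lt_max_of_lt_left hC₁, ?_⟩
  filter_upwards [h1, h2, chart_source_mem_nhds (EuclideanHalfSpace n) p] with z hz1 hz2 hz v
  rw [← hnorm]
  have e1 := TangentBundle.continuousLinearMapAt_trivializationAt (I := 𝓡∂ n) hz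
  have hb : z ∈ (trivializationAt (EuclideanSpace ℝ (Fin n))
      (fun x : M => TangentSpace (𝓡∂ n) x) p).baseSet := by
    simpa using hz
  have e2 := (trivializationAt (EuclideanSpace ℝ (Fin n))
      (fun x : M => TangentSpace (𝓡∂ n) x) p).symmL_continuousLinearMapAt (R := ℝ) hb v
  have hw : ∀ w : EuclideanSpace ℝ (Fin n), (trivializationAt (EuclideanSpace ℝ (Fin n))
      (fun x : M => TangentSpace (𝓡∂ n) x) p).continuousLinearMapAt ℝ z v = w →
      ‖v‖ ≤ max C₁ C₂ * ‖w‖ ∧ ‖w‖ ≤ max C₁ C₂ * ‖v‖ := by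
    rintro w rfl
    constructor
    · nth_rewrite 1 [← e2]
      refine (ContinuousLinearMap.le_opNorm _ _).trans ?_
      gcongr
      exact hz2.le.trans (le_max_right _ _)
    · refine (ContinuousLinearMap.le_opNorm _ _).trans ?_
      gcongr
      exact hz1.le.trans (le_max_left _ _)
  exact hw _ (DFunLike.congr_fun e1 v)

variable {X : ∀ x : M, TangentSpace (𝓡∂ n) x} {e : M → F}
  [CompactSpace M] [T2Space M]
  (hX : ContMDiff (𝓡∂ n) (𝓡∂ n).tangent 1 (fun x => (⟨x, X x⟩ : TangentBundle (𝓡∂ n) M)))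
  (hin : InwardlyTransverse X) (he : ContMDiff (𝓡∂ n) 𝓘(ℝ, F) 1 e)
  (hinj : ∀ x, Function.Injective (mfderiv (𝓡∂ n) 𝓘(ℝ, F) e x))

include hX hin he hinj

/-- Both norms are comparable with the coordinate norm near each point. Consequently the hyperbolic
rates, stated for a Riemannian metric, can be read in the embedding. -/
theorem exists_norm_le_embDeriv (g : RiemMetric n M) {Λ : Set M} (hΛ : IsCompact Λ)
    (hΛi : Λ ⊆ (𝓡∂ n).interior M) :
    ∃ C : ℝ, 0 < C ∧ ∀ z ∈ Λ, ∀ v, g.norm z v ≤ C * ‖embDeriv e X 0 z v‖ ∧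
      ‖embDeriv e X 0 z v‖ ≤ C * g.norm z v := by
  have hg : ∀ z v, 0 ≤ g.norm z v := fun z v => Real.sqrt_nonneg _
  refine hΛ.induction_on ⟨1, one_pos, by simp⟩ ?_ ?_ ?_
  · rintro S S' hSS ⟨C, hC, h⟩
    exact ⟨C, hC, fun z hz => h z (hSS hz)⟩
  · rintro S S' ⟨C, hC, h⟩ ⟨C', hC', h'⟩
    refine ⟨max C C', lt_max_of_lt_left hC, ?_⟩
    rintro z (hz | hz) v
    · exact ⟨(h z hz v).1.trans (by gcongr; exact le_max_left _ _),
        (h z hz v).2.trans (mul_le_mul_of_nonneg_right (le_max_left _ _) (hg _ _))⟩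
    · exact ⟨(h' z hz v).1.trans (by gcongr; exact le_max_right _ _),
        (h' z hz v).2.trans (mul_le_mul_of_nonneg_right (le_max_right _ _) (hg _ _))⟩
  · intro p hp
    obtain ⟨C, hC, hCp⟩ := g.exists_norm_extChartAt_le p
    have hi := hΛi hp
    have ha := contDiffAt_embed_comp_flow hX hin he hi le_rfl
    have hev := eventually_embDeriv_eq_fderiv hX hin he hi le_rfl
    set φ := extChartAt (𝓡∂ n) p
    set a := (e ∘ flow X 0) ∘ φ.symm
    obtain ⟨D, hD⟩ := isInvertible_mfderiv_extChartAt (I := 𝓡∂ n) (mem_extChartAt_source p)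
    have hLi : Function.Injective (fderiv ℝ a (φ p)) := by
      intro v w hvw
      have h3 : ∀ v, mfderiv (𝓡∂ n) 𝓘(ℝ, EuclideanSpace ℝ (Fin n)) φ p (D.symm v) = v := fun v => by
        rw [← hD]; exact D.apply_symm_apply v
      have h1 := (hev.self_of_nhds (D.symm v)).trans (congrArg (fderiv ℝ a (φ p)) (h3 v))
      have h2 := (hev.self_of_nhds (D.symm w)).trans (congrArg (fderiv ℝ a (φ p)) (h3 w))
      have := injective_embDeriv hX hin he hinj hi le_rfl (h1.trans (hvw.trans h2.symm))
      exact D.symm.injective this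
    obtain ⟨c, hc, hcL⟩ := (fderiv ℝ a (φ p)).toLinearMap.exists_antilipschitzWith
      (LinearMap.ker_eq_bot.2 hLi)
    have hb : ∀ v, ‖v‖ ≤ c * ‖fderiv ℝ a (φ p) v‖ := fun v => by
      have := hcL.le_mul_dist v 0
      rw [dist_zero_right, map_zero, dist_zero_right] at this
      exact this
    have hc0 : (0 : ℝ) < c := hc
    have hcont : ContinuousAt (fderiv ℝ a) (φ p) :=
      (ha.fderiv_right (m := 0) (by simp)).continuousAt
    -- A perturbation of size 1/(2c) costs half of the lower bound 1/c.
    have hnear : ∀ᶠ z in 𝓝 p, dist (fderiv ℝ a (φ z)) (fderiv ℝ a (φ p)) < (2 * c : ℝ)⁻¹ :=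
      (continuousAt_extChartAt (I := 𝓡∂ n) p).eventually
        (hcont.eventually (Metric.ball_mem_nhds _ (by positivity)))
    set B := ‖fderiv ℝ a (φ p)‖ + (2 * c : ℝ)⁻¹
    refine ⟨_, mem_nhdsWithin_of_mem_nhds (inter_mem (inter_mem hCp hnear) hev),
      max (C * (2 * c)) (B * C), by positivity, ?_⟩
    rintro z ⟨⟨hz1, hz2⟩, hz3⟩ v
    obtain ⟨h1, h2⟩ := hz1 v
    have h3 := hz3 v
    let w : EuclideanSpace ℝ (Fin n) :=
      mfderiv (𝓡∂ n) 𝓘(ℝ, EuclideanSpace ℝ (Fin n)) (extChartAt (𝓡∂ n) p) z v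
    change g.norm z v ≤ C * ‖w‖ at h1
    change ‖w‖ ≤ C * g.norm z v at h2
    change embDeriv e X 0 z v = fderiv ℝ a (φ z) w at h3
    rw [h3]
    change dist (fderiv ℝ a (φ z)) (fderiv ℝ a (φ p)) < (2 * c : ℝ)⁻¹ at hz2
    rw [dist_eq_norm] at hz2
    have h4 := (fderiv ℝ a (φ z) - fderiv ℝ a (φ p)).le_of_opNorm_le hz2.le w
    rw [sub_apply] at h4
    have h5 := hb w
    have h6 := norm_sub_norm_le (fderiv ℝ a (φ p) w) (fderiv ℝ a (φ z) w)
    have h7 := norm_sub_norm_le (fderiv ℝ a (φ z) w) (fderiv ℝ a (φ p) w)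
    rw [norm_sub_rev] at h6
    have h8 := (fderiv ℝ a (φ p)).le_opNorm w
    have h9 : ‖w‖ ≤ 2 * c * ‖fderiv ℝ a (φ z) w‖ := by
      have : (c : ℝ) * ((2 * c : ℝ)⁻¹ * ‖w‖) = ‖w‖ / 2 := by field_simp
      nlinarith
    have h10 : ‖fderiv ℝ a (φ z) w‖ ≤ B * ‖w‖ := by
      simp only [B]; linarith
    constructor
    · calc g.norm z v ≤ C * (2 * c * ‖fderiv ℝ a (φ z) w‖) := h1.trans (by gcongr)
        _ = (C * (2 * c)) * ‖fderiv ℝ a (φ z) w‖ := by ring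
        _ ≤ _ := by gcongr; exact le_max_left _ _
    · calc ‖fderiv ℝ a (φ z) w‖ ≤ B * (C * g.norm z v) := h10.trans (by gcongr)
        _ = (B * C) * g.norm z v := by ring
        _ ≤ _ := mul_le_mul_of_nonneg_right (le_max_right _ _) (hg _ _)

omit hinj in
theorem continuous_norm_embDeriv_self : Continuous fun z => ‖embDeriv e X 0 z (X z)‖ := by
  have h1 : Continuous fun z => tangentMap (𝓡∂ n) 𝓘(ℝ, F) e ⟨z, X z⟩ :=
    (he.continuous_tangentMap le_rfl).comp hX.continuous
  have h2 := (tangentBundleModelSpaceHomeomorph 𝓘(ℝ, F)).continuous.comp h1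
  have h3 := (continuous_snd.comp h2).norm
  refine h3.congr fun z => ?_
  rw [embDeriv_zero hX hin]
  rfl

end HypAttr

/-! ### Cone criteria over a hyperbolic set. -/

namespace HypAttr

variable {n : ℕ} [NeZero n] {M : Type*} [TopologicalSpace M]
  [ChartedSpace (EuclideanHalfSpace n) M] [IsManifold (𝓡∂ n) ∞ M]
  {F : Type*} [NormedAddCommGroup F] [NormedSpace ℝ F]

/-- A compact invariant set with an invariant splitting into a contracting and an expanding
direction and the flow direction, the rates being measured through a map `e : M → F`. -/
structure HypRates (e : M → F) (X : ∀ x : M, TangentSpace (𝓡∂ n) x) (Λ : Set M)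
    (Es Eu : ∀ x : M, Submodule ℝ (TangentSpace (𝓡∂ n) x)) (B lam : ℝ) : Prop where
  isCompact : IsCompact Λ
  subset_interior : Λ ⊆ (𝓡∂ n).interior M
  image_eq : InvariantSet X Λ
  one_le : 1 ≤ B
  lam_pos : 0 < lam
  splitting : HyperbolicSplitting X Λ Es Eu
  stable : ∀ z ∈ Λ, ∀ t : ℝ, 0 ≤ t → ∀ v ∈ Es z,
    ‖embDeriv e X t z v‖ ≤ B * Real.exp (-lam * t) * ‖embDeriv e X 0 z v‖
  unstable : ∀ z ∈ Λ, ∀ t : ℝ, 0 ≤ t → ∀ v ∈ Eu z,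
    ‖embDeriv e X 0 z v‖ ≤ B * Real.exp (-lam * t) * ‖embDeriv e X t z v‖

variable {X : ∀ x : M, TangentSpace (𝓡∂ n) x} {e : M → F} {Λ : Set M}
  {Es Eu : ∀ x : M, Submodule ℝ (TangentSpace (𝓡∂ n) x)} {B lam : ℝ}

omit [IsManifold (𝓡∂ n) ∞ M] in
theorem InvariantSet.flow_mem (h : InvariantSet X Λ) {z : M} (hz : z ∈ Λ) {t : ℝ} (ht : 0 ≤ t) :
    flow X t z ∈ Λ := by
  rw [← h t ht]; exact mem_image_of_mem _ hz

theorem HyperbolicSplitting.exists_eq_add (h : HyperbolicSplitting X Λ Es Eu) {z : M} (hz : z ∈ Λ)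
    (v : TangentSpace (𝓡∂ n) z) :
    ∃ s ∈ Es z, ∃ c : ℝ, ∃ u ∈ Eu z, v = s + c • X z + u := by
  have hv : v ∈ (Es z ⊔ Submodule.span ℝ {X z}) ⊔ Eu z := by
    rw [(h.isCompl z hz).sup_eq_top]; exact Submodule.mem_top
  obtain ⟨w, hw, u, hu, rfl⟩ := Submodule.mem_sup.1 hv
  obtain ⟨s, hs, x, hx, rfl⟩ := Submodule.mem_sup.1 hw
  obtain ⟨c, rfl⟩ := Submodule.mem_span_singleton.1 hx
  exact ⟨s, hs, c, u, hu, rfl⟩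

theorem HyperbolicSplitting.dflow_stable (h : HyperbolicSplitting X Λ Es Eu) {z : M} (hz : z ∈ Λ)
    {t : ℝ} (ht : 0 ≤ t) {v : TangentSpace (𝓡∂ n) z} (hv : v ∈ Es z) :
    dflow X t z v ∈ Es (flow X t z) := by
  rw [← h.map_stable z hz t ht]; exact Submodule.mem_map_of_mem hv

theorem HyperbolicSplitting.dflow_unstable (h : HyperbolicSplitting X Λ Es Eu) {z : M}
    (hz : z ∈ Λ) {t : ℝ} (ht : 0 ≤ t) {v : TangentSpace (𝓡∂ n) z} (hv : v ∈ Eu z) :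
    dflow X t z v ∈ Eu (flow X t z) := by
  rw [← h.map_unstable z hz t ht]; exact Submodule.mem_map_of_mem hv

theorem exists_mul_exp_neg_le {lam : ℝ} (hlam : 0 < lam) (B : ℝ) {ε : ℝ} (hε : 0 < ε) :
    ∃ T : ℝ, 0 < T ∧ B * Real.exp (-lam * T) ≤ ε := by
  have h1 : Tendsto (fun T : ℝ => B * Real.exp (-lam * T)) atTop (𝓝 (B * 0)) := by
    refine Tendsto.const_mul _ (Real.tendsto_exp_atBot.comp ?_)
    exact tendsto_id.const_mul_atTop_of_neg (neg_neg_of_pos hlam)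
  rw [mul_zero] at h1
  obtain ⟨T, hT, hT0⟩ := ((h1.eventually (Iic_mem_nhds hε)).and (eventually_gt_atTop 0)).exists
  exact ⟨T, hT0, hT⟩

/-- Subscripts are the times 0, T, 2T; v is the norm of the vector, u that of its expanding part and
c that of the rest. With A = 4B, expansion by A/2 leaves at most half of v₁ to the nonexpanding
part, so u₁ ≥ v₁/2, and u₂ - c₂ ≥ (16B + 1)v₁/2 - v₁/2 = 2A v₁. -/
theorem cone_step {B v₀ v₁ v₂ c₁ c₂ u₁ u₂ : ℝ} (hB : 1 ≤ B) (hc₁ : c₁ ≤ B * v₀)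
    (hc₂ : c₂ ≤ B * v₀) (h₁ : v₁ ≤ c₁ + u₁) (h₂ : u₂ ≤ c₂ + v₂) (hu : (16 * B + 1) * u₁ ≤ u₂)
    (hv : 4 * B / 2 * v₀ ≤ v₁) : 2 * (4 * B) * v₁ ≤ v₂ := by
  have h3 : v₁ / 2 ≤ u₁ := by linarith
  have h4 : (16 * B + 1) * (v₁ / 2) ≤ (16 * B + 1) * u₁ := by gcongr
  linarith

variable [CompactSpace M] [T2Space M]
  (hX : ContMDiff (𝓡∂ n) (𝓡∂ n).tangent 1 (fun x => (⟨x, X x⟩ : TangentBundle (𝓡∂ n) M)))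
  (hin : InwardlyTransverse X) (he : ContMDiff (𝓡∂ n) 𝓘(ℝ, F) 1 e)
  (hinj : ∀ x, Function.Injective (mfderiv (𝓡∂ n) 𝓘(ℝ, F) e x))

include hX hin he

section

include hinj

/-- Changing the norm costs a factor `C` at each end, whence `C * K * C`. -/
theorem HyperbolicSplitting.exists_hypRates (h : HyperbolicSplitting X Λ Es Eu) (hΛ : IsCompact Λ)
    (hinv : InvariantSet X Λ) : ∃ B lam, HypRates e X Λ Es Eu B lam := by
  obtain ⟨g, K, lam, hK, hlam, hs, hu⟩ := h.rates
  have hint := hinv.subset_interior hX hin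
  obtain ⟨C, hC, hCg⟩ := exists_norm_le_embDeriv hX hin he hinj g hΛ hint
  refine ⟨max 1 (C * K * C), lam, hΛ, hint, hinv, le_max_left _ _, hlam, h, ?_, ?_⟩
  · intro z hz t ht v hv
    rw [embDeriv_eq hX hin he (hint hz) ht]
    calc _ ≤ C * g.norm (flow X t z) (dflow X t z v) := (hCg _ (hinv.flow_mem hz ht) _).2
      _ ≤ C * (K * Real.exp (-lam * t) * g.norm z v) := by gcongr; exact hs z hz t ht v hv
      _ ≤ C * (K * Real.exp (-lam * t) * (C * ‖embDeriv e X 0 z v‖)) := by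
        gcongr; exact (hCg z hz v).1
      _ = C * K * C * Real.exp (-lam * t) * ‖embDeriv e X 0 z v‖ := by ring
      _ ≤ _ := by gcongr; exact le_max_right _ _
  · intro z hz t ht v hv
    rw [embDeriv_eq hX hin he (hint hz) ht]
    have h1 := hu z hz t ht v hv
    have h2 : g.norm z v = K * Real.exp (-lam * t) * (K⁻¹ * Real.exp (lam * t) * g.norm z v) := by
      have : Real.exp (-lam * t) * Real.exp (lam * t) = 1 := by
        rw [← Real.exp_add]; simp
      calc g.norm z v = (K * K⁻¹) * (Real.exp (-lam * t) * Real.exp (lam * t)) * g.norm z v := by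
            rw [this, mul_inv_cancel₀ hK.ne']; ring
        _ = _ := by ring
    calc _ ≤ C * g.norm z v := (hCg z hz v).2
      _ ≤ C * (K * Real.exp (-lam * t) * g.norm (flow X t z) (dflow X t z v)) := by
        rw [h2]; gcongr
      _ ≤ C * (K * Real.exp (-lam * t) *
          (C * ‖embDeriv e X 0 (flow X t z) (dflow X t z v)‖)) := by
        gcongr; exact (hCg _ (hinv.flow_mem hz ht) _).1
      _ = C * K * C * Real.exp (-lam * t) * ‖embDeriv e X 0 (flow X t z) (dflow X t z v)‖ := by
        ring
      _ ≤ _ := by gcongr; exact le_max_right _ _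

end

namespace HypRates

variable (h : HypRates e X Λ Es Eu B lam)

include h

theorem stable_add {z : M} (hz : z ∈ Λ) {s t : ℝ} (hs : 0 ≤ s) (ht : 0 ≤ t)
    {v : TangentSpace (𝓡∂ n) z} (hv : v ∈ Es z) :
    ‖embDeriv e X (s + t) z v‖ ≤ B * Real.exp (-lam * t) * ‖embDeriv e X s z v‖ := by
  rw [embDeriv_add hX hin he (h.subset_interior hz) hs ht,
    embDeriv_eq hX hin he (h.subset_interior hz) hs]
  exact h.stable _ (h.image_eq.flow_mem hz hs) t ht _ (h.splitting.dflow_stable hz hs hv)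

theorem unstable_add {z : M} (hz : z ∈ Λ) {s t : ℝ} (hs : 0 ≤ s) (ht : 0 ≤ t)
    {v : TangentSpace (𝓡∂ n) z} (hv : v ∈ Eu z) :
    ‖embDeriv e X s z v‖ ≤ B * Real.exp (-lam * t) * ‖embDeriv e X (s + t) z v‖ := by
  rw [embDeriv_add hX hin he (h.subset_interior hz) hs ht,
    embDeriv_eq hX hin he (h.subset_interior hz) hs]
  exact h.unstable _ (h.image_eq.flow_mem hz hs) t ht _ (h.splitting.dflow_unstable hz hs hv)

omit hX hin he [CompactSpace M] [T2Space M] in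
theorem mul_exp_le {t : ℝ} (ht : 0 ≤ t) : B * Real.exp (-lam * t) ≤ B := by
  have h1 : Real.exp (-lam * t) ≤ 1 := Real.exp_le_one_iff.2 (by nlinarith [h.lam_pos])
  nlinarith [h.one_le]

/-- The alternative on X is used here: |X| is either zero on Λ or has a positive minimum there, and
so its values on Λ are mutually comparable. -/
theorem exists_growth (hinj : ∀ x, Function.Injective (mfderiv (𝓡∂ n) 𝓘(ℝ, F) e x))
    (h0 : (∀ z ∈ Λ, X z = 0) ∨ ∀ z ∈ Λ, X z ≠ 0) :
    ∃ b : ℝ, 1 ≤ b ∧ ∀ z ∈ Λ, ∀ w ∈ Λ, ‖embDeriv e X 0 z (X z)‖ ≤ b * ‖embDeriv e X 0 w (X w)‖ := by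
  rcases h0 with h0 | h0
  · exact ⟨1, le_rfl, fun z hz w hw => by simp [h0 z hz, h0 w hw]⟩
  rcases Λ.eq_empty_or_nonempty with rfl | hne
  · exact ⟨1, le_rfl, by simp⟩
  have hc := (continuous_norm_embDeriv_self hX hin he).continuousOn (s := Λ)
  obtain ⟨z₀, hz₀, hmin⟩ := h.isCompact.exists_isMinOn hne hc
  obtain ⟨z₁, hz₁, hmax⟩ := h.isCompact.exists_isMaxOn hne hc
  have hpos : 0 < ‖embDeriv e X 0 z₀ (X z₀)‖ := by
    refine norm_pos_iff.2 fun hh => h0 z₀ hz₀ ?_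
    refine injective_embDeriv hX hin he hinj (h.subset_interior hz₀) le_rfl ?_
    rw [hh, map_zero]
  set a := ‖embDeriv e X 0 z₀ (X z₀)‖
  set b := ‖embDeriv e X 0 z₁ (X z₁)‖
  have hab : a ≤ b := hmin hz₁
  refine ⟨b / a, (one_le_div hpos).2 hab, fun z hz w hw => ?_⟩
  have h1 : ‖embDeriv e X 0 z (X z)‖ ≤ b := hmax hz
  have h2 : a ≤ ‖embDeriv e X 0 w (X w)‖ := hmin hw
  calc _ ≤ b := h1
    _ = b / a * a := by field_simp
    _ ≤ _ := by gcongr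

/-- The components are bounded by different growth rates rather than by continuity of the splitting.
By time τ the stable part shrinks by 1/(2b) while the flow part keeps at least the fraction 1/b of
its size, which separates these two; by time τ' their sum has grown by at most R while the unstable
part has grown by R + 1, which separates the latter. -/
theorem exists_projection_le (hinj : ∀ x, Function.Injective (mfderiv (𝓡∂ n) 𝓘(ℝ, F) e x))
    {b : ℝ} (hb : 1 ≤ b) (hgr : ∀ z ∈ Λ, ∀ w ∈ Λ,
      ‖embDeriv e X 0 z (X z)‖ ≤ b * ‖embDeriv e X 0 w (X w)‖) :
    ∃ P : ℝ, 1 ≤ P ∧ ∀ z ∈ Λ, ∀ s ∈ Es z, ∀ c : ℝ, ∀ u ∈ Eu z,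
      ‖embDeriv e X 0 z s‖ ≤ P * ‖embDeriv e X 0 z (s + c • X z + u)‖ ∧
      ‖embDeriv e X 0 z (c • X z)‖ ≤ P * ‖embDeriv e X 0 z (s + c • X z + u)‖ ∧
      ‖embDeriv e X 0 z u‖ ≤ P * ‖embDeriv e X 0 z (s + c • X z + u)‖ := by
  have hB0 : 0 < B := zero_lt_one.trans_le h.one_le
  have hb0 : 0 < b := zero_lt_one.trans_le hb
  obtain ⟨τ, hτ, hτs⟩ := exists_mul_exp_neg_le h.lam_pos B (ε := (2 * b)⁻¹) (by positivity)
  obtain ⟨C, hC, hCτ⟩ := exists_embDeriv_le hX hin he hinj h.isCompact h.subset_interior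
    le_rfl hτ.le
  set Q := 2 * b * C + 2
  have hQ : 0 < Q := by positivity
  have hXt : ∀ z ∈ Λ, ∀ t : ℝ, 0 ≤ t → ∀ c : ℝ,
      ‖embDeriv e X 0 z (c • X z)‖ ≤ b * ‖embDeriv e X t z (c • X z)‖ ∧
      ‖embDeriv e X t z (c • X z)‖ ≤ b * ‖embDeriv e X 0 z (c • X z)‖ := by
    intro z hz t ht c
    simp only [map_smul, norm_smul, embDeriv_self hX hin he (h.subset_interior hz) ht]
    constructor
    · nlinarith [hgr z hz _ (h.image_eq.flow_mem hz ht), norm_nonneg c]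
    · nlinarith [hgr _ (h.image_eq.flow_mem hz ht) z hz, norm_nonneg c]
  have key : ∀ z ∈ Λ, ∀ s ∈ Es z, ∀ c : ℝ,
      ‖embDeriv e X 0 z s‖ ≤ Q * ‖embDeriv e X 0 z (s + c • X z)‖ ∧
      ‖embDeriv e X 0 z (c • X z)‖ ≤ Q * ‖embDeriv e X 0 z (s + c • X z)‖ := by
    intro z hz s hs c
    have h1 := h.stable z hz τ hτ.le s hs
    have h2 := (hXt z hz τ hτ.le c).1
    have h3 := hCτ z hz (s + c • X z)
    have h4 : ‖embDeriv e X τ z (c • X z)‖ ≤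
        ‖embDeriv e X τ z (s + c • X z)‖ + ‖embDeriv e X τ z s‖ := by
      have := norm_sub_le (embDeriv e X τ z (s + c • X z)) (embDeriv e X τ z s)
      rwa [← map_sub, add_sub_cancel_left] at this
    have h5 : ‖embDeriv e X 0 z s‖ ≤
        ‖embDeriv e X 0 z (s + c • X z)‖ + ‖embDeriv e X 0 z (c • X z)‖ := by
      have := norm_sub_le (embDeriv e X 0 z (s + c • X z)) (embDeriv e X 0 z (c • X z))
      rwa [← map_sub, add_sub_cancel_right] at this
    have h6 : ‖embDeriv e X τ z s‖ ≤ (2 * b)⁻¹ * ‖embDeriv e X 0 z s‖ := h1.trans (by gcongr)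
    have h7 : ‖embDeriv e X 0 z (c • X z)‖ ≤
        b * (C * ‖embDeriv e X 0 z (s + c • X z)‖ + (2 * b)⁻¹ * ‖embDeriv e X 0 z s‖) :=
      h2.trans (by gcongr; linarith)
    have h8 : b * (C * ‖embDeriv e X 0 z (s + c • X z)‖ + (2 * b)⁻¹ * ‖embDeriv e X 0 z s‖) =
        b * C * ‖embDeriv e X 0 z (s + c • X z)‖ + ‖embDeriv e X 0 z s‖ / 2 := by
      field_simp
    rw [h8] at h7
    have h9 := norm_nonneg (embDeriv e X 0 z (s + c • X z))
    constructor <;> simp only [Q] <;> linarith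
  set R := (B + b) * Q
  have hR : 0 < R := by positivity
  have hfwd : ∀ z ∈ Λ, ∀ s ∈ Es z, ∀ c : ℝ, ∀ t : ℝ, 0 ≤ t →
      ‖embDeriv e X t z (s + c • X z)‖ ≤ R * ‖embDeriv e X 0 z (s + c • X z)‖ := by
    intro z hz s hs c t ht
    obtain ⟨k1, k2⟩ := key z hz s hs c
    have h1 := h.stable z hz t ht s hs
    calc ‖embDeriv e X t z (s + c • X z)‖
        ≤ ‖embDeriv e X t z s‖ + ‖embDeriv e X t z (c • X z)‖ := by
          rw [map_add]; exact norm_add_le _ _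
      _ ≤ B * ‖embDeriv e X 0 z s‖ + b * ‖embDeriv e X 0 z (c • X z)‖ :=
          add_le_add (h1.trans (by gcongr; exact h.mul_exp_le ht)) (hXt z hz t ht c).2
      _ ≤ B * (Q * ‖embDeriv e X 0 z (s + c • X z)‖) +
          b * (Q * ‖embDeriv e X 0 z (s + c • X z)‖) := by gcongr
      _ = R * ‖embDeriv e X 0 z (s + c • X z)‖ := by simp only [R]; ring
  obtain ⟨τ', hτ', hτu⟩ := exists_mul_exp_neg_le h.lam_pos B (ε := (R + 1)⁻¹) (by positivity)
  obtain ⟨C', hC', hCτ'⟩ := exists_embDeriv_le hX hin he hinj h.isCompact h.subset_interior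
    le_rfl hτ'.le
  set S := C' + R
  have hproj : ∀ z ∈ Λ, ∀ s ∈ Es z, ∀ c : ℝ, ∀ u ∈ Eu z,
      ‖embDeriv e X 0 z u‖ ≤ S * ‖embDeriv e X 0 z (s + c • X z + u)‖ := by
    intro z hz s hs c u hu
    have h1 : (R + 1) * ‖embDeriv e X 0 z u‖ ≤ ‖embDeriv e X τ' z u‖ := by
      have := (h.unstable z hz τ' hτ'.le u hu).trans
        (mul_le_mul_of_nonneg_right hτu (norm_nonneg _))
      rwa [inv_mul_eq_div, le_div_iff₀ (by positivity), mul_comm] at this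
    have h2 := hfwd z hz s hs c τ' hτ'.le
    have h3 := hCτ' z hz (s + c • X z + u)
    have h4 : ‖embDeriv e X τ' z u‖ ≤
        ‖embDeriv e X τ' z (s + c • X z + u)‖ + ‖embDeriv e X τ' z (s + c • X z)‖ := by
      have := norm_sub_le (embDeriv e X τ' z (s + c • X z + u)) (embDeriv e X τ' z (s + c • X z))
      rwa [← map_sub, add_sub_cancel_left] at this
    have h5 : ‖embDeriv e X 0 z (s + c • X z)‖ ≤
        ‖embDeriv e X 0 z (s + c • X z + u)‖ + ‖embDeriv e X 0 z u‖ := by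
      have := norm_sub_le (embDeriv e X 0 z (s + c • X z + u)) (embDeriv e X 0 z u)
      rwa [← map_sub, add_sub_cancel_right] at this
    have h6 := mul_le_mul_of_nonneg_left h5 hR.le
    simp only [S]
    linarith
  have hS : 0 < S := by positivity
  refine ⟨max (max 1 S) (Q * (1 + S)), (le_max_left _ _).trans (le_max_left _ _), ?_⟩
  intro z hz s hs c u hu
  have h1 := hproj z hz s hs c u hu
  obtain ⟨k1, k2⟩ := key z hz s hs c
  have h5 : ‖embDeriv e X 0 z (s + c • X z)‖ ≤
      ‖embDeriv e X 0 z (s + c • X z + u)‖ + ‖embDeriv e X 0 z u‖ := by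
    have := norm_sub_le (embDeriv e X 0 z (s + c • X z + u)) (embDeriv e X 0 z u)
    rwa [← map_sub, add_sub_cancel_right] at this
  have h6 : Q * ‖embDeriv e X 0 z (s + c • X z)‖ ≤
      max (max 1 S) (Q * (1 + S)) * ‖embDeriv e X 0 z (s + c • X z + u)‖ :=
    calc Q * ‖embDeriv e X 0 z (s + c • X z)‖
        ≤ Q * ((1 + S) * ‖embDeriv e X 0 z (s + c • X z + u)‖) := by gcongr; linarith
      _ = Q * (1 + S) * ‖embDeriv e X 0 z (s + c • X z + u)‖ := by ring
      _ ≤ _ := by gcongr; exact le_max_right _ _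
  exact ⟨k1.trans h6, k2.trans h6, h1.trans (by
    gcongr; exact (le_max_right _ _).trans (le_max_left _ _))⟩

/-- Cone criteria for the time-`T` map, forward and backward. -/
theorem exists_cone_criteria (hinj : ∀ x, Function.Injective (mfderiv (𝓡∂ n) 𝓘(ℝ, F) e x))
    (h0 : (∀ z ∈ Λ, X z = 0) ∨ ∀ z ∈ Λ, X z ≠ 0) :
    ∃ T A : ℝ, 0 < T ∧ 1 < A ∧ ∀ z ∈ Λ,
      (∀ v, A / 2 * ‖embDeriv e X 0 z v‖ ≤ ‖embDeriv e X T z v‖ →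
        2 * A * ‖embDeriv e X T z v‖ ≤ ‖embDeriv e X (T + T) z v‖) ∧
      (∀ v, A / 2 * ‖embDeriv e X (T + T) z v‖ ≤ ‖embDeriv e X T z v‖ →
        2 * A * ‖embDeriv e X T z v‖ ≤ ‖embDeriv e X 0 z v‖) ∧
      (∀ u ∈ Eu z, 2 * A * ‖embDeriv e X 0 z u‖ ≤ ‖embDeriv e X T z u‖) ∧
      (∀ s ∈ Es z, 2 * A * ‖embDeriv e X (T + T) z s‖ ≤ ‖embDeriv e X T z s‖) := by
  obtain ⟨b, hb, hgr⟩ := h.exists_growth hX hin he hinj h0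
  obtain ⟨P, hP, hproj⟩ := h.exists_projection_le hX hin he hinj hb hgr
  have hB0 : 0 < B := zero_lt_one.trans_le h.one_le
  have hb0 : 0 < b := zero_lt_one.trans_le hb
  have hP0 : 0 < P := zero_lt_one.trans_le hP
  set D := (B + b) * P
  have hD : 1 ≤ D := by
    have : 1 * 1 ≤ (B + b) * P := by
      gcongr
      linarith [h.one_le]
    simpa using this
  -- `D` bounds the part outside the expanding direction, so `cone_step` applies with D in place of
  -- its B, A = 4D, and rate m = 16D + 1 over time T.
  set m := 16 * D + 1
  have hm : 0 < m := by positivity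
  obtain ⟨T, hT, hTm⟩ := exists_mul_exp_neg_le h.lam_pos B (ε := m⁻¹) (by positivity)
  have hTT : 0 ≤ T + T := by positivity
  have hX' : ∀ z ∈ Λ, ∀ s : ℝ, 0 ≤ s → ∀ t : ℝ, 0 ≤ t → ∀ c : ℝ,
      ‖embDeriv e X s z (c • X z)‖ ≤ b * ‖embDeriv e X t z (c • X z)‖ := by
    intro z hz s hs t ht c
    simp only [map_smul, norm_smul, embDeriv_self hX hin he (h.subset_interior hz) ht,
      embDeriv_self hX hin he (h.subset_interior hz) hs]
    nlinarith [hgr _ (h.image_eq.flow_mem hz hs) _ (h.image_eq.flow_mem hz ht), norm_nonneg c]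
  have hproj' : ∀ z ∈ Λ, ∀ t : ℝ, 0 ≤ t → ∀ s ∈ Es z, ∀ c : ℝ, ∀ u ∈ Eu z,
      ‖embDeriv e X t z s‖ ≤ P * ‖embDeriv e X t z (s + c • X z + u)‖ ∧
      ‖embDeriv e X t z (c • X z)‖ ≤ P * ‖embDeriv e X t z (s + c • X z + u)‖ ∧
      ‖embDeriv e X t z u‖ ≤ P * ‖embDeriv e X t z (s + c • X z + u)‖ := by
    intro z hz t ht s hs c u hu
    have hzi := h.subset_interior hz
    simp only [embDeriv_eq hX hin he hzi ht, map_add, map_smul, dflow_apply_self hX hin hzi ht]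
    simpa only [map_add, map_smul] using hproj _ (h.image_eq.flow_mem hz ht) _
      (h.splitting.dflow_stable hz ht hs) c _ (h.splitting.dflow_unstable hz ht hu)
  have hexp : ∀ {x y : ℝ}, 0 ≤ y → x ≤ B * Real.exp (-lam * T) * y → m * x ≤ y := by
    intro x y hy hxy
    have := hxy.trans (mul_le_mul_of_nonneg_right hTm hy)
    rwa [inv_mul_eq_div, le_div_iff₀ hm, mul_comm] at this
  have hm8 : ∀ {x y : ℝ}, 0 ≤ x → m * x ≤ y → 2 * (4 * D) * x ≤ y := by
    intro x y hx hxy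
    refine le_trans ?_ hxy
    gcongr
    simp only [m]; linarith
  have hu0 : ∀ z ∈ Λ, ∀ u ∈ Eu z, m * ‖embDeriv e X 0 z u‖ ≤ ‖embDeriv e X T z u‖ :=
    fun z hz u hu => hexp (norm_nonneg _) (h.unstable z hz T hT.le u hu)
  have hu1 : ∀ z ∈ Λ, ∀ u ∈ Eu z, m * ‖embDeriv e X T z u‖ ≤ ‖embDeriv e X (T + T) z u‖ :=
    fun z hz u hu => hexp (norm_nonneg _) (h.unstable_add hX hin he hz hT.le hT.le hu)
  have hs0 : ∀ z ∈ Λ, ∀ s ∈ Es z, m * ‖embDeriv e X T z s‖ ≤ ‖embDeriv e X 0 z s‖ :=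
    fun z hz s hs => hexp (norm_nonneg _) (h.stable z hz T hT.le s hs)
  have hs1 : ∀ z ∈ Λ, ∀ s ∈ Es z, m * ‖embDeriv e X (T + T) z s‖ ≤ ‖embDeriv e X T z s‖ :=
    fun z hz s hs => hexp (norm_nonneg _) (h.stable_add hX hin he hz hT.le hT.le hs)
  refine ⟨T, 4 * D, hT, by linarith, fun z hz => ⟨fun v hv => ?_, fun v hv => ?_,
    fun u hu => hm8 (norm_nonneg _) (hu0 z hz u hu),
    fun s hs => hm8 (norm_nonneg _) (hs1 z hz s hs)⟩⟩
  · obtain ⟨s, hs, c, u, hu, hvs⟩ := h.splitting.exists_eq_add hz v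
    have hc : ∀ t : ℝ, 0 ≤ t → ‖embDeriv e X t z (s + c • X z)‖ ≤ D * ‖embDeriv e X 0 z v‖ := by
      intro t ht
      obtain ⟨k1, k2, -⟩ := hproj z hz s hs c u hu
      rw [← hvs] at k1 k2
      calc ‖embDeriv e X t z (s + c • X z)‖
          ≤ ‖embDeriv e X t z s‖ + ‖embDeriv e X t z (c • X z)‖ := by
            rw [map_add]; exact norm_add_le _ _
        _ ≤ B * ‖embDeriv e X 0 z s‖ + b * ‖embDeriv e X 0 z (c • X z)‖ :=
            add_le_add ((h.stable z hz t ht s hs).trans (by gcongr; exact h.mul_exp_le ht))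
              (hX' z hz t ht 0 le_rfl c)
        _ ≤ B * (P * ‖embDeriv e X 0 z v‖) + b * (P * ‖embDeriv e X 0 z v‖) := by gcongr
        _ = D * ‖embDeriv e X 0 z v‖ := by simp only [D]; ring
    refine cone_step hD (hc T hT.le) (hc _ hTT) ?_ ?_ (hu1 z hz u hu) hv
    · rw [hvs, map_add _ _ u]; exact norm_add_le _ _
    · have := norm_sub_le (embDeriv e X (T + T) z v) (embDeriv e X (T + T) z (s + c • X z))
      rw [← map_sub, hvs, add_sub_cancel_left] at this
      rw [hvs]; linarith
  -- The same argument with time reversed from 2T to 0: the stable part is now the expanding one,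
  -- and the components are controlled by the vector at time 2T.
  · obtain ⟨s, hs, c, u, hu, hvs⟩ := h.splitting.exists_eq_add hz v
    have hc : ∀ t : ℝ, 0 ≤ t → ∀ r : ℝ, 0 ≤ r → t + r = T + T →
        ‖embDeriv e X t z (c • X z + u)‖ ≤ D * ‖embDeriv e X (T + T) z v‖ := by
      intro t ht r hr htr
      obtain ⟨-, k2, k3⟩ := hproj' z hz _ hTT s hs c u hu
      rw [← hvs] at k2 k3
      have h1 := h.unstable_add hX hin he hz ht hr hu
      rw [htr] at h1
      calc ‖embDeriv e X t z (c • X z + u)‖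
          ≤ ‖embDeriv e X t z (c • X z)‖ + ‖embDeriv e X t z u‖ := by
            rw [map_add]; exact norm_add_le _ _
        _ ≤ b * ‖embDeriv e X (T + T) z (c • X z)‖ + B * ‖embDeriv e X (T + T) z u‖ :=
            add_le_add (hX' z hz t ht _ hTT c)
              (h1.trans (by gcongr; exact h.mul_exp_le hr))
        _ ≤ b * (P * ‖embDeriv e X (T + T) z v‖) + B * (P * ‖embDeriv e X (T + T) z v‖) := by
            gcongr
        _ = D * ‖embDeriv e X (T + T) z v‖ := by simp only [D]; ring
    have hvs' : v = (c • X z + u) + s := by rw [hvs]; abel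
    refine cone_step hD (hc T hT.le T hT.le rfl) (hc 0 le_rfl _ hTT (zero_add _)) ?_ ?_
      (hs0 z hz s hs) hv
    · rw [hvs', map_add _ _ s]; exact norm_add_le _ _
    · have := norm_sub_le (embDeriv e X 0 z v) (embDeriv e X 0 z (c • X z + u))
      rw [← map_sub, hvs', add_sub_cancel_left] at this
      rw [hvs']; linarith

end HypRates

end HypAttr

/-! ### Expansion of pairs of nearby points, and separation of orbits. -/

namespace HypAttr

section Pairs

variable {E F : Type*} [NormedAddCommGroup E] [NormedSpace ℝ E] [NormedAddCommGroup F]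
  [NormedSpace ℝ F] {a₀ a₁ a₂ : E → F} {L₀ L₁ L₂ : E →L[ℝ] F} {u₀ : E} {A c : ℝ}

theorem HasStrictFDerivAt.eventually_norm_le {a : E → F} {L : E →L[ℝ] F}
    (h : HasStrictFDerivAt a L u₀) {ε : ℝ} (hε : 0 < ε) : ∀ᶠ q : E × E in 𝓝 (u₀, u₀),
      ‖a q.1 - a q.2‖ ≤ ‖L (q.1 - q.2)‖ + ε * ‖q.1 - q.2‖ ∧
      ‖L (q.1 - q.2)‖ ≤ ‖a q.1 - a q.2‖ + ε * ‖q.1 - q.2‖ := by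
  filter_upwards [h.isLittleO.def hε] with q hq
  have h1 := norm_sub_norm_le (a q.1 - a q.2) (L (q.1 - q.2))
  have h2 := norm_sub_norm_le (L (q.1 - q.2)) (a q.1 - a q.2)
  rw [norm_sub_rev (L (q.1 - q.2))] at h2
  constructor <;> linarith

/-- Differences of values equal differentials up to a small multiple of |q.1 - q.2|, which is itself
dominated by the differentials. The gap between A/2, 2A and A absorbs the error. -/
theorem eventually_cone_of_hasStrictFDerivAt (h₀ : HasStrictFDerivAt a₀ L₀ u₀)
    (h₁ : HasStrictFDerivAt a₁ L₁ u₀) (h₂ : HasStrictFDerivAt a₂ L₂ u₀) (hA : 1 < A) (hc : 0 < c)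
    (hc₀ : ∀ v, c * ‖v‖ ≤ ‖L₀ v‖) (hc₁ : ∀ v, c * ‖v‖ ≤ ‖L₁ v‖)
    (hcone : ∀ v, A / 2 * ‖L₀ v‖ ≤ ‖L₁ v‖ → 2 * A * ‖L₁ v‖ ≤ ‖L₂ v‖) :
    ∀ᶠ q : E × E in 𝓝 (u₀, u₀), A * ‖a₀ q.1 - a₀ q.2‖ ≤ ‖a₁ q.1 - a₁ q.2‖ →
      A * ‖a₁ q.1 - a₁ q.2‖ ≤ ‖a₂ q.1 - a₂ q.2‖ := by
  have hε : 0 < c / 4 := by positivity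
  filter_upwards [HasStrictFDerivAt.eventually_norm_le h₀ hε,
    HasStrictFDerivAt.eventually_norm_le h₁ hε, HasStrictFDerivAt.eventually_norm_le h₂ hε]
    with q q₀ q₁ q₂ hq
  set w := q.1 - q.2
  have k0 := hc₀ w
  have k1 := hc₁ w
  have kw := norm_nonneg w
  have e1 : 0 ≤ (A - 1) * (c * ‖w‖) :=
    mul_nonneg (by linarith) (by positivity)
  have e2 := mul_le_mul_of_nonneg_left k0 (zero_le_one.trans hA.le)
  have e3 := mul_le_mul_of_nonneg_left k1 (zero_le_one.trans hA.le)
  have e4 := mul_le_mul_of_nonneg_left q₀.2 (zero_le_one.trans hA.le)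
  have e5 := mul_le_mul_of_nonneg_left q₁.1 (zero_le_one.trans hA.le)
  have k2 := hcone w (by linarith [q₁.1])
  linarith [q₂.2]

theorem eventually_expand_of_hasStrictFDerivAt (h₀ : HasStrictFDerivAt a₀ L₀ u₀)
    (h₁ : HasStrictFDerivAt a₁ L₁ u₀) (hA : 1 < A) (hc : 0 < c)
    (hc₀ : ∀ v, c * ‖v‖ ≤ ‖L₀ v‖) {v : E} (hv : 2 * A * ‖L₀ v‖ ≤ ‖L₁ v‖) :
    ∀ᶠ q : E × E in 𝓝 (u₀, u₀), ∀ s : ℝ, q.1 - q.2 = s • v →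
      A * ‖a₀ q.1 - a₀ q.2‖ ≤ ‖a₁ q.1 - a₁ q.2‖ := by
  have hε : 0 < c / 4 := by positivity
  filter_upwards [HasStrictFDerivAt.eventually_norm_le h₀ hε,
    HasStrictFDerivAt.eventually_norm_le h₁ hε] with q q₀ q₁ s hs
  have hv' : 2 * A * ‖L₀ (q.1 - q.2)‖ ≤ ‖L₁ (q.1 - q.2)‖ := by
    rw [hs, map_smul, map_smul, norm_smul, norm_smul]
    have := mul_le_mul_of_nonneg_left hv (norm_nonneg s)
    linarith
  set w := q.1 - q.2
  have k0 := hc₀ w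
  have kw := norm_nonneg w
  have e1 : 0 ≤ (A - 1) * (c * ‖w‖) :=
    mul_nonneg (by linarith) (by positivity)
  have e2 := mul_le_mul_of_nonneg_left k0 (zero_le_one.trans hA.le)
  have e4 := mul_le_mul_of_nonneg_left q₀.1 (zero_le_one.trans hA.le)
  have e5 : 0 ≤ A * (c * ‖w‖) := mul_nonneg (by linarith) (by positivity)
  linarith [q₁.2]

theorem exists_lower_bound_of_injective [FiniteDimensional ℝ E] {L : E →L[ℝ] F}
    (hL : Function.Injective L) : ∃ c : ℝ, 0 < c ∧ ∀ v, c * ‖v‖ ≤ ‖L v‖ := by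
  obtain ⟨c, hc, hcL⟩ := L.toLinearMap.exists_antilipschitzWith (LinearMap.ker_eq_bot.2 hL)
  have hc0 : (0 : ℝ) < c := hc
  refine ⟨(c : ℝ)⁻¹, by positivity, fun v => ?_⟩
  have := hcL.le_mul_dist v 0
  rw [dist_zero_right, map_zero, dist_zero_right] at this
  rw [inv_mul_eq_div, div_le_iff₀ hc0, mul_comm]
  exact this

end Pairs

variable {n : ℕ} [NeZero n] {M : Type*}
  {F : Type*} [NormedAddCommGroup F] [NormedSpace ℝ F]

section

variable [TopologicalSpace M] [ChartedSpace (EuclideanHalfSpace n) M] [IsManifold (𝓡∂ n) ∞ M]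
  {X : ∀ x : M, TangentSpace (𝓡∂ n) x} {e : M → F} [CompactSpace M] [T2Space M]
  (hX : ContMDiff (𝓡∂ n) (𝓡∂ n).tangent 1 (fun x => (⟨x, X x⟩ : TangentBundle (𝓡∂ n) M)))
  (hin : InwardlyTransverse X) (he : ContMDiff (𝓡∂ n) 𝓘(ℝ, F) 1 e)
  (hinj : ∀ x, Function.Injective (mfderiv (𝓡∂ n) 𝓘(ℝ, F) e x))

include hX hin he hinj

/-- The first property keeps an expanding pair expanding. The second starts the process: from any q
near p, move along the coordinate direction of `u`. -/
theorem exists_nhds_expansion {p : M} (hp : p ∈ (𝓡∂ n).interior M) {T A : ℝ} (hT : 0 ≤ T)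
    (hA : 1 < A) (hcone : ∀ v, A / 2 * ‖embDeriv e X 0 p v‖ ≤ ‖embDeriv e X T p v‖ →
        2 * A * ‖embDeriv e X T p v‖ ≤ ‖embDeriv e X (T + T) p v‖)
    {u : TangentSpace (𝓡∂ n) p} (hu0 : u ≠ 0)
    (hu : 2 * A * ‖embDeriv e X 0 p u‖ ≤ ‖embDeriv e X T p u‖) :
    ∃ W ∈ 𝓝 p, (∀ z ∈ W, ∀ z' ∈ W,
        A * dist (e z) (e z') ≤ dist (e (flow X T z)) (e (flow X T z')) →
        A * dist (e (flow X T z)) (e (flow X T z')) ≤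
          dist (e (flow X (T + T) z)) (e (flow X (T + T) z'))) ∧
      ∀ q ∈ W, ∀ V ∈ 𝓝 q, ∃ z ∈ V, z ≠ q ∧
        A * dist (e z) (e q) ≤ dist (e (flow X T z)) (e (flow X T q)) := by
  set φ := extChartAt (𝓡∂ n) p
  have hTT : 0 ≤ T + T := by positivity
  have hs : ∀ t : ℝ, 0 ≤ t → HasStrictFDerivAt ((e ∘ flow X t) ∘ φ.symm)
      (show EuclideanSpace ℝ (Fin n) →L[ℝ] F from embDeriv e X t p) (φ p) := fun t ht =>
    hasStrictFDerivAt_comp_extChartAt_symm hp (contMDiffAt_embed_comp_flow hX hin he hp ht)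
  obtain ⟨c, hc, hcL⟩ := exists_lower_bound_of_injective
    (L := (show EuclideanSpace ℝ (Fin n) →L[ℝ] F from embDeriv e X 0 p))
    (injective_embDeriv hX hin he hinj hp le_rfl)
  obtain ⟨c', hc', hcL'⟩ := exists_lower_bound_of_injective
    (L := (show EuclideanSpace ℝ (Fin n) →L[ℝ] F from embDeriv e X T p))
    (injective_embDeriv hX hin he hinj hp hT)
  have hm : 0 < min c c' := lt_min hc hc'
  have h1 := eventually_cone_of_hasStrictFDerivAt (hs 0 le_rfl) (hs T hT) (hs _ hTT) hA hm
    (fun v => (mul_le_mul_of_nonneg_right (min_le_left _ _) (norm_nonneg _)).trans (hcL v))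
    (fun v => (mul_le_mul_of_nonneg_right (min_le_right _ _) (norm_nonneg _)).trans (hcL' v)) hcone
  have h2 := eventually_expand_of_hasStrictFDerivAt (hs 0 le_rfl) (hs T hT) hA hc hcL (v := u) hu
  rw [nhds_prod_eq] at h1 h2
  obtain ⟨V₁, hV₁, hV₁'⟩ := mem_prod_self_iff.1 (h1.and h2)
  obtain ⟨r, hr, hrV⟩ := Metric.mem_nhds_iff.1
    (inter_mem hV₁ (extChartAt_target_mem_nhds_of_interior hp))
  have h0 : ∀ z, flow X 0 z = z := flow_zero hX hin
  refine ⟨φ.source ∩ φ ⁻¹' Metric.ball (φ p) r, inter_mem (extChartAt_source_mem_nhds p)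
    ((continuousAt_extChartAt p).preimage_mem_nhds (Metric.ball_mem_nhds _ hr)), ?_, ?_⟩
  · rintro z ⟨hz, hzr⟩ z' ⟨hz', hzr'⟩
    have := (hV₁' (mk_mem_prod (hrV hzr).1 (hrV hzr').1)).1
    simpa only [Function.comp_apply, φ.left_inv hz, φ.left_inv hz', ← dist_eq_norm, h0] using this
  · rintro q ⟨hq, hqr⟩ V hV
    let u' : EuclideanSpace ℝ (Fin n) := u
    have hu' : u' ≠ 0 := hu0
    have hline : ContinuousAt (fun s : ℝ => φ q + s • u') 0 := by fun_prop
    have hline0 : φ q + (0 : ℝ) • u' = φ q := by simp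
    have k1 : ∀ᶠ s : ℝ in 𝓝 0, φ q + s • u' ∈ Metric.ball (φ p) r :=
      hline.eventually_mem (by rw [hline0]; exact Metric.isOpen_ball.mem_nhds hqr)
    have k2 : ∀ᶠ s : ℝ in 𝓝 0, φ.symm (φ q + s • u') ∈ V := by
      have : ContinuousAt φ.symm (φ q + (0 : ℝ) • u') := by
        rw [hline0]; exact continuousAt_extChartAt_symm' hq
      refine (ContinuousAt.comp (f := fun s : ℝ => φ q + s • u') this hline).eventually_mem ?_
      simp only [Function.comp_apply, hline0, φ.left_inv hq]
      exact hV
    obtain ⟨s, ⟨hs1, hs2⟩, hs0⟩ := (((k1.and k2).filter_mono nhdsWithin_le_nhds).and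
      (self_mem_nhdsWithin : {0}ᶜ ∈ 𝓝[≠] (0 : ℝ))).exists
    refine ⟨_, hs2, fun heq => ?_, ?_⟩
    · have h3 := congrArg φ heq
      rw [φ.right_inv (hrV hs1).2] at h3
      have h4 : s • u' = 0 := by simpa using h3
      exact (smul_ne_zero hs0 hu') h4
    · have := (hV₁' (mk_mem_prod (hrV hs1).1 (hrV hqr).1)).2 s (by simp [u'])
      simpa only [Function.comp_apply, φ.left_inv hq, ← dist_eq_norm, h0] using this

end

variable [MetricSpace M] [ChartedSpace (EuclideanHalfSpace n) M] [IsManifold (𝓡∂ n) ∞ M]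
  {X : ∀ x : M, TangentSpace (𝓡∂ n) x} {e : M → F} [CompactSpace M]
  (hX : ContMDiff (𝓡∂ n) (𝓡∂ n).tangent 1 (fun x => (⟨x, X x⟩ : TangentBundle (𝓡∂ n) M)))
  (hin : InwardlyTransverse X) (he : ContMDiff (𝓡∂ n) 𝓘(ℝ, F) 1 e)
  (hinj : ∀ x, Function.Injective (mfderiv (𝓡∂ n) 𝓘(ℝ, F) e x))

include hX hin in
theorem flow_natCast_succ_mul {T : ℝ} (hT : 0 ≤ T) (k : ℕ) (z : M) :
    flow X ((k + 1 : ℕ) * T) z = flow X T (flow X (k * T) z) := by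
  rw [← flow_add hX hin (mul_nonneg (Nat.cast_nonneg k) hT) hT]
  congr 1
  push_cast; ring

include hX hin he hinj in
/-- Points whose orbits accumulate only on `Λ` have arbitrarily close points whose orbits separate
from theirs. -/
theorem HypRates.exists_separation {Λ : Set M}
    {Es Eu : ∀ x : M, Submodule ℝ (TangentSpace (𝓡∂ n) x)} {B lam : ℝ}
    (h : HypRates e X Λ Es Eu B lam) (heinj : Function.Injective e)
    (h0 : (∀ z ∈ Λ, X z = 0) ∨ ∀ z ∈ Λ, X z ≠ 0) (hEu : ∀ z ∈ Λ, Eu z ≠ ⊥) :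
    ∃ δ : ℝ, 0 < δ ∧ ∀ y ∈ basin X Λ, ∀ V ∈ 𝓝 y, ∃ y' ∈ V, ∃ t : ℝ, 0 ≤ t ∧
      δ < dist (flow X t y) (flow X t y') := by
  obtain ⟨T, A, hT, hA, hcone⟩ := h.exists_cone_criteria hX hin he hinj h0
  have hW : ∀ p ∈ Λ, ∃ W ∈ 𝓝 p, (∀ z ∈ W, ∀ z' ∈ W,
        A * dist (e z) (e z') ≤ dist (e (flow X T z)) (e (flow X T z')) →
        A * dist (e (flow X T z)) (e (flow X T z')) ≤
          dist (e (flow X (T + T) z)) (e (flow X (T + T) z'))) ∧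
      ∀ q ∈ W, ∀ V ∈ 𝓝 q, ∃ z ∈ V, z ≠ q ∧
        A * dist (e z) (e q) ≤ dist (e (flow X T z)) (e (flow X T q)) := by
    intro p hp
    obtain ⟨u, hu, hu0⟩ := Submodule.exists_mem_ne_zero_of_ne_bot (hEu p hp)
    exact exists_nhds_expansion hX hin he hinj (h.subset_interior hp) hT.le hA (hcone p hp).1 hu0
      ((hcone p hp).2.2.1 u hu)
  choose! W hWn hWc hWe using hW
  obtain ⟨δ, hδ, hcov⟩ := lebesgue_number_lemma_of_metric h.isCompact
    (c := fun p : Λ => interior (W p)) (fun _ => isOpen_interior)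
    (fun p hp => mem_iUnion.2 ⟨⟨p, hp⟩, mem_interior_iff_mem_nhds.2 (hWn p hp)⟩)
  -- Two orbits within δ/4 of that of y are within δ/2 of each other, and the orbit is eventually
  -- within δ/2 of Λ; together this fits in a ball of the Lebesgue radius δ.
  refine ⟨δ / 4, by positivity, fun y hy V hV => ?_⟩
  by_contra! hcon
  have hcont := continuousOn_flow hX hin y
  -- y may lie on the boundary, where openness of X_t is not available. It is replaced by a point of
  -- its own orbit which is interior and still in V.
  obtain ⟨ε, hε, hεV⟩ : ∃ ε : ℝ, 0 < ε ∧ flow X ε y ∈ interior V := by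
    have h1 : ∀ᶠ s in 𝓝[Ici 0] (0 : ℝ), flow X s y ∈ interior V := by
      refine (hcont 0 self_mem_Ici).eventually_mem ?_
      simp only [flow_zero hX hin]
      exact interior_mem_nhds.2 hV
    obtain ⟨s, hs, hs0⟩ := ((h1.filter_mono (nhdsWithin_mono _ Ioi_subset_Ici_self)).and
      (self_mem_nhdsWithin : Ioi 0 ∈ 𝓝[>] (0 : ℝ))).exists
    exact ⟨s, hs0, hs⟩
  set y₁ := flow X ε y
  have hy₁ : y₁ ∈ (𝓡∂ n).interior M := flow_mem_interior hX hin y hε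
  have hyV : y₁ ∈ V := interior_subset hεV
  have hclose : ∀ z ∈ V, ∀ t : ℝ, 0 ≤ t → dist (flow X t z) (flow X t y₁) ≤ δ / 2 := by
    intro z hz t ht
    have h1 := hcon z hz t ht
    have h2 := hcon y₁ hyV t ht
    have h3 := dist_triangle_left (flow X t z) (flow X t y₁) (flow X t y)
    linarith
  obtain ⟨t₀, ht₀, hnear⟩ : ∃ t₀ : ℝ, 0 ≤ t₀ ∧ ∀ t ≥ t₀,
      flow X t y₁ ∈ Metric.thickening (δ / 2) Λ := by
    have h1 : ∀ᶠ t in atTop, flow X t y ∈ Metric.thickening (δ / 2) Λ := by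
      have := eventually_mapsTo_of_isOpen_of_omegaLimit_subset (f := atTop) (ϕ := flow X) (s := {y})
        (Metric.isOpen_thickening (δ := δ / 2) (E := Λ))
        (hy.trans (Metric.self_subset_thickening (by positivity) Λ))
      exact this.mono fun t ht => ht rfl
    obtain ⟨t₁, ht₁⟩ := eventually_atTop.1 h1
    refine ⟨max t₁ 0, le_max_right _ _, fun t ht => ?_⟩
    have ht' := max_le_iff.1 ht
    have := ht₁ (ε + t) (by linarith [ht'.1])
    rwa [flow_add hX hin hε.le ht'.2] at this
  have hWnear : ∀ t ≥ t₀, ∃ p ∈ Λ, ∀ z, dist z (flow X t y₁) ≤ δ / 2 → z ∈ W p := by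
    intro t ht
    obtain ⟨p, hp, hpd⟩ := Metric.mem_thickening_iff.1 (hnear t ht)
    obtain ⟨i, hi⟩ := hcov p hp
    refine ⟨i, i.2, fun z hz => interior_subset (hi ?_)⟩
    rw [Metric.mem_ball]
    linarith [dist_triangle z (flow X t y₁) p]
  set q := flow X t₀ y₁
  -- The unstable displacement is made only after the orbit has come near Λ; openness of the time-t₀
  -- map realizes it by a point of V.
  have himg := image_flow_mem_nhds hX hin hy₁ ht₀ (isOpen_interior.mem_nhds hεV)
  obtain ⟨p₀, hp₀, hW₀⟩ := hWnear t₀ le_rfl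
  obtain ⟨z, hzV, hzq, hz⟩ := hWe p₀ hp₀ q (hW₀ q (by rw [dist_self]; positivity)) _ himg
  obtain ⟨y', hy', rfl⟩ := hzV
  set z := flow X t₀ y'
  let ρ : ℕ → ℝ := fun k => dist (e (flow X (k * T) z)) (e (flow X (k * T) q))
  have hρ : ∀ k, A * ρ k ≤ ρ (k + 1) := by
    intro k
    induction k with
    | zero =>
      simpa only [ρ, flow_natCast_succ_mul hX hin hT.le, Nat.cast_zero, zero_mul,
        flow_zero hX hin] using hz
    | succ k ih =>
      have hk : 0 ≤ k * T := mul_nonneg (Nat.cast_nonneg k) hT.le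
      obtain ⟨p, hp, hWp⟩ := hWnear (t₀ + k * T) (by linarith)
      rw [flow_add hX hin ht₀ hk] at hWp
      have m1 : flow X (k * T) z ∈ W p := hWp _ (by
        rw [← flow_add hX hin ht₀ hk, ← flow_add hX hin ht₀ hk]
        exact hclose y' (interior_subset hy') _ (by linarith))
      have m2 : flow X (k * T) q ∈ W p := hWp _ (by rw [dist_self]; positivity)
      have := hWc p hp _ m1 _ m2
      simp only [ρ, flow_natCast_succ_mul hX hin hT.le] at ih ⊢
      simp only [flow_add hX hin hT.le hT.le] at this
      exact this ih
  have hρA : ∀ k : ℕ, A ^ k * ρ 0 ≤ ρ k := by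
    intro k
    induction k with
    | zero => simp
    | succ k ih =>
      calc A ^ (k + 1) * ρ 0 = A * (A ^ k * ρ 0) := by ring
        _ ≤ A * ρ k := by gcongr
        _ ≤ ρ (k + 1) := hρ k
  have hρ0 : 0 < ρ 0 := by
    simp only [ρ, Nat.cast_zero, zero_mul, flow_zero hX hin]
    exact dist_pos.2 (heinj.ne hzq)
  -- Growth like A^k of a positive distance contradicts boundedness of e(M).
  obtain ⟨R, hR⟩ := Metric.isBounded_iff.1 (isCompact_range he.continuous).isBounded
  obtain ⟨k, hk⟩ := pow_unbounded_of_one_lt (R / ρ 0) hA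
  rw [div_lt_iff₀ hρ0] at hk
  exact absurd (hR (mem_range_self _) (mem_range_self _)) (not_le.2 (hk.trans_le (hρA k)))

end HypAttr

/-! ### Dimension counts, an elementary bound, and long passages near a point. -/

namespace HypAttr

theorem exists_mem_inf_ne_zero {V : Type*} [AddCommGroup V] [Module ℝ V] [FiniteDimensional ℝ V]
    {P Q : Submodule ℝ V}
    (h : Module.finrank ℝ V < Module.finrank ℝ P + Module.finrank ℝ Q) :
    ∃ v, v ∈ P ∧ v ∈ Q ∧ v ≠ 0 := by
  have h1 := Submodule.finrank_sup_add_finrank_inf_eq P Q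
  have h2 := Submodule.finrank_le (P ⊔ Q)
  have h3 : P ⊓ Q ≠ ⊥ := by
    intro h0
    rw [h0, finrank_bot] at h1
    omega
  obtain ⟨v, hv, hv0⟩ := Submodule.exists_mem_ne_zero_of_ne_bot h3
  exact ⟨v, hv.1, hv.2, hv0⟩

theorem finrank_sup_span_singleton {V : Type*} [AddCommGroup V] [Module ℝ V]
    [FiniteDimensional ℝ V] {P : Submodule ℝ V} {x : V} (h : Disjoint P (Submodule.span ℝ {x}))
    (hx : x ≠ 0) : Module.finrank ℝ ↥(P ⊔ Submodule.span ℝ {x}) = Module.finrank ℝ P + 1 := by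
  have h1 := Submodule.finrank_sup_add_finrank_inf_eq P (Submodule.span ℝ {x})
  rw [h.eq_bot, finrank_bot, finrank_span_singleton hx] at h1
  exact h1

/-- The roles are: a a hyperbolic component, b the whole vector, r the coefficient of X, c₀ a lower
bound for |X| at one end and m an upper bound at the other. -/
theorem projection_bound {a b r c₀ m C : ℝ} (hc₀ : 0 < c₀) (hm : 0 ≤ m)
    (h₁ : (1 + m / c₀) * a ≤ C * b + r * m) (h₂ : r * c₀ ≤ b + a) : a ≤ (C + m / c₀) * b := by
  have h3 : r * m ≤ m / c₀ * (b + a) := by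
    calc r * m = m / c₀ * (r * c₀) := by field_simp
      _ ≤ _ := by gcongr
  linarith

/-- A curve which returns infinitely often both near `σ` and away from `σ` has arbitrarily long
passages through a small ball around `σ`, when it is slow near `σ`. -/
theorem exists_long_passage {M : Type*} [MetricSpace M] {γ : ℝ → M}
    (hγ : ContinuousOn γ (Ici 0)) {σ p : M} {η : ℝ} (hp : η < dist p σ)
    (hσf : ∀ U ∈ 𝓝 σ, ∃ᶠ t in atTop, γ t ∈ U) (hpf : ∀ U ∈ 𝓝 p, ∃ᶠ t in atTop, γ t ∈ U) {N : ℝ}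
    (hN : 0 ≤ N)
    (hslow : ∃ U ∈ 𝓝 σ, ∀ t : ℝ, 0 ≤ t → γ t ∈ U → ∀ s ∈ Icc 0 N, dist (γ (t + s)) σ < η) :
    ∃ a b : ℝ, 0 ≤ a ∧ a + N < b ∧ dist (γ a) σ = η ∧ dist (γ b) σ = η ∧
      ∀ t ∈ Icc a b, dist (γ t) σ ≤ η := by
  obtain ⟨U, hU, hslow⟩ := hslow
  have hfar : {z | η < dist z σ} ∈ 𝓝 p :=
    (isOpen_lt continuous_const (continuous_id.dist continuous_const)).mem_nhds hp
  -- Times far, near, far. The passage runs from the last time before t₂ to the first time after t₂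
  -- with distance at least η, and slowness already puts its end more than N after t₂.
  obtain ⟨t₁, ht₁, ht₁0⟩ := ((hpf _ hfar).and_eventually (eventually_ge_atTop 0)).exists
  obtain ⟨t₂, ht₂, ht₁₂⟩ := ((hσf _ hU).and_eventually (eventually_ge_atTop t₁)).exists
  obtain ⟨t₃, ht₃, ht₂₃⟩ := ((hpf _ hfar).and_eventually (eventually_ge_atTop t₂)).exists
  have ht₂0 : 0 ≤ t₂ := ht₁0.trans ht₁₂
  have hd : ∀ c d : ℝ, 0 ≤ c → ContinuousOn (fun t => dist (γ t) σ) (Icc c d) := fun c d hc =>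
    (continuous_id.dist continuous_const).comp_continuousOn
      (hγ.mono fun _ (ht : _ ∈ Icc c d) => hc.trans ht.1)
  have hslow' := hslow t₂ ht₂0 ht₂
  have ht₂η : dist (γ t₂) σ < η := by simpa using hslow' 0 ⟨le_rfl, hN⟩
  have hS : IsCompact {t ∈ Icc t₁ t₂ | η ≤ dist (γ t) σ} :=
    isCompact_Icc.of_isClosed_subset ((hd t₁ t₂ ht₁0).preimage_isClosed_of_isClosed isClosed_Icc
      isClosed_Ici) (fun t ht => ht.1)
  have hS' : IsCompact {t ∈ Icc t₂ t₃ | η ≤ dist (γ t) σ} :=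
    isCompact_Icc.of_isClosed_subset ((hd t₂ t₃ ht₂0).preimage_isClosed_of_isClosed isClosed_Icc
      isClosed_Ici) (fun t ht => ht.1)
  obtain ⟨a, ⟨⟨ha1, ha2⟩, haη⟩, hamax⟩ := hS.exists_isGreatest ⟨t₁, ⟨le_rfl, ht₁₂⟩, le_of_lt ht₁⟩
  obtain ⟨b, ⟨⟨hb1, hb2⟩, hbη⟩, hbmin⟩ := hS'.exists_isLeast ⟨t₃, ⟨ht₂₃, le_rfl⟩, le_of_lt ht₃⟩
  have hat : a < t₂ := lt_of_le_of_ne ha2 fun h => (h ▸ haη).not_gt ht₂η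
  have htb : t₂ < b := lt_of_le_of_ne hb1 fun h => (h ▸ hbη).not_gt ht₂η
  have ha0 : 0 ≤ a := ht₁0.trans ha1
  have hmid : ∀ t ∈ Ioo a b, dist (γ t) σ ≤ η := by
    rintro t ⟨hta, htb⟩
    by_contra! hcon
    rcases le_total t t₂ with h | h
    · exact (hamax ⟨⟨ha1.trans hta.le, h⟩, hcon.le⟩).not_gt hta
    · exact (hbmin ⟨⟨h, htb.le.trans hb2⟩, hcon.le⟩).not_gt htb
  have hcl : ∀ t ∈ Icc a b, dist (γ t) σ ≤ η := by
    have h1 := closure_Ioo (hat.trans htb).ne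
    rw [← h1]
    refine fun t ht => le_on_closure hmid ?_ continuousOn_const ht
    rw [h1]
    exact hd a b ha0
  refine ⟨a, b, ha0, ?_, le_antisymm (hcl a ⟨le_rfl, by linarith⟩) haη,
    le_antisymm (hcl b ⟨by linarith, le_rfl⟩) hbη, hcl⟩
  by_contra! hcon
  have := hslow' (b - t₂) ⟨by linarith, by linarith⟩
  rw [add_sub_cancel] at this
  exact hbη.not_gt this

end HypAttr

/-! ### Near a hyperbolic singularity: persistent cones, isolation, projections. -/

namespace HypAttr

variable {n : ℕ} [NeZero n] {M : Type*} [MetricSpace M]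
  [ChartedSpace (EuclideanHalfSpace n) M] [IsManifold (𝓡∂ n) ∞ M]
  {F : Type*} [NormedAddCommGroup F] [NormedSpace ℝ F]
  {X : ∀ x : M, TangentSpace (𝓡∂ n) x} {e : M → F} [CompactSpace M]
  (hX : ContMDiff (𝓡∂ n) (𝓡∂ n).tangent 1 (fun x => (⟨x, X x⟩ : TangentBundle (𝓡∂ n) M)))
  (hin : InwardlyTransverse X) (he : ContMDiff (𝓡∂ n) 𝓘(ℝ, F) 1 e)
  (hinj : ∀ x, Function.Injective (mfderiv (𝓡∂ n) 𝓘(ℝ, F) e x))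
  {Es Eu : ∀ x : M, Submodule ℝ (TangentSpace (𝓡∂ n) x)} {B lam : ℝ}

include hX hin he hinj

/-- Strict cone criteria at a point extend to the nearby points. -/
theorem exists_nhds_cone_criteria {p : M} (hp : p ∈ (𝓡∂ n).interior M) {T A : ℝ} (hT : 0 < T)
    (hA : 1 < A)
    (hf : ∀ v, A / 2 * ‖embDeriv e X 0 p v‖ ≤ ‖embDeriv e X T p v‖ →
      2 * A * ‖embDeriv e X T p v‖ ≤ ‖embDeriv e X (T + T) p v‖)
    (hb : ∀ v, A / 2 * ‖embDeriv e X (T + T) p v‖ ≤ ‖embDeriv e X T p v‖ →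
      2 * A * ‖embDeriv e X T p v‖ ≤ ‖embDeriv e X 0 p v‖)
    (hu : ∀ u ∈ Eu p, 2 * A * ‖embDeriv e X 0 p u‖ ≤ ‖embDeriv e X T p u‖)
    (hs : ∀ s ∈ Es p, 2 * A * ‖embDeriv e X (T + T) p s‖ ≤ ‖embDeriv e X T p s‖) :
    ∀ᶠ z in 𝓝 p,
      (∀ v, A * ‖embDeriv e X 0 z v‖ < ‖embDeriv e X T z v‖ →
        A * ‖embDeriv e X T z v‖ < ‖embDeriv e X (T + T) z v‖) ∧
      (∀ v, A * ‖embDeriv e X (T + T) z v‖ < ‖embDeriv e X T z v‖ →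
        A * ‖embDeriv e X T z v‖ < ‖embDeriv e X 0 z v‖) ∧
      (∃ Q : Submodule ℝ (TangentSpace (𝓡∂ n) z), Module.finrank ℝ Q = Module.finrank ℝ (Eu p) ∧
        ∀ v ∈ Q, v ≠ 0 → A * ‖embDeriv e X 0 z v‖ < ‖embDeriv e X T z v‖) ∧
      (∃ Q : Submodule ℝ (TangentSpace (𝓡∂ n) z), Module.finrank ℝ Q = Module.finrank ℝ (Es p) ∧
        ∀ v ∈ Q, v ≠ 0 → A * ‖embDeriv e X (T + T) z v‖ < ‖embDeriv e X T z v‖) := by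
  have hA0 : 0 < A := zero_lt_one.trans hA
  let t : Fin 3 → ℝ := ![0, T, T + T]
  have ht : ∀ i, 0 ≤ t i := by
    intro i
    fin_cases i
    · exact le_rfl
    · exact hT.le
    · exact (add_pos hT hT).le
  have hpos : ∀ r : ℝ, 0 ≤ r → ∀ v : TangentSpace (𝓡∂ n) p, v ≠ 0 → 0 < ‖embDeriv e X r p v‖ := by
    intro r hr v hv
    refine norm_pos_iff.2 fun h0 => hv ?_
    exact injective_embDeriv hX hin he hinj hp hr (h0.trans (map_zero _).symm)
  have hop : ∀ i j, IsOpen {x : Fin 3 → ℝ | A * x i < x j} := fun i j =>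
    isOpen_lt (by fun_prop) (by fun_prop)
  have hsc : ∀ i j, ∀ r : ℝ, 0 < r → ∀ x ∈ {x : Fin 3 → ℝ | A * x i < x j},
      r • x ∈ {x : Fin 3 → ℝ | A * x i < x j} := by
    intro i j r hr x hx
    simp only [mem_ofPred_eq, Pi.smul_apply, smul_eq_mul] at hx ⊢
    nlinarith
  have hop' : ∀ i j, IsOpen {x : Fin 3 → ℝ | x j < A * x i} := fun i j =>
    isOpen_lt (by fun_prop) (by fun_prop)
  have hsc' : ∀ i j, ∀ r : ℝ, 0 < r → ∀ x ∈ {x : Fin 3 → ℝ | x j < A * x i},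
      r • x ∈ {x : Fin 3 → ℝ | x j < A * x i} := by
    intro i j r hr x hx
    simp only [mem_ofPred_eq, Pi.smul_apply, smul_eq_mul] at hx ⊢
    nlinarith
  have hsu : ∀ i j k l, ∀ r : ℝ, 0 < r →
      ∀ x ∈ {x : Fin 3 → ℝ | x j < A * x i} ∪ {x : Fin 3 → ℝ | A * x k < x l},
      r • x ∈ {x : Fin 3 → ℝ | x j < A * x i} ∪ {x : Fin 3 → ℝ | A * x k < x l} := by
    rintro i j k l r hr x (hx | hx)
    · exact Or.inl (hsc' i j r hr x hx)
    · exact Or.inr (hsc k l r hr x hx)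
  -- An implication between strict inequalities is not an open condition. It is weakened at its
  -- negated premise to a strict inequality: x₁ < A x₀ or A x₁ < x₂, which is open and conical.
  have k1 := eventually_of_cone hX hin he ht ((hop' 0 1).union (hop 1 2)) (hsu 0 1 1 2) hp
    (fun v hv => by
      by_cases h : ‖embDeriv e X T p v‖ < A * ‖embDeriv e X 0 p v‖
      · exact Or.inl h
      · refine Or.inr ?_
        change A * ‖embDeriv e X T p v‖ < ‖embDeriv e X (T + T) p v‖
        have h1 := hpos T hT.le v hv
        have h2 := hf v (by nlinarith [norm_nonneg (embDeriv e X 0 p v)])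
        nlinarith)
  have k2 := eventually_of_cone hX hin he ht ((hop' 2 1).union (hop 1 0)) (hsu 2 1 1 0) hp
    (fun v hv => by
      by_cases h : ‖embDeriv e X T p v‖ < A * ‖embDeriv e X (T + T) p v‖
      · exact Or.inl h
      · refine Or.inr ?_
        change A * ‖embDeriv e X T p v‖ < ‖embDeriv e X 0 p v‖
        have h1 := hpos T hT.le v hv
        have h2 := hb v (by nlinarith [norm_nonneg (embDeriv e X (T + T) p v)])
        nlinarith)
  have k3 := eventually_exists_submodule hX hin he ht (hop 0 1) (hsc 0 1) hp (B := Eu p)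
    (fun v hv hv0 => by
      change A * ‖embDeriv e X 0 p v‖ < ‖embDeriv e X T p v‖
      nlinarith [hu v hv, hpos 0 le_rfl v hv0])
  have k4 := eventually_exists_submodule hX hin he ht (hop 2 1) (hsc 2 1) hp (B := Es p)
    (fun v hv hv0 => by
      change A * ‖embDeriv e X (T + T) p v‖ < ‖embDeriv e X T p v‖
      nlinarith [hs v hv, hpos (T + T) (add_pos hT hT).le v hv0])
  filter_upwards [k1, k2, k3, k4] with z h1 h2 h3 h4
  refine ⟨fun v hv => ?_, fun v hv => ?_, h3, h4⟩
  · rcases eq_or_ne v 0 with rfl | hv0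
    · simp at hv
    · exact (h1 v hv0).resolve_left fun h => lt_asymm h hv
  · rcases eq_or_ne v 0 with rfl | hv0
    · simp at hv
    · exact (h2 v hv0).resolve_left fun h => lt_asymm h hv

/-- A hyperbolic singularity is an isolated zero of `X`. -/
theorem HypRates.eventually_eq_of_eq_zero {σ : M} (h : HypRates e X {σ} Es Eu B lam)
    (hσ : X σ = 0) : ∀ᶠ z in 𝓝 σ, X z = 0 → z = σ := by
  obtain ⟨T, A, hT, hA, hcone⟩ := h.exists_cone_criteria hX hin he hinj
    (Or.inl fun z hz => by rw [mem_singleton_iff.1 hz]; exact hσ)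
  obtain ⟨-, -, hu, hs⟩ := hcone σ rfl
  have hσi := h.subset_interior rfl
  have hfix : flow X T σ = σ := flow_eq_self_of_eq_zero hX hin hσ hT.le
  let D : ℝ → M → EuclideanSpace ℝ (Fin n) →L[ℝ] F := fun t z => embDeriv e X t z
  let J : EuclideanSpace ℝ (Fin n) →L[ℝ] EuclideanSpace ℝ (Fin n) := dflow X T σ
  let Vs : M → Submodule ℝ (EuclideanSpace ℝ (Fin n)) := Es
  let Vu : M → Submodule ℝ (EuclideanSpace ℝ (Fin n)) := Eu
  have hDadd : ∀ t : ℝ, 0 ≤ t → ∀ v, D (T + t) σ v = D t σ (J v) := by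
    intro t ht v
    have h1 : D (T + t) σ v = D t (flow X T σ) (J v) := embDeriv_add hX hin he hσi hT.le ht v
    rwa [hfix] at h1
  have hJs : ∀ v ∈ Vs σ, J v ∈ Vs σ := by
    intro v hv
    have h1 : J v ∈ Vs (flow X T σ) := h.splitting.dflow_stable rfl hT.le hv
    rwa [hfix] at h1
  have hJu : ∀ v ∈ Vu σ, J v ∈ Vu σ := by
    intro v hv
    have h1 : J v ∈ Vu (flow X T σ) := h.splitting.dflow_unstable rfl hT.le hv
    rwa [hfix] at h1
  have hDi : Function.Injective (D 0 σ) := injective_embDeriv hX hin he hinj hσi le_rfl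
  have hDT : ∀ v, D T σ v = D 0 σ (J v) := fun v => by
    rw [← hDadd 0 le_rfl, add_zero]
  have hdisj : Disjoint (Vs σ) (Vu σ) := (h.splitting.isCompl σ rfl).disjoint.mono_left le_sup_left
  -- 1 is not an eigenvalue of DX_T(σ): the stable and unstable parts of a fixed vector would be
  -- fixed separately, against contraction and expansion. A zero of X is a fixed point of X_T, and e
  -- ∘ X_T - e has injective derivative at σ, so no other zero is near.
  have hker : ∀ v, D T σ v = D 0 σ v → v = 0 := by
    intro v hv
    rw [hDT] at hv
    have hJv := hDi hv
    obtain ⟨s, hs', c, u, hu', hvs⟩ := h.splitting.exists_eq_add (z := σ) rfl v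
    rw [hσ, smul_zero, add_zero] at hvs
    let s' : EuclideanSpace ℝ (Fin n) := s
    let u' : EuclideanSpace ℝ (Fin n) := u
    have hvs' : v = s' + u' := hvs
    have h1 : J s' - s' = u' - J u' := by
      rw [hvs', map_add] at hJv
      rw [sub_eq_sub_iff_add_eq_add, hJv, add_comm]
    have h2 : J s' - s' = 0 := by
      refine Submodule.disjoint_def.1 hdisj _ (sub_mem (hJs _ hs') hs') ?_
      rw [h1]
      exact sub_mem hu' (hJu _ hu')
    have h3 : J u' = u' := by
      rw [h2] at h1
      exact (sub_eq_zero.1 h1.symm).symm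
    have h4 : J s' = s' := sub_eq_zero.1 h2
    have h5 : 2 * A * ‖D 0 σ u'‖ ≤ ‖D T σ u'‖ := hu u hu'
    have h6 : 2 * A * ‖D (T + T) σ s'‖ ≤ ‖D T σ s'‖ := hs s hs'
    rw [hDadd T hT.le, h4, hDT, h4] at h6
    rw [hDT, h3] at h5
    have h7 : ‖D 0 σ u'‖ = 0 := by nlinarith [norm_nonneg (D 0 σ u')]
    have h8 : ‖D 0 σ s'‖ = 0 := by nlinarith [norm_nonneg (D 0 σ s')]
    have h9 : u' = 0 := hDi ((norm_eq_zero.1 h7).trans (map_zero _).symm)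
    have h10 : s' = 0 := hDi ((norm_eq_zero.1 h8).trans (map_zero _).symm)
    rw [hvs', h9, h10, add_zero]
  set φ := extChartAt (𝓡∂ n) σ
  have hsd : ∀ t : ℝ, 0 ≤ t → HasStrictFDerivAt ((e ∘ flow X t) ∘ φ.symm) (D t σ) (φ σ) :=
    fun t ht => hasStrictFDerivAt_comp_extChartAt_symm hσi
      (contMDiffAt_embed_comp_flow hX hin he hσi ht)
  have hsub := (hsd T hT.le).hasFDerivAt.sub (hsd 0 le_rfl).hasFDerivAt
  obtain ⟨c, hc, hcL⟩ := exists_lower_bound_of_injective (L := D T σ - D 0 σ) (by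
    refine (injective_iff_map_eq_zero _).2 fun v hv => hker v ?_
    rw [sub_apply] at hv
    exact sub_eq_zero.1 hv)
  have hne := hsub.eventually_ne (c := (0 : F)) ⟨⟨c⁻¹, (inv_pos.2 hc).le⟩, by
    refine AddMonoidHomClass.antilipschitz_of_bound _ fun v => ?_
    change ‖v‖ ≤ c⁻¹ * _
    rw [inv_mul_eq_div, le_div_iff₀ hc, mul_comm]
    exact hcL v⟩
  have hne' := (eventually_nhdsWithin_iff.1 hne)
  filter_upwards [(continuousAt_extChartAt (I := 𝓡∂ n) σ).eventually hne',
    extChartAt_source_mem_nhds (I := 𝓡∂ n) σ] with z hz hzs hz0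
  by_contra hzσ
  refine hz (fun h0 => hzσ (φ.injOn hzs (mem_extChartAt_source σ) h0)) ?_
  have hzz : φ.symm (extChartAt (𝓡∂ n) σ z) = z := φ.left_inv hzs
  simp only [Pi.sub_apply, Function.comp_apply, hzz,
    flow_eq_self_of_eq_zero hX hin hz0 hT.le, flow_zero hX hin, sub_self]

variable {Λ : Set M} (h : HypRates e X Λ Es Eu B lam) {c₀ m : ℝ} (hc₀ : 0 < c₀) (hm : 0 ≤ m)
  (hXm : ∀ z, ‖embDeriv e X 0 z (X z)‖ ≤ m)

include h hc₀ hm hXm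

/-- |X| is bounded below only at `z`, as the orbit may have come close to a singularity. So go back
by τ, the direction in which the stable component grows and in which only the upper bound m for |X|
is needed. -/
theorem HypRates.exists_projection_stable_le :
    ∃ C : ℝ, 0 < C ∧ ∀ z ∈ Λ, c₀ ≤ ‖embDeriv e X 0 z (X z)‖ → ∀ s ∈ Es z, ∀ c : ℝ,
      ‖embDeriv e X 0 z s‖ ≤ C * ‖embDeriv e X 0 z (s + c • X z)‖ ∧
      ‖embDeriv e X 0 z (c • X z)‖ ≤ C * ‖embDeriv e X 0 z (s + c • X z)‖ := by
  have hr : 0 < 1 + m / c₀ := by positivity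
  obtain ⟨τ, hτ, hτs⟩ := exists_mul_exp_neg_le h.lam_pos B (ε := (1 + m / c₀)⁻¹) (by positivity)
  obtain ⟨C, hC, hCτ⟩ := exists_embDeriv_le hX hin he hinj h.isCompact h.subset_interior
    hτ.le le_rfl
  refine ⟨1 + (C + m / c₀), by positivity, fun z hz hcz s hs c => ?_⟩
  rw [← h.image_eq τ hτ.le] at hz
  obtain ⟨w, hw, rfl⟩ := hz
  rw [← h.splitting.map_stable w hw τ hτ.le] at hs
  obtain ⟨s', hs', rfl⟩ := hs
  have hwi := h.subset_interior hw
  have e1 : ‖embDeriv e X 0 (flow X τ w) (dflow X τ w s')‖ = ‖embDeriv e X τ w s'‖ := by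
    rw [embDeriv_eq hX hin he hwi hτ.le]
  have e2 : dflow X τ w s' + c • X (flow X τ w) = dflow X τ w (s' + c • X w) := by
    rw [map_add, map_smul, dflow_apply_self hX hin hwi hτ.le]
  have e3 : ‖embDeriv e X 0 (flow X τ w) (dflow X τ w s' + c • X (flow X τ w))‖ =
      ‖embDeriv e X τ w (s' + c • X w)‖ := by
    rw [e2, ← embDeriv_eq hX hin he hwi hτ.le]
  have h1 : (1 + m / c₀) * ‖embDeriv e X τ w s'‖ ≤ ‖embDeriv e X 0 w s'‖ := by
    have := (h.stable w hw τ hτ.le s' hs').trans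
      (mul_le_mul_of_nonneg_right hτs (norm_nonneg _))
    rwa [inv_mul_eq_div, le_div_iff₀ hr, mul_comm] at this
  have h2 : ‖embDeriv e X 0 w s'‖ ≤ ‖embDeriv e X 0 w (s' + c • X w)‖ + ‖c‖ * m := by
    have := norm_sub_le (embDeriv e X 0 w (s' + c • X w)) (embDeriv e X 0 w (c • X w))
    rw [← map_sub, add_sub_cancel_right, map_smul _ c, norm_smul] at this
    exact this.trans (by gcongr; exact hXm w)
  have h3 := hCτ w hw (s' + c • X w)
  have h4 : ‖embDeriv e X 0 (flow X τ w) (c • X (flow X τ w))‖ ≤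
      ‖embDeriv e X τ w (s' + c • X w)‖ + ‖embDeriv e X τ w s'‖ := by
    rw [← e3, ← e1]
    have := norm_sub_le (embDeriv e X 0 (flow X τ w) (dflow X τ w s' + c • X (flow X τ w)))
      (embDeriv e X 0 (flow X τ w) (dflow X τ w s'))
    rwa [← map_sub, add_sub_cancel_left] at this
  have h5 : ‖c‖ * c₀ ≤ ‖embDeriv e X τ w (s' + c • X w)‖ + ‖embDeriv e X τ w s'‖ := by
    refine le_trans ?_ h4
    rw [map_smul, norm_smul]
    gcongr
  have h6 := projection_bound (C := C) hc₀ hm (by linarith) h5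
  change ‖embDeriv e X 0 (flow X τ w) (dflow X τ w s')‖ ≤ _ * ‖embDeriv e X 0 (flow X τ w)
      (dflow X τ w s' + c • X (flow X τ w))‖ ∧ _ ≤ _ * ‖embDeriv e X 0 (flow X τ w)
      (dflow X τ w s' + c • X (flow X τ w))‖
  rw [e1, e3]
  have h7 := norm_nonneg (embDeriv e X τ w (s' + c • X w))
  constructor <;> linarith

/-- Going forward by τ makes the unstable component grow, again with only an upper bound for |X| at
the far end. -/
theorem HypRates.exists_projection_unstable_le :
    ∃ C : ℝ, 0 < C ∧ ∀ z ∈ Λ, c₀ ≤ ‖embDeriv e X 0 z (X z)‖ → ∀ u ∈ Eu z, ∀ c : ℝ,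
      ‖embDeriv e X 0 z u‖ ≤ C * ‖embDeriv e X 0 z (u + c • X z)‖ ∧
      ‖embDeriv e X 0 z (c • X z)‖ ≤ C * ‖embDeriv e X 0 z (u + c • X z)‖ := by
  have hr : 0 < 1 + m / c₀ := by positivity
  obtain ⟨τ, hτ, hτu⟩ := exists_mul_exp_neg_le h.lam_pos B (ε := (1 + m / c₀)⁻¹) (by positivity)
  obtain ⟨C, hC, hCτ⟩ := exists_embDeriv_le hX hin he hinj h.isCompact h.subset_interior
    le_rfl hτ.le
  refine ⟨1 + (C + m / c₀), by positivity, fun z hz hcz u hu c => ?_⟩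
  have h1 : (1 + m / c₀) * ‖embDeriv e X 0 z u‖ ≤ ‖embDeriv e X τ z u‖ := by
    have := (h.unstable z hz τ hτ.le u hu).trans
      (mul_le_mul_of_nonneg_right hτu (norm_nonneg _))
    rwa [inv_mul_eq_div, le_div_iff₀ hr, mul_comm] at this
  have h2 : ‖embDeriv e X τ z u‖ ≤ ‖embDeriv e X τ z (u + c • X z)‖ + ‖c‖ * m := by
    have := norm_sub_le (embDeriv e X τ z (u + c • X z)) (embDeriv e X τ z (c • X z))
    rw [← map_sub, add_sub_cancel_right, map_smul _ c, norm_smul,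
      embDeriv_self hX hin he (h.subset_interior hz) hτ.le] at this
    exact this.trans (by gcongr; exact hXm _)
  have h3 := hCτ z hz (u + c • X z)
  have h4 : ‖embDeriv e X 0 z (c • X z)‖ ≤
      ‖embDeriv e X 0 z (u + c • X z)‖ + ‖embDeriv e X 0 z u‖ := by
    have := norm_sub_le (embDeriv e X 0 z (u + c • X z)) (embDeriv e X 0 z u)
    rwa [← map_sub, add_sub_cancel_left] at this
  have h5 : ‖c‖ * c₀ ≤ ‖embDeriv e X 0 z (u + c • X z)‖ + ‖embDeriv e X 0 z u‖ := by
    refine le_trans ?_ h4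
    rw [map_smul, norm_smul]
    gcongr
  have h6 := projection_bound (C := C) hc₀ hm (by linarith) h5
  have h7 := norm_nonneg (embDeriv e X 0 z (u + c • X z))
  constructor <;> linarith

end HypAttr

/-! ### A hyperbolic omega-limit set of one of its points, with a singularity, is that singularity.
-/

namespace HypAttr

variable {n : ℕ} [NeZero n] {M : Type*} [MetricSpace M]
  [ChartedSpace (EuclideanHalfSpace n) M] [IsManifold (𝓡∂ n) ∞ M]
  {F : Type*} [NormedAddCommGroup F] [NormedSpace ℝ F]
  {X : ∀ x : M, TangentSpace (𝓡∂ n) x} {e : M → F} [CompactSpace M]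
  (hX : ContMDiff (𝓡∂ n) (𝓡∂ n).tangent 1 (fun x => (⟨x, X x⟩ : TangentBundle (𝓡∂ n) M)))
  (hin : InwardlyTransverse X) (he : ContMDiff (𝓡∂ n) 𝓘(ℝ, F) 1 e)
  (hinj : ∀ x, Function.Injective (mfderiv (𝓡∂ n) 𝓘(ℝ, F) e x))
  {Es Eu : ∀ x : M, Submodule ℝ (TangentSpace (𝓡∂ n) x)} {B lam : ℝ} {Λ : Set M}

omit [CompactSpace M] in
theorem HypRates.of_singleton (h : HypRates e X Λ Es Eu B lam) {σ : M} (hσ : σ ∈ Λ)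
    (hinv : InvariantSet X {σ}) : HypRates e X {σ} Es Eu B lam where
  isCompact := isCompact_singleton
  subset_interior := singleton_subset_iff.2 (h.subset_interior hσ)
  image_eq := hinv
  one_le := h.one_le
  lam_pos := h.lam_pos
  splitting :=
    { disjoint := fun x hx => h.splitting.disjoint x (by rwa [mem_singleton_iff.1 hx])
      isCompl := fun x hx => h.splitting.isCompl x (by rwa [mem_singleton_iff.1 hx])
      map_stable := fun x hx => h.splitting.map_stable x (by rwa [mem_singleton_iff.1 hx])
      map_unstable := fun x hx => h.splitting.map_unstable x (by rwa [mem_singleton_iff.1 hx])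
      rates := by
        obtain ⟨g, K, l, hK, hl, hs, hu⟩ := h.splitting.rates
        exact ⟨g, K, l, hK, hl, fun x hx => hs x (by rwa [mem_singleton_iff.1 hx]),
          fun x hx => hu x (by rwa [mem_singleton_iff.1 hx])⟩ }
  stable := fun x hx => h.stable x (by rwa [mem_singleton_iff.1 hx])
  unstable := fun x hx => h.unstable x (by rwa [mem_singleton_iff.1 hx])

include hX hin

theorem invariantSet_singleton {σ : M} (hσ : X σ = 0) : InvariantSet X {σ} := fun t ht => by
  rw [image_singleton, flow_eq_self_of_eq_zero hX hin hσ ht]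

omit [CompactSpace M] hX hin in
theorem HypRates.finrank_add_finrank_of_eq_zero (h : HypRates e X Λ Es Eu B lam) {σ : M}
    (hσΛ : σ ∈ Λ) (hσ : X σ = 0) :
    Module.finrank ℝ (Es σ) + Module.finrank ℝ (Eu σ) = n := by
  have h1 := Submodule.finrank_add_eq_of_isCompl (h.splitting.isCompl σ hσΛ)
  rw [hσ, Submodule.span_zero_singleton, sup_bot_eq, finrank_tangentSpace] at h1
  exact h1

omit [CompactSpace M] hX hin in
theorem HypRates.finrank_add_finrank_of_ne_zero (h : HypRates e X Λ Es Eu B lam) {z : M}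
    (hz : z ∈ Λ) (hXz : X z ≠ 0) :
    Module.finrank ℝ (Es z) + 1 + Module.finrank ℝ (Eu z) = n := by
  have h1 := Submodule.finrank_add_eq_of_isCompl (h.splitting.isCompl z hz)
  rw [finrank_sup_span_singleton (h.splitting.disjoint z hz) hXz, finrank_tangentSpace] at h1
  exact h1

include he

section Passage

variable {T A C : ℝ} {z : M} {k : ℕ}

/-- Each conclusion of the cone criterion at X_{jT}(z) is its premise at X_{(j+1)T}(z). -/
theorem pow_mul_norm_embDeriv_le (hT : 0 < T) (hA : 1 < A) (hz : z ∈ (𝓡∂ n).interior M)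
    (hf : ∀ j : ℕ, j ≤ k → ∀ v, A * ‖embDeriv e X 0 (flow X (j * T) z) v‖ <
      ‖embDeriv e X T (flow X (j * T) z) v‖ → A * ‖embDeriv e X T (flow X (j * T) z) v‖ <
        ‖embDeriv e X (T + T) (flow X (j * T) z) v‖)
    {v : TangentSpace (𝓡∂ n) z} (hv : A * ‖embDeriv e X 0 z v‖ < ‖embDeriv e X T z v‖) :
    A ^ k * ‖embDeriv e X 0 z v‖ ≤ ‖embDeriv e X (k * T) z v‖ := by
  have hA0 : 0 < A := zero_lt_one.trans hA
  have h1 : ∀ j : ℕ, j ≤ k → A * ‖embDeriv e X (j * T) z v‖ < ‖embDeriv e X (j * T + T) z v‖ := by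
    intro j
    induction j with
    | zero =>
      intro _
      rw [Nat.cast_zero, zero_mul, zero_add]
      exact hv
    | succ j ih =>
      intro hj
      have hj0 : 0 ≤ j * T := mul_nonneg (Nat.cast_nonneg j) hT.le
      have h2 := ih (by omega)
      have e0 := embDeriv_eq hX hin he hz hj0 v
      have e1 := embDeriv_add hX hin he hz hj0 hT.le v
      have e2 := embDeriv_add hX hin he hz hj0 (add_pos hT hT).le v
      rw [e0, e1] at h2
      have h3 := hf j (by omega) _ h2
      rw [← e1, ← e2] at h3
      have e3 : ((j + 1 : ℕ) : ℝ) * T = j * T + T := by push_cast; ring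
      rw [e3, add_assoc]
      exact h3
  have h2 : ∀ j : ℕ, j ≤ k → A ^ j * ‖embDeriv e X 0 z v‖ ≤ ‖embDeriv e X (j * T) z v‖ := by
    intro j
    induction j with
    | zero => simp
    | succ j ih =>
      intro hj
      have e3 : ((j + 1 : ℕ) : ℝ) * T = j * T + T := by push_cast; ring
      rw [e3]
      refine le_trans ?_ (h1 j (by omega)).le
      rw [pow_succ', mul_assoc]
      exact mul_le_mul_of_nonneg_left (ih (by omega)) hA0.le
  exact h2 k le_rfl

/-- The backward criterion, started at the end of the passage and carried down to j = 0. -/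
theorem pow_mul_norm_embDeriv_le_zero (hT : 0 < T) (hA : 1 < A) (hz : z ∈ (𝓡∂ n).interior M)
    (hb : ∀ j : ℕ, j ≤ k → ∀ v, A * ‖embDeriv e X (T + T) (flow X (j * T) z) v‖ <
      ‖embDeriv e X T (flow X (j * T) z) v‖ → A * ‖embDeriv e X T (flow X (j * T) z) v‖ <
        ‖embDeriv e X 0 (flow X (j * T) z) v‖)
    {v : TangentSpace (𝓡∂ n) z}
    (hv : A * ‖embDeriv e X (T + T) (flow X (k * T) z) (dflow X (k * T) z v)‖ <
      ‖embDeriv e X T (flow X (k * T) z) (dflow X (k * T) z v)‖) :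
    A ^ k * ‖embDeriv e X (k * T) z v‖ ≤ ‖embDeriv e X 0 z v‖ := by
  have hA0 : 0 < A := zero_lt_one.trans hA
  have h1 : ∀ i j : ℕ, j + i = k →
      A * ‖embDeriv e X (j * T + T) z v‖ < ‖embDeriv e X (j * T) z v‖ := by
    intro i
    induction i with
    | zero =>
      rintro j rfl
      have hj0 : 0 ≤ (j : ℕ) * T := mul_nonneg (Nat.cast_nonneg _) hT.le
      rw [add_zero] at hv hb
      have h3 := hb j le_rfl _ hv
      rw [← embDeriv_eq hX hin he hz hj0, ← embDeriv_add hX hin he hz hj0 hT.le] at h3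
      exact h3
    | succ i ih =>
      intro j hj
      have hj0 : 0 ≤ j * T := mul_nonneg (Nat.cast_nonneg j) hT.le
      have h2 := ih (j + 1) (by omega)
      have e0 := embDeriv_eq hX hin he hz hj0 v
      have e1 := embDeriv_add hX hin he hz hj0 hT.le v
      have e2 := embDeriv_add hX hin he hz hj0 (add_pos hT hT).le v
      have e3 : ((j + 1 : ℕ) : ℝ) * T = j * T + T := by push_cast; ring
      rw [e3, add_assoc, e1, e2] at h2
      have h3 := hb j (by omega) _ h2
      rwa [← e0, ← e1] at h3
  have h2 : ∀ j : ℕ, j ≤ k → A ^ j * ‖embDeriv e X (j * T) z v‖ ≤ ‖embDeriv e X 0 z v‖ := by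
    intro j
    induction j with
    | zero => simp
    | succ j ih =>
      intro hj
      have e3 : ((j + 1 : ℕ) : ℝ) * T = j * T + T := by push_cast; ring
      rw [e3]
      refine le_trans ?_ (ih (by omega))
      rw [pow_succ, mul_assoc]
      exact mul_le_mul_of_nonneg_left (h1 (k - j) j (by omega)).le (by positivity)
  exact h2 k le_rfl

end Passage

include hinj

/-- A hyperbolic set which is the omega-limit set of one of its points and contains a singularity
reduces to this singularity. -/
theorem HypRates.eq_singleton_of_eq_zero (h : HypRates e X Λ Es Eu B lam) {x : M} (hx : x ∈ Λ)
    (hω : Λ = omegaSet X x) {σ : M} (hσΛ : σ ∈ Λ) (hσ : X σ = 0) : Λ = {σ} := by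
  by_contra hne
  obtain ⟨p, hp, hpσ⟩ : ∃ p ∈ Λ, p ≠ σ := by
    by_contra! hcon
    exact hne (Subset.antisymm hcon (singleton_subset_iff.2 hσΛ))
  have hB0 : 0 < B := zero_lt_one.trans_le h.one_le
  have hcluster : ∀ q ∈ Λ, ∀ U ∈ 𝓝 q, ∃ᶠ t in atTop, flow X t x ∈ U := by
    intro q hq
    rw [hω] at hq
    exact mapClusterPt_iff_frequently.1 ((mem_omegaLimit_singleton_iff_mapClusterPt _ _ _ _).1 hq)
  have hσh := h.of_singleton hσΛ (invariantSet_singleton hX hin hσ)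
  have hσi := h.subset_interior hσΛ
  obtain ⟨T, A, hT, hA, hcone⟩ := hσh.exists_cone_criteria hX hin he hinj
    (Or.inl fun z hz => by rw [mem_singleton_iff.1 hz]; exact hσ)
  obtain ⟨hf, hb, hu, hs⟩ := hcone σ rfl
  have hWn := exists_nhds_cone_criteria hX hin he hinj hσi hT hA hf hb hu hs
  have hiso := hσh.eventually_eq_of_eq_zero hX hin he hinj hσ
  obtain ⟨r, hr, hrW⟩ := Metric.mem_nhds_iff.1 (hWn.and hiso)
  set η := min (r / 2) (dist p σ / 2)
  have hpσ' : 0 < dist p σ := dist_pos.2 hpσ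
  have hη : 0 < η := by positivity
  have hηr : ∀ z, dist z σ ≤ η → z ∈ Metric.ball σ r := fun z hz =>
    Metric.mem_ball.2 ((hz.trans (min_le_left _ _)).trans_lt (half_lt_self hr))
  have hηp : η < dist p σ := (min_le_right _ _).trans_lt (half_lt_self hpσ')
  -- A point within η' of σ stays strictly within η for time T. This keeps the last sampled point of
  -- the passage, less than T before the exit, at distance at least η' from σ.
  obtain ⟨η', hη', hη'T⟩ := Metric.mem_nhds_iff.1
    (eventually_flow_mem_of_eq_zero hX hin hσ T (Metric.ball_mem_nhds σ hη))
  have hcont := continuous_norm_embDeriv_self hX hin he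
  have hK : IsCompact {z | min η η' ≤ dist z σ ∧ dist z σ ≤ η} :=
    ((isClosed_le continuous_const (continuous_id.dist continuous_const)).inter
      (isClosed_le (continuous_id.dist continuous_const) continuous_const)).isCompact
  obtain ⟨c₀, hc₀, hc₀le⟩ : ∃ c₀ : ℝ, 0 < c₀ ∧ ∀ z, min η η' ≤ dist z σ → dist z σ ≤ η →
      c₀ ≤ ‖embDeriv e X 0 z (X z)‖ := by
    rcases eq_empty_or_nonempty {z | min η η' ≤ dist z σ ∧ dist z σ ≤ η} with h0 | h0
    · exact ⟨1, one_pos, fun z h1 h2 => absurd (show z ∈ (∅ : Set M) from h0 ▸ ⟨h1, h2⟩)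
        (notMem_empty z)⟩
    obtain ⟨w, hw, hwmin⟩ := hK.exists_isMinOn h0 hcont.continuousOn
    refine ⟨_, norm_pos_iff.2 fun h1 => ?_, fun z h1 h2 => hwmin ⟨h1, h2⟩⟩
    have hw0 : X w = 0 := by
      rw [embDeriv_zero hX hin] at h1
      exact hinj w (h1.trans (map_zero _).symm)
    have hwσ := (hrW (hηr w hw.2)).2 hw0
    have h2 := hw.1
    rw [hwσ, dist_self] at h2
    exact (lt_min hη hη').not_ge h2
  obtain ⟨m, hm⟩ := (isCompact_range hcont).bddAbove
  have hXm : ∀ z, ‖embDeriv e X 0 z (X z)‖ ≤ m := fun z => hm (mem_range_self z)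
  have hm0 : 0 ≤ m := (norm_nonneg _).trans (hXm σ)
  obtain ⟨C₁, hC₁, hproj₁⟩ :=
    h.exists_projection_stable_le hX hin he hinj hc₀ hm0 hXm
  obtain ⟨C₂, hC₂, hproj₂⟩ :=
    h.exists_projection_unstable_le hX hin he hinj hc₀ hm0 hXm
  -- `D` bounds the forward growth on E^s ⊕ E^X and the backward growth on E^u ⊕ E^X whatever the
  -- length of the passage. The passage is then taken so long that A^k > D.
  set D := (B + m / c₀) * max C₁ C₂
  obtain ⟨k₀, hk₀⟩ := pow_unbounded_of_one_lt D hA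
  have hN : 0 ≤ k₀ * T := mul_nonneg (Nat.cast_nonneg _) hT.le
  obtain ⟨a, b, ha, hab, haη, hbη, hpass⟩ := exists_long_passage
    (continuousOn_flow hX hin x) hηp (hcluster σ hσΛ) (hcluster p hp) hN
    ⟨_, eventually_flow_mem_of_eq_zero hX hin hσ (k₀ * T) (Metric.ball_mem_nhds σ hη),
      fun t ht hU s hs => by
        rw [flow_add hX hin ht hs.1]
        exact hU s hs⟩
  have hba : 0 ≤ (b - a) / T := div_nonneg (by linarith) hT.le
  set k := ⌊(b - a) / T⌋₊
  have hk1 : k * T ≤ b - a := (le_div_iff₀ hT).1 (Nat.floor_le hba)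
  have hk2 : b - a < (k + 1) * T := (div_lt_iff₀ hT).1 (Nat.lt_floor_add_one _)
  have hkk : k₀ ≤ k := Nat.le_floor ((le_div_iff₀ hT).2 (by linarith))
  have hDk : D < A ^ k := hk₀.trans_le (pow_le_pow_right₀ hA.le hkk)
  have hk0 : 0 ≤ k * T := mul_nonneg (Nat.cast_nonneg _) hT.le
  set z := flow X a x
  have hzΛ : z ∈ Λ := h.image_eq.flow_mem hx ha
  have hzi := h.subset_interior hzΛ
  have hzj : ∀ t : ℝ, 0 ≤ t → t ≤ b - a → dist (flow X t z) σ ≤ η := by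
    intro t ht htb
    rw [← flow_add hX hin ha ht]
    exact hpass _ ⟨by linarith, by linarith⟩
  have hWj : ∀ j : ℕ, j ≤ k → flow X (j * T) z ∈ Metric.ball σ r := by
    intro j hj
    refine hηr _ (hzj _ (mul_nonneg (Nat.cast_nonneg _) hT.le) (le_trans ?_ hk1))
    gcongr
  set w := flow X (k * T) z
  have hwΛ : w ∈ Λ := h.image_eq.flow_mem hzΛ hk0
  have hwη' : η' ≤ dist w σ := by
    by_contra! hcon
    have h1 := hη'T hcon (b - a - k * T) ⟨by linarith, by linarith⟩
    rw [← flow_add hX hin hk0 (by linarith), ← flow_add hX hin ha (by linarith),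
      show a + (k * T + (b - a - k * T)) = b by ring, Metric.mem_ball, hbη] at h1
    exact lt_irrefl _ h1
  have hzc : c₀ ≤ ‖embDeriv e X 0 z (X z)‖ :=
    hc₀le z ((min_le_left _ _).trans haη.ge) haη.le
  have hwc : c₀ ≤ ‖embDeriv e X 0 w (X w)‖ :=
    hc₀le w ((min_le_right _ _).trans hwη') (hzj _ hk0 hk1)
  have hXz : X z ≠ 0 := by
    intro h0
    rw [h0, map_zero, norm_zero] at hzc
    exact hc₀.not_ge hzc
  have hpos : ∀ t : ℝ, 0 ≤ t → ∀ v : TangentSpace (𝓡∂ n) z, v ≠ 0 →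
      0 < ‖embDeriv e X t z v‖ := by
    intro t ht v hv
    refine norm_pos_iff.2 fun h0 => hv ?_
    exact injective_embDeriv hX hin he hinj hzi ht (h0.trans (map_zero _).symm)
  have hcX : ∀ c : ℝ, ∀ r s : M, c₀ ≤ ‖embDeriv e X 0 s (X s)‖ →
      ‖embDeriv e X 0 r (c • X r)‖ ≤ m / c₀ * ‖embDeriv e X 0 s (c • X s)‖ := by
    intro c r s hs
    rw [map_smul, map_smul, norm_smul, norm_smul]
    calc ‖c‖ * ‖embDeriv e X 0 r (X r)‖ ≤ ‖c‖ * m := by gcongr; exact hXm r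
      _ = m / c₀ * (‖c‖ * c₀) := by field_simp
      _ ≤ _ := by gcongr
  have hwX : ∀ c : ℝ, embDeriv e X (k * T) z (c • X z) = embDeriv e X 0 w (c • X w) := fun c => by
    rw [map_smul, map_smul, embDeriv_self hX hin he hzi hk0]
  have hdimσ := h.finrank_add_finrank_of_eq_zero hσΛ hσ
  have hdimz := h.finrank_add_finrank_of_ne_zero hzΛ hXz
  have hBm : 0 ≤ m / c₀ := div_nonneg hm0 hc₀.le
  -- At σ the dimensions of E^s and E^u sum to n, at z to n - 1. If dim E^s(σ) ≤ dim E^s(z), then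
  -- E^s ⊕ E^X at z is too large to avoid a subspace of dimension dim E^u(σ); otherwise E^u ⊕ E^X is
  -- too large to avoid one of dimension dim E^s(σ).
  rcases lt_or_ge (Module.finrank ℝ (Es σ)) (Module.finrank ℝ (Es z) + 1) with hdim | hdim
  · obtain ⟨Q, hQ, hQv⟩ := (hrW (hηr z haη.le)).1.2.2.1
    obtain ⟨v, hvP, hvQ, hv0⟩ := exists_mem_inf_ne_zero
      (P := Es z ⊔ Submodule.span ℝ {X z}) (Q := Q) (by
        rw [hQ, finrank_sup_span_singleton (h.splitting.disjoint z hzΛ) hXz, finrank_tangentSpace]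
        omega)
    have hgrow := pow_mul_norm_embDeriv_le hX hin he hT hA hzi
      (fun j hj => (hrW (hWj j hj)).1.1) (hQv v hvQ hv0)
    obtain ⟨s, hs, y, hy, hsy⟩ := Submodule.mem_sup.1 hvP
    obtain ⟨c, rfl⟩ := Submodule.mem_span_singleton.1 hy
    obtain ⟨p1, p2⟩ := hproj₁ z hzΛ hzc s hs c
    rw [hsy] at p1 p2
    have hbound : ‖embDeriv e X (k * T) z v‖ ≤ D * ‖embDeriv e X 0 z v‖ :=
      calc ‖embDeriv e X (k * T) z v‖
          ≤ ‖embDeriv e X (k * T) z s‖ + ‖embDeriv e X (k * T) z (c • X z)‖ := by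
            rw [← hsy, map_add]; exact norm_add_le _ _
        _ ≤ B * ‖embDeriv e X 0 z s‖ + m / c₀ * ‖embDeriv e X 0 z (c • X z)‖ := by
            refine add_le_add ((h.stable z hzΛ _ hk0 s hs).trans ?_) ?_
            · gcongr; exact h.mul_exp_le hk0
            · rw [hwX]; exact hcX c w z hzc
        _ ≤ B * (C₁ * ‖embDeriv e X 0 z v‖) + m / c₀ * (C₁ * ‖embDeriv e X 0 z v‖) := by gcongr
        _ = (B + m / c₀) * C₁ * ‖embDeriv e X 0 z v‖ := by ring
        _ ≤ D * ‖embDeriv e X 0 z v‖ := by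
            simp only [D]; gcongr; exact le_max_left _ _
    exact (mul_lt_mul_of_pos_right hDk (hpos 0 le_rfl v hv0)).not_ge (hgrow.trans hbound)
  · obtain ⟨Q, hQ, hQv⟩ := (hrW (hWj k le_rfl)).1.2.2.2
    have hdisj : Disjoint (Eu z) (Submodule.span ℝ {X z}) :=
      ((h.splitting.isCompl z hzΛ).disjoint.mono_left le_sup_right).symm
    have hDi := injective_dflow hX hin hzi hk0
    -- The intersection is taken at the end `w` of the passage, where the backward cone is
    -- available; injectivity of the derivative preserves the dimension of the transported subspace.
    obtain ⟨v', hvP, hvQ, hv0'⟩ := exists_mem_inf_ne_zero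
      (P := (Eu z ⊔ Submodule.span ℝ {X z}).map (dflow X (k * T) z).toLinearMap) (Q := Q) (by
        rw [hQ, ← (Submodule.equivMapOfInjective (dflow X (k * T) z).toLinearMap hDi
          (Eu z ⊔ Submodule.span ℝ {X z})).finrank_eq, finrank_sup_span_singleton hdisj hXz,
          finrank_tangentSpace]
        omega)
    obtain ⟨v, hvP, rfl⟩ := hvP
    have hv0 : v ≠ 0 := by
      rintro rfl
      exact hv0' (map_zero _)
    have hgrow := pow_mul_norm_embDeriv_le_zero hX hin he hT hA hzi
      (fun j hj => (hrW (hWj j hj)).1.2.1) (hQv _ hvQ hv0')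
    obtain ⟨u, hu, y, hy, huy⟩ := Submodule.mem_sup.1 hvP
    obtain ⟨c, rfl⟩ := Submodule.mem_span_singleton.1 hy
    obtain ⟨p1, p2⟩ := hproj₂ w hwΛ hwc _ (h.splitting.dflow_unstable hzΛ hk0 hu) c
    have hDv : dflow X (k * T) z u + c • X w = dflow X (k * T) z v := by
      rw [← huy, map_add, map_smul, dflow_apply_self hX hin hzi hk0]
    rw [hDv, ← embDeriv_eq hX hin he hzi hk0] at p1 p2
    rw [← embDeriv_eq hX hin he hzi hk0] at p1
    have hbound : ‖embDeriv e X 0 z v‖ ≤ D * ‖embDeriv e X (k * T) z v‖ :=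
      calc ‖embDeriv e X 0 z v‖
          ≤ ‖embDeriv e X 0 z u‖ + ‖embDeriv e X 0 z (c • X z)‖ := by
            rw [← huy, map_add]; exact norm_add_le _ _
        _ ≤ B * ‖embDeriv e X (k * T) z u‖ + m / c₀ * ‖embDeriv e X 0 w (c • X w)‖ := by
            refine add_le_add ((h.unstable z hzΛ _ hk0 u hu).trans ?_) (hcX c z w hwc)
            gcongr; exact h.mul_exp_le hk0
        _ ≤ B * (C₂ * ‖embDeriv e X (k * T) z v‖) + m / c₀ * (C₂ * ‖embDeriv e X (k * T) z v‖) := by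
            gcongr
        _ = (B + m / c₀) * C₂ * ‖embDeriv e X (k * T) z v‖ := by ring
        _ ≤ D * ‖embDeriv e X (k * T) z v‖ := by
            simp only [D]; gcongr; exact le_max_right _ _
    exact (mul_lt_mul_of_pos_right hDk (hpos (k * T) hk0 v hv0)).not_ge (hgrow.trans hbound)

end HypAttr

/-! ### Conclusion: from separation on basins to sensitivity. -/

namespace HypAttr

variable {n : ℕ} [NeZero n] {M : Type*} [MetricSpace M]
  [ChartedSpace (EuclideanHalfSpace n) M] [IsManifold (𝓡∂ n) ∞ M]
  {X : ∀ x : M, TangentSpace (𝓡∂ n) x} [CompactSpace M]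
  (hX : ContMDiff (𝓡∂ n) (𝓡∂ n).tangent 1 (fun x => (⟨x, X x⟩ : TangentBundle (𝓡∂ n) M)))
  (hin : InwardlyTransverse X)

include hX hin

/-- An embedding in Euclidean space supplies e. In the transitive case a singularity in Λ forces Λ
to be a singleton, so X vanishes everywhere or nowhere on Λ. -/
theorem SaddleHyperbolicSet.exists_separation {Λ : Set M} (h : SaddleHyperbolicSet X Λ)
    (hΛ : (∀ z ∈ Λ, X z = 0) ∨ ∃ x ∈ Λ, Λ = omegaSet X x) :
    ∃ δ : ℝ, 0 < δ ∧ ∀ y ∈ basin X Λ, ∀ V ∈ 𝓝 y, ∃ y' ∈ V, ∃ t : ℝ, 0 ≤ t ∧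
      δ < dist (flow X t y) (flow X t y') := by
  obtain ⟨N, e, he, hemb, hinj⟩ := exists_embedding_euclidean_of_compact (I := 𝓡∂ n) (M := M)
  obtain ⟨hc, hinv, Es, Eu, hsplit, hne⟩ := h
  have he1 : ContMDiff (𝓡∂ n) 𝓘(ℝ, EuclideanSpace ℝ (Fin N)) 1 e := he.of_le (by simp)
  obtain ⟨B, lam, hr⟩ := hsplit.exists_hypRates hX hin he1 hinj hc hinv
  refine hr.exists_separation hX hin he1 hinj hemb.injective ?_ fun z hz => (hne z hz).2
  rcases hΛ with h0 | ⟨x, hx, hω⟩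
  · exact Or.inl h0
  · by_cases hz : ∃ σ ∈ Λ, X σ = 0
    · obtain ⟨σ, hσΛ, hσ⟩ := hz
      rw [hr.eq_singleton_of_eq_zero hX hin he1 hinj hx hω hσΛ hσ]
      exact Or.inl fun z hz => by rw [mem_singleton_iff.1 hz]; exact hσ
    · push Not at hz
      exact Or.inr hz

omit [IsManifold (𝓡∂ n) ∞ M] [CompactSpace M] hX hin in
-- Near x pick y in some basin and then y' separating from y by more than ε; at that time one of y,
-- y' is more than ε/2 from the orbit of x.
theorem sensitiveToInitialConditions_of_dense_basins {𝒞 : Set (Set M)} (h𝒞 : 𝒞.Finite)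
    (hsep : ∀ Λ ∈ 𝒞, ∃ δ : ℝ, 0 < δ ∧ ∀ y ∈ basin X Λ, ∀ V ∈ 𝓝 y, ∃ y' ∈ V, ∃ t : ℝ, 0 ≤ t ∧
      δ < dist (flow X t y) (flow X t y'))
    (hdense : Dense (⋃ Λ ∈ 𝒞, basin X Λ)) : SensitiveToInitialConditions X := by
  choose! δ hδ hsep using hsep
  obtain ⟨ε, hε, hεδ⟩ : ∃ ε : ℝ, 0 < ε ∧ ∀ Λ ∈ 𝒞, ε ≤ δ Λ := by
    rcases 𝒞.eq_empty_or_nonempty with rfl | hne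
    · exact ⟨1, one_pos, by simp⟩
    · obtain ⟨Λ, hΛ, hmin⟩ := h𝒞.exists_minimalFor δ 𝒞 hne
      exact ⟨δ Λ, hδ Λ hΛ, fun Λ' hΛ' => (le_total (δ Λ) (δ Λ')).elim id (hmin hΛ')⟩
  refine ⟨ε / 2, half_pos hε, fun x U hU => ?_⟩
  obtain ⟨y, hyU, hy⟩ := hdense.inter_open_nonempty _ isOpen_interior
    ⟨x, mem_interior_iff_mem_nhds.2 hU⟩
  obtain ⟨Λ, hΛ, hyΛ⟩ := mem_iUnion₂.1 hy
  obtain ⟨y', hy', t, ht, hlt⟩ := hsep Λ hΛ y hyΛ U (mem_interior_iff_mem_nhds.1 hyU)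
  have h1 := hεδ Λ hΛ
  have h2 := dist_triangle_left (flow X t y) (flow X t y') (flow X t x)
  by_cases h3 : ε / 2 < dist (flow X t x) (flow X t y)
  · exact ⟨y, interior_subset hyU, t, ht, h3⟩
  · exact ⟨y', hy', t, ht, by linarith⟩

end HypAttr

end

theorem mainTheorem6 {n : ℕ} [NeZero n] {M : Type*} [MetricSpace M] [CompactSpace M]
    [ChartedSpace (EuclideanHalfSpace n) M] [IsManifold (𝓡∂ n) ∞ M]
    (X : ∀ x : M, TangentSpace (𝓡∂ n) x)
    (hX : ContMDiff (𝓡∂ n) (𝓡∂ n).tangent 1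
      (fun x => (⟨x, X x⟩ : TangentBundle (𝓡∂ n) M)))
    (hin : HypAttr.InwardlyTransverse X)
    (𝒜 : Set (Set M)) (h𝒜 : 𝒜.Finite)
    (hA : ∀ A ∈ 𝒜, HypAttr.SaddleHyperbolicAttractor X A)
    (S : Set M) (hS : S.Finite)
    (hσ : ∀ σ ∈ S, HypAttr.SaddleHyperbolicSingularity X σ)
    (hdense : Dense ((⋃ A ∈ 𝒜, HypAttr.basin X A) ∪ ⋃ σ ∈ S, HypAttr.basin X {σ})) :
    HypAttr.SensitiveToInitialConditions X := by
  refine HypAttr.sensitiveToInitialConditions_of_dense_basins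
    (𝒞 := 𝒜 ∪ (fun σ => {σ}) '' S) (h𝒜.union (hS.image _)) ?_ ?_
  · rintro Λ (hΛ | ⟨σ, hσS, rfl⟩)
    · exact (hA Λ hΛ).2.exists_separation hX hin (Or.inr (hA Λ hΛ).1.1.2)
    · refine (hσ σ hσS).2.exists_separation hX hin (Or.inl fun z hz => ?_)
      rw [mem_singleton_iff.1 hz]
      exact (hσ σ hσS).1
  · rwa [biUnion_union, biUnion_image]
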